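/- Let $I=[0,1]$, let $m$ be Lebesgue measure on $I$, and write $\|\cdot\|_p$ for the norm of $L^p(m)$. For integrable $f$ let $Vf=\inf\{\operatorname{var}\bar f:\bar f=f\ \text{a.e.}\}$ be the (essential) total variation, $BV=\{f\in L^1: Vf<\infty\}$, and $\|f\|_{BV}=Vf+\|f\|_1$. Let $T:I\to I$ be measurable, piecewise $C^2$ and expanding: up to a null set $I$ is a finite or countable disjoint union of open intervals on each of which $T$ is $C^2$, and $|T'|\ge\lambda$ on these intervals for some $\lambda>1$. Let $P:L^1\to L^1$ be its transfer operator, $\int f\cdot g\circ T\,dm=\int Pf\cdot g\,dm$ for $f\in L^1$, $g\in L^\infty$. Assume: (A1) there are $\alpha\in(0,1)$ and $B_0\ge0$ with $VPf\le\alpha Vf+B_0\|f\|_1$ for all $f\in BV$; (A2) $1$ is a simple eigenvalue of $P$ on (complex) $BV$, and $P$ has no other eigenvalue of modulus $1$ on $BV$. Then $P$ has a unique fixed probability density $h$, and $h\in BV$. Moreover there are $C_*>0$ and $\rho_*\in(\alpha,1)$ such that $$\|P^kg\|_1\le C_*\rho_*^k\|g\|_{BV}\qquad\text{for all } k\ge0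 \text{ and all } g\in BV \text{ with } \textstyle\int g\,dm=0. \tag{1}$$ Let $\psi\in BV$ be real-valued and $d\nu=h\,dm$. Then the limit $$\sigma^2=\lim_{n\to\infty}\frac1n\int_I\Big(\sum_{i=0}^{n-1}\psi\circ T^i-n\int_I\psi\,d\nu\Big)^2d\nu$$ exists. For a partition $\eta$ of $I$ into finitely many intervals of positive length at most $\varepsilon$, let $\Pi_\varepsilon f=E(f\mid\mathfrak B_\eta)$ be the conditional expectation with respect to the $\sigma$-algebra generated by $\eta$, and let $P_\varepsilon=\Pi_\varepsilon P\,\Pi_\varepsilon$ be Ulam's approximation of $P$. **Theorem.** There are $\varepsilon_0\in(0,1)$ and a constant $\tilde K_*$, both computable, such that for every $0<\varepsilon\le\varepsilon_0$ and every such partition $\eta$ the following holds. The operator $P_\varepsilon$ has a unique fixed probability density $h_\varepsilon$, and $h_\varepsilon\in BV$. With $\hat\psi_\varepsilon=\psi-\int_I\psi h_\varepsilon\,dm$, the series in $$\sigma^2_\varepsilon:=\int_I\hat\psi_\varepsilon^2h_\varepsilon\,dm+2\sum_{i=1}^\infty\int_IP_\varepsilon^i(\hat\psi_\varepsilon h_\varepsilon)\,\hat\psi_\varepsilon\,dm$$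 converges. Equivalently, $$\sigma_\varepsilon^2=-\int_I\hat\psi_\varepsilon^2h_\varepsilon\,dm+2\int_I\hat\psi_\varepsilon\,(1-P_\varepsilon)^{-1}(\hat\psi_\varepsilon h_\varepsilon)\,dm,$$ where $(1-P_\varepsilon)^{-1}(\hat\psi_\varepsilon h_\varepsilon)$ is the unique $g\in L^1$ with $\int g\,dm=0$ and $g-P_\varepsilon g=\hat\psi_\varepsilon h_\varepsilon$. Finally, $$|\sigma^2_\varepsilon-\sigma^2|\le\tilde K_*\,\varepsilon\,(\ln\varepsilon^{-1})^2 .$$ Here "computable" means the following. There are computable functions $N:\mathbb N^4\to\mathbb N_{\geq 2}$ and $K:\mathbb N^6\to\mathbb N$, the same for all $T$ and $\psi$, such that for all constants $C_*>0$, $\rho_*\in(0,1)$ satisfying (1) and all natural numbers $a\ge\frac1{1-\alpha}$, $b\ge B_0$, $c\ge C_*$, $r\ge\frac1{1-\rho_*}$, $M\ge\|\psi\|_\infty$, $W\ge V\psi$ one may take $\varepsilon_0=1/N(a,b,c,r)$ and $\tilde K_*=K(a,b,c,r,M,W)$. -/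

import Mathlib

open MeasureTheory Set Filter Topology

noncomputable section

namespace UlamDiffusion

/-- Lebesgue measure `m` on `I = [0,1]`. Functions on `I` are functions on `ℝ`, considered modulo
`m`-null sets. -/
def m : Measure ℝ := volume.restrict (Icc (0 : ℝ) 1)

/-- `V f`: the infimum, over all `g` equal to `f` almost everywhere, of the variation of `g`
on `[0,1]`. -/
def essVar {E : Type*} [NormedAddCommGroup E] (f : ℝ → E) : ENNReal :=
  ⨅ (g : ℝ → E) (_ : g =ᵐ[m] f), eVariationOn g (Icc (0 : ℝ) 1)

/-- `f ∈ BV`. -/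
def MemBV {E : Type*} [NormedAddCommGroup E] (f : ℝ → E) : Prop :=
  Integrable f m ∧ essVar f ≠ ⊤

/-- `‖f‖_BV = V f + ‖f‖₁`. -/
def bvNorm (f : ℝ → ℝ) : ENNReal := essVar f + eLpNorm f 1 m

/-- A map `T : [0,1] → [0,1]` which is piecewise `C²` and expanding, with finitely or countably
many branches: up to a null set, `[0,1]` is a disjoint union of open intervals (some of which may
be empty), on each of which `T` is `C²`, and `|T'|` is bounded below on their union by a constant
larger than `1`. -/
structure IsPiecewiseExpanding (T : ℝ → ℝ) : Prop where
  measurable : Measurable T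
  mapsTo : MapsTo T (Icc 0 1) (Icc 0 1)
  branches : ∃ u v : ℕ → ℝ,
    (∀ k, Ioo (u k) (v k) ⊆ Icc 0 1) ∧
    (∀ j k, j ≠ k → Disjoint (Ioo (u j) (v j)) (Ioo (u k) (v k))) ∧
    m (⋃ k, Ioo (u k) (v k))ᶜ = 0 ∧
    (∀ k, ContDiffOn ℝ 2 T (Ioo (u k) (v k))) ∧
    ∃ c : ℝ, 1 < c ∧ ∀ k, ∀ x ∈ Ioo (u k) (v k), c ≤ |deriv T x|

/-- The transfer operator: `P f` is the density with respect to `m` of the push-forward under `T`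
of the signed measure `f m`. Hence `∫ f · (g ∘ T) dm = ∫ (P f) · g dm` for bounded `g`. -/
def transfer (T : ℝ → ℝ) (f : ℝ → ℝ) : ℝ → ℝ :=
  SignedMeasure.rnDeriv ((m.withDensityᵥ f).map T) m

/-- The complexification of the transfer operator. -/
def transferC (T : ℝ → ℝ) (f : ℝ → ℂ) : ℝ → ℂ := fun x =>
  (transfer T (fun y => (f y).re) x : ℂ) + (transfer T (fun y => (f y).im) x : ℂ) * Complex.I

/-- Assumption (A1), the Lasota-Yorke inequality `V (P f) ≤ α V f + B₀ ‖f‖₁` on `BV`. -/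
def A1 (T : ℝ → ℝ) (α B₀ : ℝ) : Prop :=
  ∀ f : ℝ → ℝ, MemBV f →
    essVar (transfer T f) ≤ ENNReal.ofReal α * essVar f + ENNReal.ofReal B₀ * eLpNorm f 1 m

/-- `f` is an eigenfunction in (complex) `BV` of the transfer operator for the eigenvalue `z`. -/
def IsEigenfunction (T : ℝ → ℝ) (z : ℂ) (f : ℝ → ℂ) : Prop :=
  MemBV f ∧ ¬ f =ᵐ[m] 0 ∧ transferC T f =ᵐ[m] fun x => z * f x

/-- Assumption (A2): `1` is a simple eigenvalue of `P` on `BV`, and there is no other eigenvalue of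
modulus `1`. Simplicity is required in the weaker, geometric sense (one-dimensional eigenspace);
as all powers of `P` are contractions of `L¹`, there are no Jordan blocks at the eigenvalue `1`,
so that this amounts to algebraic simplicity. -/
def A2 (T : ℝ → ℝ) : Prop :=
  (∃ f, IsEigenfunction T 1 f ∧
    ∀ g, IsEigenfunction T 1 g → ∃ c : ℂ, g =ᵐ[m] fun x => c * f x) ∧
  ∀ z : ℂ, ‖z‖ = 1 → (∃ f, IsEigenfunction T z f) → z = 1

/-- Exponential decay `‖Pᵏ g‖₁ ≤ C ρᵏ ‖g‖_BV` for all `g ∈ BV` with `∫ g dm = 0`. -/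
def HasDecay (T : ℝ → ℝ) (C ρ : ℝ) : Prop :=
  ∀ g : ℝ → ℝ, MemBV g → ∫ x, g x ∂m = 0 → ∀ k : ℕ,
    eLpNorm ((transfer T)^[k] g) 1 m ≤ ENNReal.ofReal (C * ρ ^ k) * bvNorm g

/-- `h` is a probability density fixed by the operator `Q`. -/
structure IsFixedDensity (Q : (ℝ → ℝ) → ℝ → ℝ) (h : ℝ → ℝ) : Prop where
  integrable : Integrable h m
  nonneg : 0 ≤ᵐ[m] h
  integral_eq : ∫ x, h x ∂m = 1
  fixed : Q h =ᵐ[m] h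

/-- `h` is the unique (modulo null sets) probability density fixed by `Q`, and it lies in `BV`. -/
def IsUniqueFixedDensity (Q : (ℝ → ℝ) → ℝ → ℝ) (h : ℝ → ℝ) : Prop :=
  IsFixedDensity Q h ∧ MemBV h ∧ ∀ h', IsFixedDensity Q h' → h' =ᵐ[m] h

/-- A finite partition of `[0,1]` into intervals of positive length, given by its nodes
`0 = a₀ < a₁ < ⋯ < a_d = 1`. -/
structure IntervalPartition where
  d : ℕ
  node : Fin (d + 1) → ℝ
  strictMono : StrictMono node
  node_zero : node 0 = 0
  node_last : node (Fin.last d) = 1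

/-- The `k`-th interval of the partition (the endpoint `1`, a null set, is left out). -/
def IntervalPartition.cell (η : IntervalPartition) (k : Fin η.d) : Set ℝ :=
  Ico (η.node k.castSucc) (η.node k.succ)

/-- All intervals of the partition have length at most `ε`. -/
def IntervalPartition.MeshLE (η : IntervalPartition) (ε : ℝ) : Prop :=
  ∀ k : Fin η.d, η.node k.succ - η.node k.castSucc ≤ ε

/-- The `σ`-algebra generated by the partition. -/
abbrev IntervalPartition.sigma (η : IntervalPartition) : MeasurableSpace ℝ :=
  MeasurableSpace.generateFrom (range η.cell)

/-- The projection `Π f = E(f | 𝔅_η)`. -/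
def proj (η : IntervalPartition) (f : ℝ → ℝ) : ℝ → ℝ :=
  condExp η.sigma m f

/-- Ulam's approximation `Π ∘ P ∘ Π` of the transfer operator. -/
def ulam (T : ℝ → ℝ) (η : IntervalPartition) (f : ℝ → ℝ) : ℝ → ℝ :=
  proj η (transfer T (proj η f))

/-- `ψ - ∫ ψ h dm`. -/
def centered (ψ h : ℝ → ℝ) : ℝ → ℝ := fun x => ψ x - ∫ y, ψ y * h y ∂m

/-- `σ²` is the diffusion coefficient of `ψ`: the limit as `n → ∞` of
`(1/n) ∫ (∑_{i<n} ψ ∘ Tⁱ - n ∫ ψ dν)² dν`, where `dν = h dm`. -/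
def IsDiffusionCoefficient (T ψ h : ℝ → ℝ) (σsq : ℝ) : Prop :=
  Tendsto (fun n : ℕ => (1 / (n : ℝ)) *
      ∫ x, (∑ i ∈ Finset.range n, ψ (T^[i] x) - n * ∫ y, ψ y * h y ∂m) ^ 2 * h x ∂m)
    atTop (𝓝 σsq)

/-- With `φ = ψ - ∫ ψ h dm`: the series `∑_{i ≥ 1} ∫ Qⁱ(φ h) φ dm` converges and
`s = ∫ φ² h dm + 2 ∑_{i ≥ 1} ∫ Qⁱ(φ h) φ dm`. -/
def IsSeriesCoefficient (Q : (ℝ → ℝ) → ℝ → ℝ) (ψ h : ℝ → ℝ) (s : ℝ) : Prop :=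
  ∃ S : ℝ,
    HasSum (fun i : ℕ => ∫ x, (Q^[i + 1] (fun y => centered ψ h y * h y)) x * centered ψ h x ∂m)
      S ∧
    s = ∫ x, centered ψ h x ^ 2 * h x ∂m + 2 * S

/-- `g` represents `(1 - Q)⁻¹ f`: it is the unique integrable function of mean zero with
`g - Q g = f`. -/
def IsResolvent (Q : (ℝ → ℝ) → ℝ → ℝ) (f g : ℝ → ℝ) : Prop :=
  (Integrable g m ∧ ∫ x, g x ∂m = 0 ∧ g - Q g =ᵐ[m] f) ∧
  ∀ g', Integrable g' m → ∫ x, g' x ∂m = 0 → g' - Q g' =ᵐ[m] f → g' =ᵐ[m] g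

/-- With `φ = ψ - ∫ ψ h dm`: `s = -∫ φ² h dm + 2 ∫ φ (1 - Q)⁻¹(φ h) dm`. -/
def IsResolventCoefficient (Q : (ℝ → ℝ) → ℝ → ℝ) (ψ h : ℝ → ℝ) (s : ℝ) : Prop :=
  ∃ g : ℝ → ℝ, IsResolvent Q (fun x => centered ψ h x * h x) g ∧
    s = -∫ x, centered ψ h x ^ 2 * h x ∂m + 2 * ∫ x, centered ψ h x * g x ∂m

end UlamDiffusion

end

/-! The operators are compared in two norms: the weak norm of `L¹` and the strong norm of `BV`. By
(A1) the transfer operator `P` contracts the weak norm and its iterates are bounded in the strong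
one. Ulam's operator `Q = ΠPΠ` inherits this with the same constants, because averaging over cells
increases neither the `L¹` norm nor the variation and keeps the integral (`ulamL_LY`). Moreover `P -
Q` has size `O(ε)` as a map from `BV` to `L¹` (`norm_transferL_sub_ulamL_le`), so that by
telescoping `Pᵏ - Qᵏ` has size `O(kε)` (`norm_pow_sub_pow_le`).

The spectral gap passes from `P` to `Q`. Fix `n` such that `Pⁿ` is small from mean zero `BV`
functions to `L¹`. If `nε` is small enough, the same holds for `Qⁿ`, and the Lasota-Yorke inequality
converts weak smallness after `n` steps into a strong contraction after `2n` steps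
(`decays_of_close`). The decay is thus uniform over all fine partitions. It yields the fixed density
of `Q`, the convergence of the series, and the resolvent as a Neumann series.

For the error estimate take `n` of order `log ε⁻¹`, so that decay has reached the size `ε`. The
fixed densities then differ by `O(ε log ε⁻¹)`. Each of the first `n` terms of the two series differs
by as much, which adds up to `O(ε (log ε⁻¹)²)`, while the tails are `O(ε)`
(`abs_coefficient_sub_le`).

That `P` itself decays follows from (A2) by compactness. Balls of `BV` are precompact in `L¹`, so
the orbit of a mean zero function has a limit point, and this limit point is recurrent. Recurrent
functions form a finite-dimensional invariant space, whose eigenvalues have modulus one; (A2)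
excludes them, so the space is zero and the orbit tends to zero (`tendsto_pow_of_noPeripheral`). The
limit defining `σ²` is a Cesàro mean of partial sums of the correlation series. The constants are
computable because every choice is polynomial in the given bounds: if `(1 - t)⁻¹ ≤ a` then `tⁿ ≤ a /
n`, and no logarithm is needed. -/

noncomputable section

namespace UlamDiffusion

open scoped ENNReal

/-! ### Essential variation -/

instance : IsProbabilityMeasure m := ⟨by simp [m]⟩

theorem eVariationOn_const {E : Type*} [NormedAddCommGroup E] (c : E) (s : Set ℝ) :
    eVariationOn (fun _ => c) s = 0 :=
  eVariationOn.constant_on (by rintro _ ⟨_, _, rfl⟩ _ ⟨_, _, rfl⟩; rfl)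

/-- A function of bounded variation on a set extends to the line without increase of variation. -/
theorem exists_extension_eVariationOn_le {f : ℝ → ℝ} {s : Set ℝ} (hf : BoundedVariationOn f s) :
    ∃ g : ℝ → ℝ, EqOn g f s ∧ eVariationOn g univ ≤ eVariationOn f s := by
  rcases s.eq_empty_or_nonempty with rfl | ⟨a, ha⟩
  · refine ⟨fun _ => 0, by simp, ?_⟩
    rw [eVariationOn_const]
    exact zero_le
  have hl := hf.locallyBoundedVariationOn
  set V := (eVariationOn f s).toReal with hV
  set p := variationOnFromTo f s a with hp
  have hmono : MonotoneOn p s := variationOnFromTo.monotoneOn hl ha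
  have hdiff : ∀ b ∈ s, ∀ c ∈ s, p c - p b ≤ V := by
    intro b hb c hc
    rw [hp, variationOnFromTo.sub_right hl ha hc hb]
    exact (le_abs_self _).trans (variationOnFromTo.abs_le_eVariationOn hf)
  have hbb : BddBelow (p '' s) :=
    ⟨p a - V, by rintro _ ⟨b, hb, rfl⟩; linarith [hdiff b hb a ha]⟩
  have hba : BddAbove (p '' s) :=
    ⟨p a + V, by rintro _ ⟨b, hb, rfl⟩; linarith [hdiff a ha b hb]⟩
  have hne : (p '' s).Nonempty := ⟨p a, a, ha, rfl⟩
  obtain ⟨p', hp'm, hp'⟩ := hmono.exists_monotone_extension hbb hba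
  set lo := sInf (p '' s)
  set hi := sSup (p '' s)
  have hlohi : hi - lo ≤ V := by
    have : ∀ b ∈ s, p b - V ≤ lo := fun b hb => by
      refine le_csInf hne ?_
      rintro _ ⟨c, hc, rfl⟩
      linarith [hdiff c hc b hb]
    have : hi ≤ lo + V := by
      refine csSup_le hne ?_
      rintro _ ⟨c, hc, rfl⟩
      linarith [this c hc]
    linarith
  -- Truncating at the extreme values of `p` on `s` keeps the total increase over the whole line at
  -- most `hi - lo ≤ V`.
  set q : ℝ → ℝ := fun x => max lo (min hi (p' x))
  have hqm : Monotone q := fun x y hxy => max_le_max le_rfl (min_le_min le_rfl (hp'm hxy))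
  have hqe : EqOn q p s := fun x hx => by
    have h1 : lo ≤ p x := csInf_le hbb ⟨x, hx, rfl⟩
    have h2 : p x ≤ hi := le_csSup hba ⟨x, hx, rfl⟩
    simp only [q, ← hp' hx] at *
    rw [min_eq_right h2, max_eq_right h1]
  have hqv : eVariationOn q univ ≤ eVariationOn f s := by
    rw [eVariationOn.eq_biSup_inter_Icc]
    simp only [iSup_le_iff]
    rintro ⟨b, c⟩ -
    rw [(hqm.monotoneOn univ).eVariationOn_eq (mem_univ _) (mem_univ _)]
    refine ENNReal.ofReal_le_of_le_toReal (le_trans ?_ hlohi)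
    have h0 : lo ≤ hi := (csInf_le hbb ⟨a, ha, rfl⟩).trans (le_csSup hba ⟨a, ha, rfl⟩)
    have h1 : q c ≤ hi := max_le h0 (min_le_left _ _)
    have h2 : lo ≤ q b := le_max_left _ _
    linarith
  have hbound : ∀ b ∈ s, ∀ c ∈ s, |f c - f b| ≤ |p c - p b| := by
    intro b hb c hc
    rcases le_total b c with h | h
    · exact (variationOnFromTo.abs_sub_le_sub_of_le hl ha hb hc h).trans (le_abs_self _)
    · rw [abs_sub_comm, abs_sub_comm (p c)]
      exact (variationOnFromTo.abs_sub_le_sub_of_le hl ha hc hb h).trans (le_abs_self _)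
  have hinv : ∀ t ∈ p '' s, Function.invFunOn p s t ∈ s ∧ p (Function.invFunOn p s t) = t :=
    fun t ht => ⟨Function.invFunOn_mem ht, Function.invFunOn_eq ht⟩
  -- By `hbound`, `f` depends on `x` only through `p x`, and in a 1-Lipschitz way. Extending this
  -- dependence to the line and composing with `q` extends `f` itself.
  have hF : LipschitzOnWith 1 (fun t => f (Function.invFunOn p s t)) (p '' s) := by
    refine LipschitzOnWith.of_dist_le_mul fun x hx y hy => ?_
    obtain ⟨hx1, hx2⟩ := hinv x hx
    obtain ⟨hy1, hy2⟩ := hinv y hy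
    have := hbound _ hy1 _ hx1
    rw [hx2, hy2] at this
    simpa [Real.dist_eq] using this
  obtain ⟨F, hFl, hFe⟩ := hF.extend_real
  refine ⟨F ∘ q, fun x hx => ?_, ?_⟩
  · have hmem : p x ∈ p '' s := ⟨x, hx, rfl⟩
    simp only [Function.comp_apply, hqe hx, ← hFe hmem]
    have := hbound _ hx _ (hinv _ hmem).1
    rw [(hinv _ hmem).2, sub_self, abs_zero] at this
    linarith [abs_nonpos_iff.1 this]
  · calc eVariationOn (F ∘ q) univ ≤ (1 : NNReal) * eVariationOn q univ :=
        (hFl.lipschitzOnWith (s := univ)).comp_eVariationOn_le (mapsTo_univ _ _)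
      _ ≤ _ := by simpa using hqv

theorem ae_mem_Icc : ∀ᵐ x ∂m, x ∈ Icc (0 : ℝ) 1 := ae_restrict_mem measurableSet_Icc

theorem essVar_congr {E : Type*} [NormedAddCommGroup E] {f g : ℝ → E} (h : f =ᵐ[m] g) :
    essVar f = essVar g := by
  unfold essVar
  congr 1; funext u
  refine iInf_congr_Prop ⟨fun h' => h'.trans h, fun h' => h'.trans h.symm⟩ fun _ => rfl

theorem essVar_le {E : Type*} [NormedAddCommGroup E] {f g : ℝ → E} (h : g =ᵐ[m] f) :
    essVar f ≤ eVariationOn g (Icc 0 1) := iInf₂_le g h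

theorem exists_rep_lt {E : Type*} [NormedAddCommGroup E] {f : ℝ → E} {R : ℝ≥0∞}
    (h : essVar f < R) : ∃ g, g =ᵐ[m] f ∧ eVariationOn g (Icc 0 1) < R := by
  unfold essVar at h
  simp only [iInf_lt_iff] at h
  obtain ⟨g, h1, h2⟩ := h
  exact ⟨g, h1, h2⟩

/-- A pointwise almost everywhere limit of functions of essential variation at most `R` has a
representative whose variation is at most `R`. -/
theorem exists_rep_of_tendsto {f : ℝ → ℝ} {F : ℕ → ℝ → ℝ} {R : ℕ → ℝ≥0∞} {R' : ℝ≥0∞}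
    (hR' : R' ≠ ⊤) (hF : ∀ n, essVar (F n) < R n) (hR : Tendsto R atTop (𝓝 R'))
    (h : ∀ᵐ x ∂m, Tendsto (fun n => F n x) atTop (𝓝 (f x))) :
    ∃ g, g =ᵐ[m] f ∧ eVariationOn g univ ≤ R' := by
  choose G hG hGv using fun n => exists_rep_lt (hF n)
  have hS : ∀ᵐ x ∂m, (∀ n, G n x = F n x) ∧ Tendsto (fun n => F n x) atTop (𝓝 (f x)) ∧
      x ∈ Icc (0 : ℝ) 1 := by
    filter_upwards [ae_all_iff.2 hG, h, ae_mem_Icc] with x h1 h2 h3 using ⟨h1, h2, h3⟩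
  -- On `S` convergence holds at every point, so the variation over `S` is lower semicontinuous. As
  -- `S` has full measure, an extension of `f` from `S` is a representative.
  set S := {x | (∀ n, G n x = F n x) ∧ Tendsto (fun n => F n x) atTop (𝓝 (f x)) ∧
      x ∈ Icc (0 : ℝ) 1}
  have hle : eVariationOn f S ≤ R' := by
    refine le_of_forall_lt fun c hc => ?_
    have h1 := eVariationOn.lowerSemicontinuous_aux (F := G) (p := atTop) (f := f) (s := S)
      (fun x hx => by simpa only [hx.1] using hx.2.1) hc
    obtain ⟨c', hc', hc''⟩ := exists_between hc
    have h2 := eVariationOn.lowerSemicontinuous_aux (F := G) (p := atTop) (f := f) (s := S)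
      (fun x hx => by simpa only [hx.1] using hx.2.1) hc''
    refine hc'.trans_le (ge_of_tendsto hR (h2.mono fun n hn => ?_))
    exact hn.le.trans ((eVariationOn.mono _ fun x hx => hx.2.2).trans (hGv n).le)
  obtain ⟨g, hg1, hg2⟩ := exists_extension_eVariationOn_le (f := f) (s := S)
    (ne_top_of_le_ne_top hR' hle)
  exact ⟨g, by filter_upwards [hS] with x hx using hg1 hx, hg2.trans hle⟩

theorem tendsto_add_inv (a : ℝ≥0∞) :
    Tendsto (fun n : ℕ => a + ((n : ℝ≥0∞) + 1)⁻¹) atTop (𝓝 a) := by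
  have h : Tendsto (fun n : ℕ => ((n : ℝ≥0∞) + 1)⁻¹) atTop (𝓝 0) := by
    have := (tendsto_add_atTop_iff_nat 1).2 ENNReal.tendsto_inv_nat_nhds_zero
    simpa using this
  simpa using tendsto_const_nhds.add h

theorem lt_add_inv {a : ℝ≥0∞} (ha : a ≠ ⊤) (n : ℕ) : a < a + ((n : ℝ≥0∞) + 1)⁻¹ :=
  ENNReal.lt_add_right ha (by simp)

/-- The essential variation is attained. -/
theorem exists_rep {f : ℝ → ℝ} (h : essVar f ≠ ⊤) :
    ∃ g, g =ᵐ[m] f ∧ Measurable g ∧ eVariationOn g univ = essVar f := by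
  -- A constant sequence suffices: the bounds decreasing to `essVar f` do the work of a minimizing
  -- sequence.
  obtain ⟨g, h1, h2⟩ := exists_rep_of_tendsto (f := f) (F := fun _ => f) h
    (fun n => lt_add_inv h n) (tendsto_add_inv _) (ae_of_all _ fun _ => tendsto_const_nhds)
  refine ⟨g, h1, ?_, le_antisymm h2 ?_⟩
  · have hb : LocallyBoundedVariationOn g univ :=
      BoundedVariationOn.locallyBoundedVariationOn (ne_top_of_le_ne_top h h2)
    obtain ⟨p, q, hp, hq, hpq⟩ := hb.exists_monotoneOn_sub_monotoneOn
    rw [hpq]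
    exact (monotoneOn_univ.1 hp).measurable.sub (monotoneOn_univ.1 hq).measurable
  · exact (essVar_le h1).trans (eVariationOn.mono _ (subset_univ _))

theorem essVar_le_of_tendsto {f : ℝ → ℝ} {F : ℕ → ℝ → ℝ} {R : ℝ≥0∞} (hF : ∀ n, essVar (F n) ≤ R)
    (h : ∀ᵐ x ∂m, Tendsto (fun n => F n x) atTop (𝓝 (f x))) : essVar f ≤ R := by
  rcases eq_or_ne R ⊤ with rfl | hR
  · exact le_top
  obtain ⟨g, h1, h2⟩ := exists_rep_of_tendsto (f := f) (F := F) hR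
    (fun n => (hF n).trans_lt (lt_add_inv hR n)) (tendsto_add_inv _) h
  exact (essVar_le h1).trans ((eVariationOn.mono _ (subset_univ _)).trans h2)

theorem eVariationOn_add_le {E : Type*} [NormedAddCommGroup E] {s : Set ℝ} (f g : ℝ → E) :
    eVariationOn (f + g) s ≤ eVariationOn f s + eVariationOn g s := by
  refine iSup_le ?_
  rintro ⟨n, ⟨u, hu, us⟩⟩
  calc _ ≤ ∑ i ∈ Finset.range n, (edist (f (u (i + 1))) (f (u i)) +
          edist (g (u (i + 1))) (g (u i))) :=
        Finset.sum_le_sum fun i _ => edist_add_add_le _ _ _ _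
    _ ≤ _ := by
        rw [Finset.sum_add_distrib]
        exact add_le_add (eVariationOn.sum_le hu us) (eVariationOn.sum_le hu us)

theorem essVar_add_le (f g : ℝ → ℝ) : essVar (f + g) ≤ essVar f + essVar g := by
  rcases eq_or_ne (essVar f) ⊤ with h | hf
  · simp [h]
  rcases eq_or_ne (essVar g) ⊤ with h | hg
  · simp [h]
  obtain ⟨f', hf1, -, hf2⟩ := exists_rep hf
  obtain ⟨g', hg1, -, hg2⟩ := exists_rep hg
  rw [← hf2, ← hg2]
  exact (essVar_le (hf1.add hg1)).trans
    ((eVariationOn.mono _ (subset_univ _)).trans (eVariationOn_add_le _ _))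

theorem essVar_comp_le {E F : Type*} [NormedAddCommGroup E] [NormedAddCommGroup F] {φ : E → F}
    {C : NNReal} (hφ : LipschitzWith C φ) (f : ℝ → E) :
    essVar (fun x => φ (f x)) ≤ C * essVar f := by
  rcases eq_or_ne (essVar f) ⊤ with h | hf
  -- For `C = 0` the right side is `0 * ⊤ = 0`, so the constancy of `φ` has to be used.
  · rcases eq_or_ne C 0 with rfl | hC
    · obtain ⟨e⟩ : Nonempty E := ⟨0⟩
      have : (fun x => φ (f x)) = fun _ => φ 0 := by
        funext x
        have := hφ (f x) 0
        simpa using this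
      rw [this]
      refine (essVar_le (EventuallyEq.refl _ _)).trans ?_
      rw [eVariationOn_const]
      exact zero_le
    · rw [h, ENNReal.mul_top (by simpa using hC)]
      exact le_top
  -- Attainment of the infimum is proved for real functions only. For general values, near-optimal
  -- representatives are used.
  · have key : ∀ n : ℕ, essVar (fun x => φ (f x)) ≤ C * (essVar f + ((n : ℝ≥0∞) + 1)⁻¹) := by
      intro n
      obtain ⟨g, hg, hgv⟩ := exists_rep_lt (lt_add_inv hf n)
      have h1 : (φ ∘ g) =ᵐ[m] fun x => φ (f x) := by
        filter_upwards [hg] with x hx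
        simp [hx]
      exact (essVar_le h1).trans (((hφ.lipschitzOnWith (s := univ)).comp_eVariationOn_le
        (mapsTo_univ _ _)).trans (by gcongr))
    refine ge_of_tendsto' (ENNReal.Tendsto.const_mul (tendsto_add_inv _) ?_) key
    right; simp

theorem essVar_const_mul_le (c : ℝ) (f : ℝ → ℝ) :
    essVar (fun x => c * f x) ≤ ‖c‖ₑ * essVar f :=
  essVar_comp_le (φ := fun y : ℝ => c * y) (C := ‖c‖₊)
    (LipschitzWith.of_dist_le_mul fun x y => by
      rw [Real.dist_eq, Real.dist_eq, ← mul_sub, abs_mul]; rfl) f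

theorem essVar_abs_le (f : ℝ → ℝ) : essVar (fun x => |f x|) ≤ essVar f := by
  simpa using essVar_comp_le (φ := fun y : ℝ => |y|) (C := 1)
    (LipschitzWith.of_dist_le_mul fun x y => by
      simpa [Real.dist_eq] using abs_abs_sub_abs_le x y) f

theorem essVar_const {E : Type*} [NormedAddCommGroup E] (c : E) : essVar (fun _ => c) = 0 := by
  refine le_antisymm ((essVar_le (EventuallyEq.refl _ _)).trans ?_) zero_le
  rw [eVariationOn_const]

theorem abs_le_of_eVariationOn {g : ℝ → ℝ} {V : ℝ} (hV : 0 ≤ V)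
    (hgv : eVariationOn g univ ≤ ENNReal.ofReal V) (x y : ℝ) : |g x - g y| ≤ V := by
  have h := eVariationOn.edist_le g (mem_univ x) (mem_univ y)
  rw [edist_dist, Real.dist_eq] at h
  exact (ENNReal.ofReal_le_ofReal_iff hV).1 (h.trans hgv)

/-- Since `|g x| - V ≤ |g y|` for every `y`, it is enough to integrate over `y` against a
probability measure. -/
theorem abs_le_integral_add {g : ℝ → ℝ} {V : ℝ} (hV : 0 ≤ V) (hg : Integrable g m)
    (hgv : eVariationOn g univ ≤ ENNReal.ofReal V) (x : ℝ) : |g x| ≤ ∫ y, |g y| ∂m + V := by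
  have h1 : ∫ _, (|g x| - V) ∂m ≤ ∫ y, |g y| ∂m := by
    refine integral_mono (integrable_const _) hg.abs fun y => ?_
    have := abs_le_of_eVariationOn hV hgv x y
    have := abs_sub_abs_le_abs_sub (g x) (g y)
    simp only
    linarith
  simp at h1
  linarith

theorem toReal_eLpNorm_one {f : ℝ → ℝ} (hf : Integrable f m) :
    eLpNorm f 1 m = ENNReal.ofReal (∫ x, |f x| ∂m) := by
  rw [eLpNorm_one_eq_lintegral_enorm, ← ofReal_integral_norm_eq_lintegral_enorm hf]
  rfl

/-- An optimal representative is bounded everywhere by its `BV` norm, so the product rule for the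
variation applies. `BV` is therefore an algebra, which makes multiplication by `ψ` a bounded
operator. -/
theorem essVar_mul_le {f g : ℝ → ℝ} (hf : MemBV f) (hg : MemBV g) :
    essVar (fun x => f x * g x) ≤ 2 * bvNorm f * bvNorm g := by
  obtain ⟨f', hf1, -, hf2⟩ := exists_rep hf.2
  obtain ⟨g', hg1, -, hg2⟩ := exists_rep hg.2
  have key : ∀ {f f' : ℝ → ℝ}, MemBV f → f' =ᵐ[m] f → eVariationOn f' univ = essVar f →
      ∀ x, ‖f' x‖ₑ ≤ bvNorm f := by
    intro f f' hf hf1 hf2 x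
    have h := abs_le_integral_add (V := (essVar f).toReal) ENNReal.toReal_nonneg
      (hf.1.congr hf1.symm) (by rw [ENNReal.ofReal_toReal hf.2, hf2]) x
    rw [← ofReal_norm, bvNorm, toReal_eLpNorm_one hf.1]
    refine (ENNReal.ofReal_le_ofReal h).trans ?_
    rw [ENNReal.ofReal_add (integral_nonneg fun _ => abs_nonneg _) ENNReal.toReal_nonneg,
      ENNReal.ofReal_toReal hf.2, add_comm]
    refine add_le_add le_rfl (ENNReal.ofReal_le_ofReal ?_)
    exact (integral_congr_ae (hf1.mono fun x hx => congrArg abs hx)).le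
  have h1 := eVariation_mul_le (s := univ) (fun x _ => key hf hf1 hf2 x)
    (fun x _ => key hg hg1 hg2 x)
  have h2 : (f' * g') =ᵐ[m] fun x => f x * g x := hf1.mul hg1
  refine (essVar_le h2).trans ((eVariationOn.mono _ (subset_univ _)).trans (h1.trans ?_))
  rw [hf2, hg2]
  have e1 : essVar f ≤ bvNorm f := le_self_add
  have e2 : essVar g ≤ bvNorm g := le_self_add
  calc _ ≤ bvNorm f * bvNorm g + bvNorm g * bvNorm f := by gcongr
    _ = _ := by ring

end UlamDiffusion
end

noncomputable section

namespace UlamDiffusion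

open scoped ENNReal

/-! ### Averaging over the cells of a partition -/

/-- Extension from `s` does not increase the variation. Points where a representative behaves badly,
such as the endpoint `1` for step functions, can thus be left out. -/
theorem essVar_le_of_ae_mem {f : ℝ → ℝ} {s : Set ℝ} (hs : ∀ᵐ x ∂m, x ∈ s) :
    essVar f ≤ eVariationOn f s := by
  rcases eq_or_ne (eVariationOn f s) ⊤ with h | h
  · rw [h]; exact le_top
  obtain ⟨g, h1, h2⟩ := exists_extension_eVariationOn_le h
  exact (essVar_le (hs.mono fun x hx => h1 hx)).trans ((eVariationOn.mono _ (subset_univ _)).trans h2)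

theorem memBV_of_monotone_bounded {f : ℝ → ℝ} (hf : Monotone f) {C : ℝ} (hC : ∀ x, |f x| ≤ C) :
    MemBV f := by
  refine ⟨Integrable.of_bound hf.measurable.aestronglyMeasurable C (ae_of_all _ hC), ?_⟩
  exact ne_top_of_le_ne_top ((hf.monotoneOn (Icc 0 1)).boundedVariationOn fun x _ => hC x)
    (essVar_le (EventuallyEq.refl _ _))

theorem MemBV.add {f g : ℝ → ℝ} (hf : MemBV f) (hg : MemBV g) : MemBV (f + g) :=
  ⟨hf.1.add hg.1, ne_top_of_le_ne_top (ENNReal.add_ne_top.2 ⟨hf.2, hg.2⟩) (essVar_add_le f g)⟩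

theorem MemBV.const_mul {f : ℝ → ℝ} (hf : MemBV f) (c : ℝ) : MemBV (fun x => c * f x) :=
  ⟨hf.1.const_mul c, ne_top_of_le_ne_top (ENNReal.mul_ne_top enorm_ne_top hf.2)
    (essVar_const_mul_le c f)⟩

theorem memBV_const (c : ℝ) : MemBV (fun _ => c) :=
  ⟨integrable_const c, by rw [essVar_const]; exact ENNReal.zero_ne_top⟩

theorem MemBV.congr {f g : ℝ → ℝ} (hf : MemBV f) (h : f =ᵐ[m] g) : MemBV g :=
  ⟨hf.1.congr h, by rw [← essVar_congr h]; exact hf.2⟩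

theorem memBV_indicator_Ico (a b : ℝ) : MemBV (indicator (Ico a b) fun _ => (1 : ℝ)) := by
  rcases le_or_gt b a with h | h
  · rw [Ico_eq_empty (not_lt.2 h), indicator_empty]
    exact memBV_const 0
  have hmono : ∀ c : ℝ, MemBV (indicator (Ici c) fun _ => (1 : ℝ)) := fun c =>
    memBV_of_monotone_bounded (C := 1) (fun x y hxy => by
      simp only [indicator, mem_Ici]
      split_ifs <;> linarith)
      (fun x => by simp only [indicator]; split_ifs <;> simp)
  have := (hmono a).add ((hmono b).const_mul (-1))
  convert this using 1
  funext x
  simp only [indicator, mem_Ico, Pi.add_apply, mem_Ici]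
  split_ifs <;> first | linarith | (exfalso; grind)

namespace IntervalPartition

variable (η : IntervalPartition)

def len (k : Fin η.d) : ℝ := η.node k.succ - η.node k.castSucc

/-- The average of `f` over a cell. -/
def avg (f : ℝ → ℝ) (k : Fin η.d) : ℝ := (η.len k)⁻¹ * ∫ x in η.cell k, f x ∂m

/-- The step function of the averages of `f`. -/
def step (f : ℝ → ℝ) : ℝ → ℝ := fun x => ∑ k, (η.cell k).indicator (fun _ => η.avg f k) x

theorem len_pos (k : Fin η.d) : 0 < η.len k := sub_pos.2 (η.strictMono (Fin.castSucc_lt_succ))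

theorem node_mem (j : Fin (η.d + 1)) : η.node j ∈ Icc (0 : ℝ) 1 :=
  ⟨by rw [← η.node_zero]; exact η.strictMono.monotone (Fin.zero_le j),
   by rw [← η.node_last]; exact η.strictMono.monotone (Fin.le_last j)⟩

theorem cell_subset (k : Fin η.d) : η.cell k ⊆ Icc 0 1 := fun _ hx =>
  ⟨(η.node_mem _).1.trans hx.1, hx.2.le.trans (η.node_mem _).2⟩

theorem measurableSet_cell (k : Fin η.d) : MeasurableSet (η.cell k) := measurableSet_Ico

theorem le_of_mem_cell {j k : Fin η.d} {x y : ℝ} (hx : x ∈ η.cell j) (hy : y ∈ η.cell k)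
    (hxy : x ≤ y) : j ≤ k := by
  by_contra h
  have h1 : k.succ ≤ j.castSucc := by
    rw [Fin.le_def]; simp only [Fin.val_succ, Fin.val_castSucc]
    have := not_le.1 h
    omega
  have := η.strictMono.monotone h1
  have h2 := hy.2
  have h3 := hx.1
  linarith

theorem eq_of_mem_cell {j k : Fin η.d} {x : ℝ} (hx : x ∈ η.cell j) (hy : x ∈ η.cell k) : j = k :=
  le_antisymm (η.le_of_mem_cell hx hy le_rfl) (η.le_of_mem_cell hy hx le_rfl)

theorem exists_mem_cell {x : ℝ} (hx : x ∈ Ico (0 : ℝ) 1) : ∃ k, x ∈ η.cell k := by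
  by_contra h
  push Not at h
  have : ∀ j : Fin (η.d + 1), η.node j ≤ x := by
    intro j
    induction j using Fin.induction with
    | zero => rw [η.node_zero]; exact hx.1
    | succ k ih => exact not_lt.1 fun h' => h k ⟨ih, h'⟩
  have := this (Fin.last _)
  rw [η.node_last] at this
  exact absurd hx.2 (not_lt.2 this)

theorem ae_mem_Ico : ∀ᵐ x ∂m, x ∈ Ico (0 : ℝ) 1 := by
  have : ∀ᵐ x ∂m, x ≠ (1 : ℝ) := by
    refine ae_restrict_of_ae ?_
    simp [ae_iff]
  filter_upwards [ae_mem_Icc, this] with x h1 h2 using ⟨h1.1, lt_of_le_of_ne h1.2 h2⟩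

theorem m_cell (k : Fin η.d) : m (η.cell k) = ENNReal.ofReal (η.len k) := by
  rw [m, Measure.restrict_apply (η.measurableSet_cell k), inter_eq_left.2 (η.cell_subset k)]
  exact Real.volume_Ico

theorem m_real_cell (k : Fin η.d) : m.real (η.cell k) = η.len k := by
  rw [measureReal_def, m_cell, ENNReal.toReal_ofReal (η.len_pos k).le]

theorem step_apply (f : ℝ → ℝ) {k : Fin η.d} {x : ℝ} (hx : x ∈ η.cell k) :
    η.step f x = η.avg f k := by
  rw [step, Finset.sum_eq_single k]
  · exact indicator_of_mem hx _
  · intro j _ hj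
    exact indicator_of_notMem (fun h => hj (η.eq_of_mem_cell h hx)) _
  · simp

theorem memBV_step (f : ℝ → ℝ) : MemBV (η.step f) := by
  have : ∀ s : Finset (Fin η.d),
      MemBV (fun x => ∑ k ∈ s, (η.cell k).indicator (fun _ => η.avg f k) x) := by
    intro s
    induction s using Finset.induction_on with
    | empty => simpa using memBV_const 0
    | insert a s ha ih =>
      simp only [Finset.sum_insert ha]
      refine MemBV.add ?_ ih
      convert (memBV_indicator_Ico (η.node a.castSucc) (η.node a.succ)).const_mul (η.avg f a) using 1
      funext x
      simp only [indicator, cell, mul_ite, mul_one, mul_zero]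
      congr
  exact this _

theorem integral_eq_sum_cell {f : ℝ → ℝ} (hf : Integrable f m) :
    ∫ x, f x ∂m = ∑ k, ∫ x in η.cell k, f x ∂m := by
  have h : (m.restrict (⋃ k, η.cell k)) = m := by
    refine Measure.restrict_eq_self_of_ae_mem ?_
    filter_upwards [ae_mem_Ico] with x hx
    exact mem_iUnion.2 (η.exists_mem_cell hx)
  conv_lhs => rw [← h]
  refine integral_iUnion_fintype (fun k => η.measurableSet_cell k) ?_ (fun k => hf.integrableOn)
  exact fun j k hjk => Set.disjoint_left.2 fun x hx hy => hjk (η.eq_of_mem_cell hx hy)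

theorem setIntegral_step (f : ℝ → ℝ) (k : Fin η.d) :
    ∫ x in η.cell k, η.step f x ∂m = ∫ x in η.cell k, f x ∂m := by
  rw [setIntegral_congr_fun (η.measurableSet_cell k) fun x hx => η.step_apply f hx]
  rw [setIntegral_const, m_real_cell, smul_eq_mul, avg, mul_inv_cancel_left₀ (η.len_pos k).ne']

theorem sigma_le : η.sigma ≤ borel ℝ := by
  refine MeasurableSpace.generateFrom_le ?_
  rintro _ ⟨k, rfl⟩
  have := η.measurableSet_cell k
  rwa [BorelSpace.measurable_eq (α := ℝ)] at this

end IntervalPartition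

/-- Both functions have the same integral over each cell. The cells form a π-system, and equality of
the total integrals carries the identity over to complements. -/
theorem proj_ae_eq (η : IntervalPartition) {f : ℝ → ℝ} (hf : Integrable f m) :
    proj η f =ᵐ[m] η.step f := by
  have hm : η.sigma ≤ (inferInstance : MeasurableSpace ℝ) := by
    rw [BorelSpace.measurable_eq (α := ℝ)]; exact η.sigma_le
  have hs : Integrable (η.step f) m := (η.memBV_step f).1
  have htot : ∫ x, η.step f x ∂m = ∫ x, f x ∂m := by
    rw [η.integral_eq_sum_cell hs, η.integral_eq_sum_cell hf]
    exact Finset.sum_congr rfl fun k _ => η.setIntegral_step f k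
  refine (ae_eq_condExp_of_forall_setIntegral_eq hm hf (fun s _ _ => hs.integrableOn) ?_ ?_).symm
  · intro s hs' _
    have hpi : IsPiSystem (range η.cell) := by
      rintro _ ⟨j, rfl⟩ _ ⟨k, rfl⟩ ⟨x, hx1, hx2⟩
      rw [η.eq_of_mem_cell hx1 hx2, inter_self]
      exact ⟨k, rfl⟩
    induction s, hs' using MeasurableSpace.induction_on_inter (rfl : η.sigma = _) hpi with
    | empty => simp
    | basic t ht =>
      obtain ⟨k, rfl⟩ := ht
      exact η.setIntegral_step f k
    | compl t ht ih =>
      have ht' : MeasurableSet t := hm t ht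
      have h1 := integral_add_compl ht' hs
      have h2 := integral_add_compl ht' hf
      have h3 := ih (measure_lt_top _ _)
      linarith
    | iUnion g hd hg ih =>
      rw [integral_iUnion (fun i => hm _ (hg i)) hd hs.integrableOn,
        integral_iUnion (fun i => hm _ (hg i)) hd hf.integrableOn]
      exact tsum_congr fun i => ih i (measure_lt_top _ _)
  · refine StronglyMeasurable.aestronglyMeasurable ?_
    refine Measurable.stronglyMeasurable ?_
    refine Finset.measurable_fun_sum _ fun k _ => ?_
    refine Measurable.indicator measurable_const ?_
    exact MeasurableSpace.measurableSet_generateFrom ⟨k, rfl⟩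

/-! ### Averaging in `BV`: variation and approximation error -/

namespace IntervalPartition

variable (η : IntervalPartition)

theorem avg_eq_integral (f : ℝ → ℝ) (k : Fin η.d) :
    η.avg f k = ∫ t, f (η.node k.castSucc + η.len k * t) ∂m := by
  have h1 : ∫ t, f (η.node k.castSucc + η.len k * t) ∂m =
      ∫ t in (0 : ℝ)..1, f (η.node k.castSucc + η.len k * t) := by
    rw [intervalIntegral.integral_of_le zero_le_one, ← integral_Icc_eq_integral_Ioc]; rfl
  have h2 : ∫ x in η.cell k, f x ∂m =
      ∫ x in (η.node k.castSucc)..(η.node k.succ), f x := by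
    rw [intervalIntegral.integral_of_le (η.strictMono (Fin.castSucc_lt_succ)).le,
      ← integral_Icc_eq_integral_Ioc, integral_Icc_eq_integral_Ico, m,
      Measure.restrict_restrict (η.measurableSet_cell k), inter_eq_left.2 (η.cell_subset k)]
    rfl
  rw [h1, avg, h2, intervalIntegral.integral_comp_add_mul _ (η.len_pos k).ne', smul_eq_mul]
  simp [len]

/-- Rescaling every cell to `[0,1]` writes all averages as integrals over one parameter `t`. For
fixed `t` the points `τ i t` increase with `i`, so the increments of `g` along them sum to at most
its variation; then integrate over `t`. -/
theorem eVariationOn_step_le {g : ℝ → ℝ} (hg : Measurable g) (hgb : BoundedVariationOn g univ) :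
    eVariationOn (η.step g) (Ico 0 1) ≤ eVariationOn g univ := by
  refine iSup_le ?_
  rintro ⟨n, ⟨u, hu, us⟩⟩
  choose κ hκ using fun i => η.exists_mem_cell (us i)
  have hκm : ∀ i, κ i ≤ κ (i + 1) := fun i => η.le_of_mem_cell (hκ i) (hκ _) (hu (Nat.le_succ i))
  set τ : ℕ → ℝ → ℝ := fun i t => η.node (κ i).castSucc + η.len (κ i) * t with hτ
  have hτmeas : ∀ i, Measurable (fun t => g (τ i t)) := fun i => hg.comp (by fun_prop)
  have hbd : ∀ x, |g x| ≤ |g 0| + (eVariationOn g univ).toReal := fun x => by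
    have := abs_le_of_eVariationOn ENNReal.toReal_nonneg
      (le_of_eq (ENNReal.ofReal_toReal hgb).symm) x 0
    have := abs_sub_abs_le_abs_sub (g x) (g 0)
    linarith
  have hint : ∀ i, Integrable (fun t => g (τ i t)) m := fun i =>
    Integrable.of_bound (hτmeas i).aestronglyMeasurable _ (ae_of_all _ fun t => hbd _)
  have hmono : ∀ t ∈ Icc (0 : ℝ) 1, Monotone fun i => τ i t := by
    intro t ht
    refine monotone_nat_of_le_succ fun i => ?_
    rcases (hκm i).eq_or_lt with h | h
    · simp only [hτ, h]; exact le_rfl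
    · have h1 : (κ i).succ ≤ (κ (i + 1)).castSucc := by
        rw [Fin.le_def]; simp only [Fin.val_succ, Fin.val_castSucc]; omega
      have h2 := η.strictMono.monotone h1
      have h3 : η.len (κ i) * t ≤ η.len (κ i) := mul_le_of_le_one_right (η.len_pos _).le ht.2
      have h4 : 0 ≤ η.len (κ (i + 1)) * t := mul_nonneg (η.len_pos _).le ht.1
      simp only [hτ]
      have h5 : η.len (κ i) = η.node (κ i).succ - η.node (κ i).castSucc := rfl
      linarith
  calc ∑ i ∈ Finset.range n, edist (η.step g (u (i + 1))) (η.step g (u i))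
      ≤ ∑ i ∈ Finset.range n, ∫⁻ t, ‖g (τ (i + 1) t) - g (τ i t)‖ₑ ∂m := by
        refine Finset.sum_le_sum fun i _ => ?_
        rw [η.step_apply g (hκ i), η.step_apply g (hκ (i + 1)), avg_eq_integral, avg_eq_integral,
          edist_eq_enorm_sub, ← integral_sub (hint _) (hint _)]
        exact enorm_integral_le_lintegral_enorm _
    _ = ∫⁻ t, ∑ i ∈ Finset.range n, ‖g (τ (i + 1) t) - g (τ i t)‖ₑ ∂m := by
        rw [lintegral_finsetSum]
        exact fun i _ => ((hτmeas _).sub (hτmeas _)).enorm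
    _ ≤ ∫⁻ t, eVariationOn g univ ∂m := by
        refine lintegral_mono_ae ?_
        filter_upwards [ae_mem_Icc] with t ht
        simp only [← edist_eq_enorm_sub]
        exact eVariationOn.sum_le (hmono t ht) fun i => mem_univ _
    _ = eVariationOn g univ := by simp

theorem avg_congr {f g : ℝ → ℝ} (h : f =ᵐ[m] g) : η.avg f = η.avg g := by
  funext k
  rw [avg, avg, integral_congr_ae (ae_restrict_of_ae h)]

theorem step_congr {f g : ℝ → ℝ} (h : f =ᵐ[m] g) : η.step f = η.step g := by
  funext x
  simp only [step, η.avg_congr h]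

theorem essVar_step_le (f : ℝ → ℝ) : essVar (η.step f) ≤ essVar f := by
  rcases eq_or_ne (essVar f) ⊤ with h | h
  · rw [h]; exact le_top
  obtain ⟨g, h1, h2, h3⟩ := exists_rep h
  rw [← η.step_congr h1, ← h3]
  exact (essVar_le_of_ae_mem ae_mem_Ico).trans
    (η.eVariationOn_step_le h2 (by rw [BoundedVariationOn, h3]; exact h))

theorem abs_sub_step_le {f : ℝ → ℝ} (hf : Integrable f m) {k : Fin η.d} {D : ℝ}
    (h : ∀ x ∈ η.cell k, ∀ y ∈ η.cell k, |f x - f y| ≤ D) {x : ℝ} (hx : x ∈ η.cell k) :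
    |f x - η.step f x| ≤ D := by
  rw [η.step_apply f hx]
  have h1 : f x - η.avg f k = (η.len k)⁻¹ * ∫ y in η.cell k, (f x - f y) ∂m := by
    rw [integral_sub (integrable_const _) hf.integrableOn, setIntegral_const, m_real_cell, mul_sub,
      smul_eq_mul, inv_mul_cancel_left₀ (η.len_pos k).ne', avg]
  have h2 : ‖∫ y in η.cell k, (f x - f y) ∂m‖ ≤ D * m.real (η.cell k) :=
    norm_setIntegral_le_of_norm_le_const (measure_lt_top _ _) fun y hy => h x hx y hy
  rw [h1, abs_mul, abs_of_pos (inv_pos.2 (η.len_pos k)), inv_mul_le_iff₀ (η.len_pos k)]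
  rwa [m_real_cell, mul_comm, Real.norm_eq_abs] at h2

/-- On a cell, `f` differs from its average by at most the increment of the variation function `p`
across that cell. Multiplied by the lengths, all at most `ε`, these increments telescope. -/
theorem integral_abs_sub_step_le {f : ℝ → ℝ} {V ε : ℝ} (hf : Integrable f m) (hV : 0 ≤ V)
    (hε : 0 ≤ ε) (hfV : essVar f ≤ ENNReal.ofReal V) (hη : η.MeshLE ε) :
    ∫ x, |f x - η.step f x| ∂m ≤ ε * V := by
  obtain ⟨g, h1, h2, h3⟩ := exists_rep (ne_top_of_le_ne_top ENNReal.ofReal_ne_top hfV)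
  have hg : Integrable g m := hf.congr h1.symm
  rw [← η.step_congr h1]
  have : ∫ x, |f x - η.step g x| ∂m = ∫ x, |g x - η.step g x| ∂m :=
    integral_congr_ae (h1.mono fun x hx => by simp only [hx])
  rw [this]
  have hb : BoundedVariationOn g univ := by
    rw [BoundedVariationOn, h3]; exact ne_top_of_le_ne_top ENNReal.ofReal_ne_top hfV
  have hl := hb.locallyBoundedVariationOn
  set p := variationOnFromTo g univ 0
  have hp : Monotone p := monotoneOn_univ.1 (variationOnFromTo.monotoneOn hl (mem_univ _))
  have hpb : ∀ x y, x ≤ y → |g y - g x| ≤ p y - p x := fun x y hxy =>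
    variationOnFromTo.abs_sub_le_sub_of_le hl (mem_univ _) (mem_univ _) (mem_univ _) hxy
  have hgs : Integrable (fun x => |g x - η.step g x|) m := (hg.sub (η.memBV_step g).1).abs
  rw [η.integral_eq_sum_cell hgs]
  have hcell : ∀ k : Fin η.d, ∫ x in η.cell k, |g x - η.step g x| ∂m ≤
      ε * (p (η.node k.succ) - p (η.node k.castSucc)) := by
    intro k
    have hD : ∀ x ∈ η.cell k, ∀ y ∈ η.cell k,
        |g x - g y| ≤ p (η.node k.succ) - p (η.node k.castSucc) := by
      have : ∀ x ∈ η.cell k, ∀ y ∈ η.cell k, x ≤ y →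
          |g y - g x| ≤ p (η.node k.succ) - p (η.node k.castSucc) := by
        intro x hx y hy hxy
        have a1 := hp hx.1
        have a2 := hp hy.2.le
        linarith [hpb x y hxy]
      intro x hx y hy
      rcases le_total x y with h | h
      · rw [abs_sub_comm]; exact this x hx y hy h
      · exact this y hy x hx h
    have h4 : ∫ x in η.cell k, |g x - η.step g x| ∂m ≤
        ∫ x in η.cell k, (p (η.node k.succ) - p (η.node k.castSucc)) ∂m :=
      setIntegral_mono_on hgs.integrableOn (integrable_const _).integrableOn
        (η.measurableSet_cell k) fun x hx => η.abs_sub_step_le hg hD hx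
    rw [setIntegral_const, m_real_cell, smul_eq_mul] at h4
    refine h4.trans (mul_le_mul_of_nonneg_right (hη k) ?_)
    exact sub_nonneg.2 (hp (η.strictMono.monotone (Fin.castSucc_lt_succ).le))
  refine (Finset.sum_le_sum fun k _ => hcell k).trans ?_
  rw [← Finset.mul_sum]
  have htel : ∑ k : Fin η.d, (p (η.node k.succ) - p (η.node k.castSucc)) = p 1 - p 0 := by
    have h0 := Fin.sum_univ_succ (fun j => p (η.node j))
    have h1 := Fin.sum_univ_castSucc (fun j => p (η.node j))
    rw [η.node_zero] at h0
    rw [η.node_last] at h1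
    rw [Finset.sum_sub_distrib]
    linarith
  rw [htel]
  refine mul_le_mul_of_nonneg_left ?_ hε
  have : p 0 = 0 := variationOnFromTo.self _ _ _
  rw [this, sub_zero]
  refine ((le_abs_self _).trans (variationOnFromTo.abs_le_eVariationOn hb)).trans ?_
  rw [h3]
  exact ENNReal.toReal_le_of_le_ofReal hV hfV

/-- The partition into `n + 1` intervals of equal length. -/
def uniform (n : ℕ) : IntervalPartition where
  d := n + 1
  node j := (j : ℝ) / (n + 1)
  strictMono i j hij := by
    have : ((i : ℕ) : ℝ) < (j : ℕ) := by exact_mod_cast hij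
    simp only
    gcongr
  node_zero := by simp
  node_last := by
    simp only [Fin.val_last]
    push_cast
    exact div_self (by positivity)

theorem uniform_meshLE (n : ℕ) : (uniform n).MeshLE (1 / ((n : ℝ) + 1)) := by
  intro k
  have h1 : (uniform n).node k.succ = ((k : ℕ) + 1 : ℝ) / (n + 1) := by
    change (((k : ℕ) + 1 : ℕ) : ℝ) / _ = _
    push_cast; rfl
  have h2 : (uniform n).node k.castSucc = ((k : ℕ) : ℝ) / (n + 1) := rfl
  rw [h1, h2, ← sub_div]
  simp

theorem exists_meshLE {ε : ℝ} (hε : 0 < ε) : ∃ η : IntervalPartition, η.MeshLE ε := by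
  obtain ⟨n, hn⟩ := exists_nat_one_div_lt hε
  exact ⟨uniform n, fun k => (uniform_meshLE n k).trans hn.le⟩

end IntervalPartition

/-- A continuous function of compact support is uniformly continuous, hence uniformly close on the
cells to its averages over a fine partition. This density of `BV` extends uniqueness of the
invariant density from `BV` to `L¹`. -/
theorem exists_memBV_integral_sub_le {f : ℝ → ℝ} (hf : Integrable f m) {δ : ℝ} (hδ : 0 < δ) :
    ∃ g, MemBV g ∧ ∫ x, |f x - g x| ∂m ≤ δ := by
  obtain ⟨g, hg1, hg2, hg3, hg4⟩ :=
    hf.exists_hasCompactSupport_integral_sub_le (ε := δ / 2) (by positivity)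
  have huc : UniformContinuous g := hg1.uniformContinuous_of_continuous hg3
  obtain ⟨ε, hε, hεg⟩ := Metric.uniformContinuous_iff.1 huc (δ / 2) (by positivity)
  obtain ⟨η, hη⟩ := IntervalPartition.exists_meshLE (half_pos hε)
  refine ⟨η.step g, η.memBV_step g, ?_⟩
  have hs := (η.memBV_step g).1
  have h1 : ∫ x, |g x - η.step g x| ∂m ≤ ∫ _, δ / 2 ∂m := by
    refine integral_mono_ae (hg4.sub hs).abs (integrable_const _) ?_
    filter_upwards [IntervalPartition.ae_mem_Ico] with x hx
    obtain ⟨k, hk⟩ := η.exists_mem_cell hx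
    refine η.abs_sub_step_le hg4 (fun y hy z hz => ?_) hk
    have := hη k
    refine (hεg (a := y) (b := z) ?_).le
    rw [Real.dist_eq, abs_lt]
    have a1 := hy.1; have a2 := hy.2; have a3 := hz.1; have a4 := hz.2
    constructor <;> linarith
  simp only [integral_const, probReal_univ, one_smul] at h1
  have h2 : ∫ x, |f x - η.step g x| ∂m ≤ ∫ x, (|f x - g x| + |g x - η.step g x|) ∂m :=
    integral_mono (hf.sub hs).abs ((hf.sub hg4).abs.add (hg4.sub hs).abs)
      fun x => abs_sub_le _ _ _
  have h3 : ∫ x, (|f x - g x| + |g x - η.step g x|) ∂m =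
      ∫ x, |f x - g x| ∂m + ∫ x, |g x - η.step g x| ∂m :=
    integral_add (hf.sub hg4).abs (hg4.sub hs).abs
  simp only [Real.norm_eq_abs] at hg2
  linarith

end UlamDiffusion
end

noncomputable section

namespace UlamDiffusion

open scoped ENNReal

/-! ### The transfer operator on functions -/

/-- On each branch `T` is injective, by Rolle's theorem, and does not shrink measure, by the change
of variables formula and `|T'| ≥ 1`. The part of the preimage of a null set in a branch is therefore
null, and there are countably many branches. -/
theorem IsPiecewiseExpanding.quasiMeasurePreserving {T : ℝ → ℝ} (hT : IsPiecewiseExpanding T) :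
    Measure.QuasiMeasurePreserving T m m := by
  refine ⟨hT.measurable, Measure.AbsolutelyContinuous.mk fun N hN hN0 => ?_⟩
  rw [Measure.map_apply hT.measurable hN]
  obtain ⟨u, v, hsub, -, hcover, -, c, hc, hderiv⟩ := hT.branches
  set s : ℕ → Set ℝ := fun k => Ioo (u k) (v k) ∩ T ⁻¹' N
  have hs : ∀ k, m (s k) = 0 := by
    intro k
    -- `deriv` takes the default value `0` where there is no derivative, so the lower bound on
    -- `|deriv T x|` already forces differentiability.
    have hd : ∀ x ∈ Ioo (u k) (v k), DifferentiableAt ℝ T x := fun x hx =>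
      differentiableAt_of_deriv_ne_zero fun h => by
        have := hderiv k x hx
        rw [h, abs_zero] at this
        linarith
    have hinj : InjOn T (Ioo (u k) (v k)) := by
      have : ∀ x ∈ Ioo (u k) (v k), ∀ y ∈ Ioo (u k) (v k), x < y → T x ≠ T y := by
        intro x hx y hy hxy h
        have hss : Icc x y ⊆ Ioo (u k) (v k) := fun z hz =>
          ⟨hx.1.trans_le hz.1, hz.2.trans_lt hy.2⟩
        obtain ⟨z, hz, hz0⟩ := exists_deriv_eq_zero hxy
          (fun z hz => (hd z (hss hz)).continuousAt.continuousWithinAt) h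
        have := hderiv k z (hss (Ioo_subset_Icc_self hz))
        rw [hz0, abs_zero] at this
        linarith
      intro x hx y hy h
      rcases lt_trichotomy x y with h' | h' | h'
      · exact absurd h (this x hx y hy h')
      · exact h'
      · exact absurd h.symm (this y hy x hx h')
    have hsm : MeasurableSet (s k) := measurableSet_Ioo.inter (hT.measurable hN)
    have himg := lintegral_image_eq_lintegral_abs_deriv_mul hsm (f' := deriv T)
      (fun x hx => (hd x hx.1).hasDerivAt.hasDerivWithinAt) (hinj.mono inter_subset_left)
      (fun _ => 1)
    have h0 : volume (T '' s k) = 0 := by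
      refine measure_mono_null ?_ (show volume (N ∩ Icc 0 1) = 0 by
        rwa [m, Measure.restrict_apply hN] at hN0)
      rintro _ ⟨x, hx, rfl⟩
      exact ⟨hx.2, hT.mapsTo (hsub k hx.1)⟩
    simp only [mul_one, lintegral_const, Measure.restrict_apply MeasurableSet.univ, univ_inter,
      one_mul, h0] at himg
    have hle : volume (s k) ≤ 0 := by
      rw [himg, ← setLIntegral_one]
      refine setLIntegral_mono' hsm fun x hx => ?_
      rw [ENNReal.one_le_ofReal]
      linarith [hderiv k x hx.1]
    exact le_antisymm ((Measure.restrict_apply_le _ _).trans hle) zero_le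
  refine measure_mono_null (t := (⋃ k, Ioo (u k) (v k))ᶜ ∪ ⋃ k, s k) ?_
    (measure_union_null hcover (measure_iUnion_null hs))
  intro x hx
  by_cases h : x ∈ ⋃ k, Ioo (u k) (v k)
  · obtain ⟨k, hk⟩ := mem_iUnion.1 h
    exact Or.inr (mem_iUnion.2 ⟨k, hk, hx⟩)
  · exact Or.inl h

/-! ### Duality, linearity and contraction of the transfer operator -/

section transfer

variable {T : ℝ → ℝ}

theorem integrable_transfer (T f : ℝ → ℝ) : Integrable (transfer T f) m :=
  SignedMeasure.integrable_rnDeriv _ _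

theorem transfer_congr {f g : ℝ → ℝ} (h : f =ᵐ[m] g) : transfer T f = transfer T g := by
  unfold transfer
  rw [WithDensityᵥEq.congr_ae h]

/-- A Radon-Nikodym derivative sees only the absolutely continuous part of a signed measure. As `T`
is nonsingular, the push-forward has no other part. -/
theorem setIntegral_transfer (hT : IsPiecewiseExpanding T) {f : ℝ → ℝ} (hf : Integrable f m)
    {A : Set ℝ} (hA : MeasurableSet A) :
    ∫ x in A, transfer T f x ∂m = ∫ x in T ⁻¹' A, f x ∂m := by
  have hac : ((m.withDensityᵥ f).map T) ≪ᵥ m.toENNRealVectorMeasure := by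
    refine VectorMeasure.AbsolutelyContinuous.mk fun N hN hN0 => ?_
    rw [VectorMeasure.map_apply _ hT.measurable hN,
      withDensityᵥ_apply hf (hT.measurable hN)]
    rw [Measure.toENNRealVectorMeasure_apply_measurable hN] at hN0
    exact setIntegral_measure_zero _ (hT.quasiMeasurePreserving.preimage_null hN0)
  have h := SignedMeasure.withDensityᵥ_rnDeriv_eq _ m hac
  have h2 := congrArg (fun v => v A) h
  rwa [withDensityᵥ_apply (SignedMeasure.integrable_rnDeriv _ _) hA,
    VectorMeasure.map_apply _ hT.measurable hA,
    withDensityᵥ_apply hf (hT.measurable hA)] at h2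

theorem ae_eq_transfer (hT : IsPiecewiseExpanding T) {f g : ℝ → ℝ} (hf : Integrable f m)
    (hg : Integrable g m)
    (h : ∀ A, MeasurableSet A → ∫ x in A, g x ∂m = ∫ x in T ⁻¹' A, f x ∂m) :
    g =ᵐ[m] transfer T f :=
  hg.ae_eq_of_forall_setIntegral_eq _ _ (integrable_transfer T f) fun A hA _ => by
    rw [h A hA, setIntegral_transfer hT hf hA]

theorem transfer_add (hT : IsPiecewiseExpanding T) {f g : ℝ → ℝ} (hf : Integrable f m)
    (hg : Integrable g m) : transfer T (f + g) =ᵐ[m] transfer T f + transfer T g := by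
  refine (ae_eq_transfer hT (hf.add hg)
    ((integrable_transfer T f).add (integrable_transfer T g)) fun A hA => ?_).symm
  simp only [Pi.add_apply]
  rw [integral_add (integrable_transfer T f).integrableOn (integrable_transfer T g).integrableOn,
    integral_add hf.integrableOn hg.integrableOn, setIntegral_transfer hT hf hA,
    setIntegral_transfer hT hg hA]

theorem transfer_const_mul (hT : IsPiecewiseExpanding T) {f : ℝ → ℝ} (hf : Integrable f m)
    (c : ℝ) : transfer T (fun x => c * f x) =ᵐ[m] fun x => c * transfer T f x := by
  refine (ae_eq_transfer hT (hf.const_mul c)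
    ((integrable_transfer T f).const_mul c) fun A hA => ?_).symm
  rw [integral_const_mul, integral_const_mul, setIntegral_transfer hT hf hA]

theorem integral_transfer (hT : IsPiecewiseExpanding T) {f : ℝ → ℝ} (hf : Integrable f m) :
    ∫ x, transfer T f x ∂m = ∫ x, f x ∂m := by
  simpa using setIntegral_transfer hT hf MeasurableSet.univ

theorem transfer_nonneg (hT : IsPiecewiseExpanding T) {f : ℝ → ℝ} (hf : Integrable f m)
    (h0 : 0 ≤ᵐ[m] f) : 0 ≤ᵐ[m] transfer T f := by
  refine ae_nonneg_of_forall_setIntegral_nonneg (integrable_transfer T f) fun A hA _ => ?_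
  rw [setIntegral_transfer hT hf hA]
  exact integral_nonneg_of_ae (ae_restrict_of_ae h0)

theorem abs_transfer_le (hT : IsPiecewiseExpanding T) {f : ℝ → ℝ} (hf : Integrable f m) :
    ∀ᵐ x ∂m, |transfer T f x| ≤ transfer T (fun y => |f y|) x := by
  have h1 := transfer_nonneg hT (hf.abs.add hf)
    (ae_of_all _ fun x => by simp only [Pi.zero_apply, Pi.add_apply]; linarith [neg_abs_le (f x)])
  have h2 := transfer_nonneg hT (hf.abs.add (hf.const_mul (-1)))
    (ae_of_all _ fun x => by simp only [Pi.zero_apply, Pi.add_apply]; linarith [le_abs_self (f x)])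
  filter_upwards [h1, h2, transfer_add hT hf.abs hf, transfer_add hT hf.abs (hf.const_mul (-1)),
    transfer_const_mul hT hf (-1)] with x h1 h2 h3 h4 h5
  simp only [Pi.zero_apply] at h1 h2
  rw [h3, Pi.add_apply] at h1
  rw [h4, Pi.add_apply, h5] at h2
  rw [abs_le]
  constructor <;> linarith

theorem integral_abs_transfer_le (hT : IsPiecewiseExpanding T) {f : ℝ → ℝ} (hf : Integrable f m) :
    ∫ x, |transfer T f x| ∂m ≤ ∫ x, |f x| ∂m := by
  rw [← integral_transfer hT hf.abs]
  exact integral_mono_ae (integrable_transfer T f).abs (integrable_transfer T _)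
    (abs_transfer_le hT hf)

/-- For `f ≥ 0` the densities `f` and `transfer T f` define positive measures, and the second is the
push-forward of the first. Change of variables then needs no bound on `g`. -/
theorem integral_transfer_mul_of_nonneg (hT : IsPiecewiseExpanding T) {f g : ℝ → ℝ}
    (hf : Integrable f m) (h0 : 0 ≤ᵐ[m] f) (hg : Measurable g) :
    ∫ x, transfer T f x * g x ∂m = ∫ x, f x * g (T x) ∂m := by
  have hP := integrable_transfer T f
  have hP0 := transfer_nonneg hT hf h0
  have key : (m.withDensity fun x => ENNReal.ofReal (f x)).map T =
      m.withDensity fun x => ENNReal.ofReal (transfer T f x) := by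
    ext A hA
    rw [Measure.map_apply hT.measurable hA, withDensity_apply _ (hT.measurable hA),
      withDensity_apply _ hA,
      ← ofReal_integral_eq_lintegral_ofReal hf.integrableOn (ae_restrict_of_ae h0),
      ← ofReal_integral_eq_lintegral_ofReal hP.integrableOn (ae_restrict_of_ae hP0),
      setIntegral_transfer hT hf hA]
  have h1 := integral_map (μ := m.withDensity fun x => ENNReal.ofReal (f x)) (f := g)
    hT.measurable.aemeasurable hg.aestronglyMeasurable
  rw [key, integral_withDensity_eq_integral_toReal_smul₀ hP.aemeasurable.ennreal_ofReal
      (ae_of_all _ fun _ => ENNReal.ofReal_lt_top),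
    integral_withDensity_eq_integral_toReal_smul₀ hf.aemeasurable.ennreal_ofReal
      (ae_of_all _ fun _ => ENNReal.ofReal_lt_top)] at h1
  rw [integral_congr_ae (hP0.mono fun x hx => show _ = (ENNReal.ofReal (transfer T f x)).toReal •
    g x by rw [ENNReal.toReal_ofReal hx, smul_eq_mul]), h1]
  exact integral_congr_ae (h0.mono fun x hx => by
    simp only; rw [ENNReal.toReal_ofReal hx, smul_eq_mul])

/-- The duality `∫ (P f) g = ∫ f (g ∘ T)` for bounded `g`. -/
theorem integral_transfer_mul (hT : IsPiecewiseExpanding T) {f g : ℝ → ℝ}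
    (hf : Integrable f m) (hg : Measurable g) {C : ℝ} (hC : ∀ x, |g x| ≤ C) :
    ∫ x, transfer T f x * g x ∂m = ∫ x, f x * g (T x) ∂m := by
  have hpos : Integrable (fun x => max (f x) 0) m := hf.pos_part
  have hneg : Integrable (fun x => max (-f x) 0) m := hf.neg_part
  have hgi : ∀ {F : ℝ → ℝ}, Integrable F m → Integrable (fun x => F x * g x) m := fun hF =>
    hF.mul_bdd hg.aestronglyMeasurable (ae_of_all _ hC)
  have hgTi : ∀ {F : ℝ → ℝ}, Integrable F m → Integrable (fun x => F x * g (T x)) m := fun hF =>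
    hF.mul_bdd (hg.comp hT.measurable).aestronglyMeasurable (ae_of_all _ fun x => hC (T x))
  have h1 := integral_transfer_mul_of_nonneg hT hpos (ae_of_all _ fun x => le_max_right _ _) hg
  have h2 := integral_transfer_mul_of_nonneg hT hneg (ae_of_all _ fun x => le_max_right _ _) hg
  have hfe : f = (fun x => max (f x) 0) + fun x => -1 * max (-f x) 0 := by
    funext x
    simp only [Pi.add_apply]
    rcases le_total 0 (f x) with h | h
    · rw [max_eq_left h, max_eq_right (by linarith)]; ring
    · rw [max_eq_right h, max_eq_left (by linarith)]; ring
  have hL : transfer T f =ᵐ[m] fun x => transfer T (fun x => max (f x) 0) x -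
      transfer T (fun x => max (-f x) 0) x := by
    rw [hfe]
    filter_upwards [transfer_add hT hpos (hneg.const_mul (-1)), transfer_const_mul hT hneg (-1)]
      with x h3 h4
    rw [← hfe] at h3 ⊢
    rw [h3, Pi.add_apply, h4]; ring
  calc ∫ x, transfer T f x * g x ∂m
      = ∫ x, (transfer T (fun x => max (f x) 0) x * g x -
          transfer T (fun x => max (-f x) 0) x * g x) ∂m :=
        integral_congr_ae (hL.mono fun x hx => by simp only; rw [hx]; ring)
    _ = ∫ x, max (f x) 0 * g (T x) ∂m - ∫ x, max (-f x) 0 * g (T x) ∂m := by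
        rw [integral_sub (hgi (integrable_transfer T _)) (hgi (integrable_transfer T _)), h1, h2]
    _ = ∫ x, f x * g (T x) ∂m := by
        rw [← integral_sub (hgTi hpos) (hgTi hneg)]
        refine integral_congr_ae (ae_of_all _ fun x => ?_)
        have := congrFun hfe x
        simp only [Pi.add_apply] at this
        simp only
        rw [← sub_mul]
        congr 1
        linarith

end transfer

end UlamDiffusion
end

noncomputable section

namespace UlamDiffusion

/-! ### Operators satisfying a Lasota-Yorke inequality -/

/-- A normed space with a subspace on which a seminorm `v` is defined, and a functional `I` of norm
at most one. -/
structure VarFrame (E : Type*) [NormedAddCommGroup E] [NormedSpace ℝ E] where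
  S : Submodule ℝ E
  v : E → ℝ
  I : E →L[ℝ] ℝ
  v_nonneg : ∀ x, 0 ≤ v x
  v_add : ∀ x ∈ S, ∀ y ∈ S, v (x + y) ≤ v x + v y
  v_smul : ∀ (c : ℝ), ∀ x ∈ S, v (c • x) ≤ |c| * v x
  I_le : ∀ x, |I x| ≤ ‖x‖

namespace VarFrame

variable {E : Type*} [NormedAddCommGroup E] [NormedSpace ℝ E] (F : VarFrame E)

/-- The strong norm. -/
def bn (x : E) : ℝ := F.v x + ‖x‖

theorem bn_nonneg (x : E) : 0 ≤ F.bn x := add_nonneg (F.v_nonneg x) (norm_nonneg x)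

theorem norm_le_bn (x : E) : ‖x‖ ≤ F.bn x := le_add_of_nonneg_left (F.v_nonneg x)

theorem v_le_bn (x : E) : F.v x ≤ F.bn x := le_add_of_nonneg_right (norm_nonneg x)

theorem bn_add {x y : E} (hx : x ∈ F.S) (hy : y ∈ F.S) : F.bn (x + y) ≤ F.bn x + F.bn y := by
  have h1 := F.v_add x hx y hy
  have h2 := norm_add_le x y
  simp only [bn]; linarith

theorem bn_smul (c : ℝ) {x : E} (hx : x ∈ F.S) : F.bn (c • x) ≤ |c| * F.bn x := by
  have h1 := F.v_smul c x hx
  have h2 : ‖c • x‖ = |c| * ‖x‖ := norm_smul c x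
  simp only [bn, h2]; linarith

theorem bn_sub {x y : E} (hx : x ∈ F.S) (hy : y ∈ F.S) : F.bn (x - y) ≤ F.bn x + F.bn y := by
  have h1 := F.bn_add hx (F.S.smul_mem (-1) hy)
  have h2 := F.bn_smul (-1) hy
  rw [abs_neg, abs_one, one_mul] at h2
  rw [sub_eq_add_neg, ← neg_one_smul ℝ y]
  linarith

/-- `P` is a contraction which preserves `I` and satisfies a Lasota-Yorke inequality. -/
structure LY (P : E →L[ℝ] E) (α B L : ℝ) : Prop where
  norm_le : ∀ x, ‖P x‖ ≤ ‖x‖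
  mem : ∀ x ∈ F.S, P x ∈ F.S
  v_le : ∀ x ∈ F.S, F.v (P x) ≤ α * F.v x + B * ‖x‖
  I_eq : ∀ x, F.I (P x) = F.I x
  α_nonneg : 0 ≤ α
  α_lt : α < 1
  B_nonneg : 0 ≤ B
  L_nonneg : 0 ≤ L
  B_le : B ≤ (1 - α) * L

variable {F}

theorem pow_succ_apply' (P : E →L[ℝ] E) (k : ℕ) (x : E) : (P ^ (k + 1)) x = P ((P ^ k) x) := by
  rw [pow_succ']; rfl

theorem pow_succ_apply (P : E →L[ℝ] E) (k : ℕ) (x : E) : (P ^ (k + 1)) x = (P ^ k) (P x) := by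
  rw [pow_succ]; rfl

theorem pow_add_apply (P : E →L[ℝ] E) (j k : ℕ) (x : E) :
    (P ^ (j + k)) x = (P ^ j) ((P ^ k) x) := by
  rw [pow_add]; rfl

theorem pow_apply_of_fixed {P : E →L[ℝ] E} {x : E} (h : P x = x) (k : ℕ) : (P ^ k) x = x := by
  induction k with
  | zero => simp
  | succ k ih => rw [pow_succ_apply, h, ih]

namespace LY

variable {P Q : E →L[ℝ] E} {α B L : ℝ}

theorem norm_pow_le (h : F.LY P α B L) (k : ℕ) (x : E) : ‖(P ^ k) x‖ ≤ ‖x‖ := by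
  induction k with
  | zero => simp
  | succ k ih => rw [pow_succ_apply']; exact (h.norm_le _).trans ih

theorem pow_mem (h : F.LY P α B L) (k : ℕ) {x : E} (hx : x ∈ F.S) : (P ^ k) x ∈ F.S := by
  induction k with
  | zero => simpa
  | succ k ih => rw [pow_succ_apply']; exact h.mem _ ih

theorem I_pow (h : F.LY P α B L) (k : ℕ) (x : E) : F.I ((P ^ k) x) = F.I x := by
  induction k with
  | zero => simp
  | succ k ih => rw [pow_succ_apply', h.I_eq, ih]

/-- The induction closes because `α L + (1 - α) L = L`. Any `L` above the geometric sum `B / (1 -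
α)` will do, which later allows the integer `a * b`. -/
theorem v_pow_le (h : F.LY P α B L) (k : ℕ) {x : E} (hx : x ∈ F.S) :
    F.v ((P ^ k) x) ≤ α ^ k * F.v x + L * ‖x‖ := by
  induction k with
  | zero => simpa using mul_nonneg h.L_nonneg (norm_nonneg x)
  | succ k ih =>
    rw [pow_succ_apply']
    calc F.v (P ((P ^ k) x)) ≤ α * F.v ((P ^ k) x) + B * ‖(P ^ k) x‖ := h.v_le _ (h.pow_mem k hx)
      _ ≤ α * (α ^ k * F.v x + L * ‖x‖) + (1 - α) * L * ‖x‖ :=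
        add_le_add (mul_le_mul_of_nonneg_left ih h.α_nonneg)
          (mul_le_mul h.B_le (h.norm_pow_le k x) (norm_nonneg _) (h.B_nonneg.trans h.B_le))
      _ = _ := by ring

theorem bn_pow_le' (h : F.LY P α B L) (k : ℕ) {x : E} (hx : x ∈ F.S) :
    F.bn ((P ^ k) x) ≤ α ^ k * F.v x + (L + 1) * ‖x‖ := by
  have h1 := h.v_pow_le k hx
  have h2 := h.norm_pow_le k x
  simp only [bn]; linarith

theorem bn_pow_le (h : F.LY P α B L) (k : ℕ) {x : E} (hx : x ∈ F.S) :
    F.bn ((P ^ k) x) ≤ (L + 1) * F.bn x := by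
  refine (h.bn_pow_le' k hx).trans ?_
  have h1 : α ^ k * F.v x ≤ 1 * F.v x :=
    mul_le_mul_of_nonneg_right (pow_le_one₀ h.α_nonneg h.α_lt.le) (F.v_nonneg x)
  have h2 := mul_nonneg h.L_nonneg (F.v_nonneg x)
  simp only [bn]; linarith

theorem bn_le_of_fixed (h : F.LY P α B L) {x : E} (hx : x ∈ F.S) (hfix : P x = x)
    (hn : ‖x‖ ≤ 1) : F.bn x ≤ L + 1 := by
  have h1 := h.v_le x hx
  rw [hfix] at h1
  have h2 : (1 - α) * F.v x ≤ (1 - α) * L := by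
    have : B * ‖x‖ ≤ B := mul_le_of_le_one_right h.B_nonneg hn
    linarith [h.B_le]
  have h3 := le_of_mul_le_mul_left h2 (sub_pos.2 h.α_lt)
  simp only [bn]; linarith

/-- Telescoping: the error made at each step is `P - Q` applied to an iterate of `Q`, whose strong
norm stays bounded, and the later steps with `P` do not enlarge it in the weak norm. The growth is
therefore only linear in `k`. -/
theorem norm_pow_sub_pow_le (hP : F.LY P α B L) (hQ : F.LY Q α B L) {δ : ℝ} (hδ : 0 ≤ δ)
    (hPQ : ∀ x ∈ F.S, ‖P x - Q x‖ ≤ δ * F.bn x) (k : ℕ) {x : E} (hx : x ∈ F.S) :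
    ‖(P ^ k) x - (Q ^ k) x‖ ≤ k * (δ * (L + 1)) * F.bn x := by
  induction k with
  | zero => simp
  | succ k ih =>
    rw [pow_succ_apply', pow_succ_apply']
    have e : P ((P ^ k) x) - Q ((Q ^ k) x) =
        P ((P ^ k) x - (Q ^ k) x) + (P ((Q ^ k) x) - Q ((Q ^ k) x)) := by
      rw [map_sub]; abel
    rw [e]
    have h1 := (hP.norm_le ((P ^ k) x - (Q ^ k) x)).trans ih
    have h2 := hPQ _ (hQ.pow_mem k hx)
    have h3 := mul_le_mul_of_nonneg_left (hQ.bn_pow_le k hx) hδ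
    refine (norm_add_le _ _).trans ?_
    rw [Nat.cast_succ]
    linarith

/-- Smallness of the weak norm after `n` steps implies contraction of the strong norm after `2n`
steps. -/
theorem bn_pow_two_mul_le (h : F.LY P α B L) {n : ℕ} (hα : α ^ n ≤ 1 / (8 * (L + 1))) {x : E}
    (hx : x ∈ F.S) (hn : ‖(P ^ n) x‖ ≤ 1 / (8 * (L + 1)) * F.bn x) :
    F.bn ((P ^ (2 * n)) x) ≤ 1 / 4 * F.bn x := by
  have hL : 0 < L + 1 := by linarith [h.L_nonneg]
  -- The second `n` steps reduce the variation by `αⁿ` and cost `L + 1` times the weak norm, which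
  -- the first `n` steps made small. Each part contributes `1 / 8`.
  rw [two_mul, pow_add_apply]
  refine (h.bn_pow_le' n (h.pow_mem n hx)).trans ?_
  have h1 : F.v ((P ^ n) x) ≤ (L + 1) * F.bn x := (F.v_le_bn _).trans (h.bn_pow_le n hx)
  have h2 : α ^ n * F.v ((P ^ n) x) ≤ 1 / (8 * (L + 1)) * ((L + 1) * F.bn x) :=
    mul_le_mul hα h1 (F.v_nonneg _) (by positivity)
  have h3 := mul_le_mul_of_nonneg_left hn hL.le
  have e1 : 1 / (8 * (L + 1)) * ((L + 1) * F.bn x) = 1 / 8 * F.bn x := by field_simp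
  have e2 : (L + 1) * (1 / (8 * (L + 1)) * F.bn x) = 1 / 8 * F.bn x := by field_simp
  linarith

/-- Write `k = n j + i` with `i < n`. Then `(1/4)ʲ ≤ e⁻ʲ ≤ e · e^(-k/n)`, and the factor `3` bounds
`e`. -/
theorem bn_pow_le_exp (h : F.LY P α B L) {n : ℕ} (hn : 0 < n)
    (hc : ∀ x ∈ F.S, F.I x = 0 → F.bn ((P ^ n) x) ≤ 1 / 4 * F.bn x) (k : ℕ) {x : E}
    (hx : x ∈ F.S) (hI : F.I x = 0) :
    F.bn ((P ^ k) x) ≤ 3 * (L + 1) * Real.exp (-(1 / n)) ^ k * F.bn x := by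
  have hiter : ∀ j : ℕ, F.bn ((P ^ (n * j)) x) ≤ (1 / 4) ^ j * F.bn x := by
    intro j
    induction j with
    | zero => simp
    | succ j ih =>
      rw [Nat.mul_succ, add_comm, pow_add_apply]
      refine (hc _ (h.pow_mem _ hx) (by rw [h.I_pow, hI])).trans ?_
      rw [pow_succ]
      linarith
  have hL : 0 ≤ L + 1 := by linarith [h.L_nonneg]
  set j := k / n
  have h1 : F.bn ((P ^ k) x) ≤ (L + 1) * ((1 / 4) ^ j * F.bn x) := by
    rw [← Nat.mod_add_div k n, pow_add_apply]
    exact (h.bn_pow_le _ (h.pow_mem _ hx)).trans (mul_le_mul_of_nonneg_left (hiter _) hL)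
  have h2 : (1 / 4 : ℝ) ^ j ≤ 3 * Real.exp (-(1 / n)) ^ k := by
    have e1 : (1 / 4 : ℝ) ≤ Real.exp (-1) := by
      rw [Real.exp_neg, ← one_div]
      exact one_div_le_one_div_of_le (Real.exp_pos _) (by linarith [Real.exp_one_lt_d9])
    have e2 : (k : ℝ) / n ≤ j + 1 := by
      have : k < n * (j + 1) := by
        rw [mul_comm]; exact Nat.lt_mul_of_div_lt (Nat.lt_succ_self _) hn
      rw [div_le_iff₀ (by exact_mod_cast hn)]
      have h' : (k : ℝ) ≤ n * (j + 1) := by exact_mod_cast this.le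
      linarith
    calc (1 / 4 : ℝ) ^ j ≤ Real.exp (-1) ^ j := by gcongr
      _ = Real.exp (-j) := by rw [← Real.exp_nat_mul]; ring_nf
      _ ≤ Real.exp (1 - k / n) := Real.exp_le_exp.2 (by linarith)
      _ = Real.exp 1 * Real.exp (-(1 / n)) ^ k := by
        rw [← Real.exp_nat_mul, ← Real.exp_add]; ring_nf
      _ ≤ _ := by gcongr; linarith [Real.exp_one_lt_d9]
  calc _ ≤ _ := h1
    _ ≤ (L + 1) * ((3 * Real.exp (-(1 / n)) ^ k) * F.bn x) := by
      gcongr; exact F.bn_nonneg x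
    _ = _ := by ring

end LY

/-- The iterates of `P` decay on the kernel of `I`. -/
def Decays (F : VarFrame E) (P : E →L[ℝ] E) (H θ : ℝ) : Prop :=
  ∀ x ∈ F.S, F.I x = 0 → ∀ k : ℕ, ‖(P ^ k) x‖ ≤ H * θ ^ k * F.bn x

theorem LY.decays {P : E →L[ℝ] E} {α B L : ℝ} (h : F.LY P α B L) {n : ℕ} (hn : 0 < n)
    (hc : ∀ x ∈ F.S, F.I x = 0 → F.bn ((P ^ n) x) ≤ 1 / 4 * F.bn x) :
    F.Decays P (3 * (L + 1)) (Real.exp (-(1 / n))) := fun _ hx hI k =>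
  (F.norm_le_bn _).trans (h.bn_pow_le_exp hn hc k hx hI)

theorem Decays.mono {P : E →L[ℝ] E} {H H' θ θ' : ℝ} (h : F.Decays P H θ) (hH : H ≤ H')
    (hH0 : 0 ≤ H') (hθ0 : 0 ≤ θ) (hθ : θ ≤ θ') : F.Decays P H' θ' := fun x hx hI k =>
  (h x hx hI k).trans (by have := F.bn_nonneg x; gcongr)

theorem Decays.tendsto {P : E →L[ℝ] E} {H θ : ℝ} (h : F.Decays P H θ) (hθ0 : 0 ≤ θ) (hθ : θ < 1)
    {x : E} (hx : x ∈ F.S) (hI : F.I x = 0) : Tendsto (fun k => (P ^ k) x) atTop (𝓝 0) := by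
  refine squeeze_zero_norm (h x hx hI) ?_
  have := (tendsto_pow_atTop_nhds_zero_of_lt_one hθ0 hθ).const_mul H |>.mul_const (F.bn x)
  simpa using this

theorem Decays.summable {P : E →L[ℝ] E} {H θ : ℝ} (h : F.Decays P H θ) (hθ0 : 0 ≤ θ)
    (hθ : θ < 1) {x : E} (hx : x ∈ F.S) (hI : F.I x = 0) :
    Summable fun k => ‖(P ^ k) x‖ :=
  Summable.of_nonneg_of_le (fun _ => norm_nonneg _) (h x hx hI)
    (((summable_geometric_of_lt_one hθ0 hθ).mul_left H).mul_right _)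

theorem Decays.tsum_tail_le {P : E →L[ℝ] E} {H θ : ℝ} (h : F.Decays P H θ) (hθ0 : 0 ≤ θ)
    (hθ : θ < 1) {x : E} (hx : x ∈ F.S) (hI : F.I x = 0) (n : ℕ) :
    ∑' k, ‖(P ^ (k + n)) x‖ ≤ H * θ ^ n * (1 - θ)⁻¹ * F.bn x := by
  have hs := (summable_nat_add_iff n).2 (h.summable hθ0 hθ hx hI)
  have hg := (((summable_geometric_of_lt_one hθ0 hθ).mul_left (H * θ ^ n)).mul_right (F.bn x))
  calc ∑' k, ‖(P ^ (k + n)) x‖ ≤ ∑' k : ℕ, H * θ ^ n * θ ^ k * F.bn x := by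
        refine hs.tsum_le_tsum (fun k => (h x hx hI (k + n)).trans (le_of_eq ?_)) hg
        rw [pow_add]; ring
    _ = _ := by
        rw [tsum_mul_right, tsum_mul_left, tsum_geometric_of_lt_one hθ0 hθ]

theorem Decays.eq_zero_of_fixed {P : E →L[ℝ] E} {H θ : ℝ} (h : F.Decays P H θ) (hθ0 : 0 ≤ θ) (hθ : θ < 1) {x : E}
    (hx : x ∈ F.S) (hI : F.I x = 0) (hfix : P x = x) : x = 0 := by
  have := h.tendsto hθ0 hθ hx hI
  simp only [pow_apply_of_fixed hfix] at this
  exact tendsto_nhds_unique tendsto_const_nhds this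

/-! ### Neumann series and existence of fixed points -/

section series

variable {P : E →L[ℝ] E} {H θ : ℝ} [CompleteSpace E]

theorem Decays.summable_apply (h : F.Decays P H θ) (hθ0 : 0 ≤ θ) (hθ : θ < 1) {x : E}
    (hx : x ∈ F.S) (hI : F.I x = 0) : Summable fun k => (P ^ k) x :=
  (h.summable hθ0 hθ hx hI).of_norm

/-- The Neumann series solves `g - P g = x`. -/
theorem Decays.tsum_sub (h : F.Decays P H θ) (hθ0 : 0 ≤ θ) (hθ : θ < 1) {x : E}
    (hx : x ∈ F.S) (hI : F.I x = 0) :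
    (∑' k, (P ^ k) x) - P (∑' k, (P ^ k) x) = x := by
  have hs := h.summable_apply hθ0 hθ hx hI
  rw [P.map_tsum hs]
  simp only [← pow_succ_apply']
  rw [hs.tsum_eq_zero_add]
  simp

theorem Decays.I_tsum {α B L : ℝ} (h : F.Decays P H θ) (hP : F.LY P α B L) (hθ0 : 0 ≤ θ)
    (hθ : θ < 1) {x : E} (hx : x ∈ F.S) (hI : F.I x = 0) : F.I (∑' k, (P ^ k) x) = 0 := by
  rw [F.I.map_tsum (h.summable_apply hθ0 hθ hx hI)]
  simp only [hP.I_pow, hI, tsum_zero]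

/-- The vector `P e - e` is annihilated by `I`, so its orbit is summable. The partial sums telescope
to `Pⁿ e - e`. -/
theorem Decays.exists_fixed {α B L : ℝ} (h : F.Decays P H θ) (hP : F.LY P α B L) (hθ0 : 0 ≤ θ)
    (hθ : θ < 1) {e : E} (he : e ∈ F.S) :
    ∃ x, P x = x ∧ Tendsto (fun k => (P ^ k) e) atTop (𝓝 x) := by
  have hd : P e - e ∈ F.S := F.S.sub_mem (hP.mem _ he) he
  have hI : F.I (P e - e) = 0 := by rw [map_sub, hP.I_eq, sub_self]
  have hs := h.summable_apply hθ0 hθ hd hI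
  have hsum : ∀ n, ∑ k ∈ Finset.range n, (P ^ k) (P e - e) = (P ^ n) e - e := by
    intro n
    have := Finset.sum_range_sub (fun k => (P ^ k) e) n
    simp only [pow_zero, one_apply_eq_self] at this
    rw [← this]
    refine Finset.sum_congr rfl fun k _ => ?_
    rw [map_sub, pow_succ_apply]
  have ht : Tendsto (fun k => (P ^ k) e) atTop (𝓝 (∑' k, (P ^ k) (P e - e) + e)) := by
    have := hs.hasSum.tendsto_sum_nat
    simp only [hsum] at this
    simpa using this.add_const e
  refine ⟨_, ?_, ht⟩
  have h1 := ht.comp (tendsto_add_atTop_nat 1)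
  have h2 := (P.continuous.tendsto _).comp ht
  refine tendsto_nhds_unique (h2.congr fun k => ?_) h1
  exact (pow_succ_apply' P k e).symm

end series

/-! ### Quantitative comparison of two operators -/

section perturbation

variable {P Q D : E →L[ℝ] E} {α B L : ℝ}

theorem inv_one_sub_exp_le {R : ℝ} (hR : 0 < R) : (1 - Real.exp (-(1 / R)))⁻¹ ≤ R + 1 := by
  have h1 : Real.exp (-(1 / R)) ≤ R / (R + 1) := by
    rw [Real.exp_neg, inv_le_comm₀ (Real.exp_pos _) (by positivity)]
    have := Real.add_one_le_exp (1 / R)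
    refine le_trans (le_of_eq ?_) this
    field_simp
    ring
  have h2 : (R + 1)⁻¹ ≤ 1 - Real.exp (-(1 / R)) := by
    have : R / (R + 1) = 1 - (R + 1)⁻¹ := by field_simp; ring
    linarith
  rw [inv_le_comm₀ _ (by positivity)]
  · exact h2
  · exact lt_of_lt_of_le (by positivity) h2

theorem exp_neg_inv_lt_one {R : ℝ} (hR : 0 < R) : Real.exp (-(1 / R)) < 1 := by
  exact (Real.exp_lt_exp.2 (neg_lt_zero.2 (one_div_pos.2 hR))).trans_eq Real.exp_zero

/-- This number of iterations brings the decay down to the size `ε`. Every power of `log ε⁻¹` in the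
final estimate comes from here. -/
theorem exists_nat_exp_pow_le {R ε : ℝ} (hR : 0 < R) (hε : 0 < ε) (hε1 : 1 ≤ Real.log ε⁻¹) :
    ∃ n : ℕ, Real.exp (-(1 / R)) ^ n ≤ ε ∧ (n : ℝ) ≤ (R + 1) * Real.log ε⁻¹ := by
  refine ⟨⌈R * Real.log ε⁻¹⌉₊, ?_, ?_⟩
  · have h := Nat.le_ceil (R * Real.log ε⁻¹)
    rw [← Real.exp_nat_mul]
    calc _ ≤ Real.exp (-Real.log ε⁻¹) := by
          refine Real.exp_le_exp.2 ?_
          rw [mul_neg, neg_le_neg_iff, mul_one_div, le_div_iff₀ hR]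
          linarith
      _ = ε := by rw [Real.log_inv, neg_neg, Real.exp_log hε]
  · have h := (Nat.ceil_lt_add_one (a := R * Real.log ε⁻¹) (by positivity)).le
    linarith

/-- Distance of the fixed points of two operators. -/
theorem norm_fixed_sub_le (hP : F.LY P α B L) (hQ : F.LY Q α B L) {δ ε H R : ℝ} (hδ : 0 ≤ δ)
    (hPQ : ∀ x ∈ F.S, ‖P x - Q x‖ ≤ δ * ε * F.bn x) (hR : 0 < R) (hH : 0 ≤ H)
    (hdP : F.Decays P H (Real.exp (-(1 / R)))) (hε : 0 < ε) (hε1 : 1 ≤ Real.log ε⁻¹) {x y : E}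
    (hx : x ∈ F.S) (hy : y ∈ F.S) (hPx : P x = x) (hQy : Q y = y) (hI : F.I x = F.I y)
    (hxn : ‖x‖ ≤ 1) (hyn : ‖y‖ ≤ 1) :
    ‖x - y‖ ≤ (2 * H * (L + 1) + (R + 1) * (δ * (L + 1)) * (L + 1)) * ε * Real.log ε⁻¹ := by
  obtain ⟨n, hn1, hn2⟩ := exists_nat_exp_pow_le hR hε hε1
  have hL := hP.L_nonneg
  have hbx := hP.bn_le_of_fixed hx hPx hxn
  have hby := hQ.bn_le_of_fixed hy hQy hyn
  -- The first summand is of size `ε` by decay. The second consists of `n` errors of size `ε` and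
  -- produces the logarithm.
  have h1 : x - y = (P ^ n) (x - y) + ((P ^ n) y - (Q ^ n) y) := by
    rw [map_sub, pow_apply_of_fixed hPx, pow_apply_of_fixed hQy]; abel
  have h2 := hdP (x - y) (F.S.sub_mem hx hy) (by rw [map_sub, hI, sub_self]) n
  have h3 := hP.norm_pow_sub_pow_le hQ (by positivity) hPQ n hy
  have h4 : F.bn (x - y) ≤ 2 * (L + 1) := (F.bn_sub hx hy).trans (by linarith)
  rw [h1]
  refine (norm_add_le _ _).trans ?_
  have h5 : H * Real.exp (-(1 / R)) ^ n * F.bn (x - y) ≤ H * ε * (2 * (L + 1)) := by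
    have := F.bn_nonneg (x - y); gcongr
  have h6 : n * (δ * ε * (L + 1)) * F.bn y ≤
      ((R + 1) * Real.log ε⁻¹) * (δ * ε * (L + 1)) * (L + 1) := by
    have := F.bn_nonneg y; gcongr
  have h7 : H * ε * (2 * (L + 1)) * 1 ≤ H * ε * (2 * (L + 1)) * Real.log ε⁻¹ := by gcongr
  calc _ ≤ H * ε * (2 * (L + 1)) * Real.log ε⁻¹ +
        ((R + 1) * Real.log ε⁻¹) * (δ * ε * (L + 1)) * (L + 1) := by linarith
    _ = _ := by ring

/-- Distance of the sums of the orbits of two operators. -/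
theorem tsum_norm_pow_sub_pow_le (hP : F.LY P α B L) (hQ : F.LY Q α B L) {δ ε H R X Y : ℝ}
    (hδ : 0 ≤ δ) (hPQ : ∀ x ∈ F.S, ‖P x - Q x‖ ≤ δ * ε * F.bn x) (hR : 0 < R) (hH : 0 ≤ H)
    (hdP : F.Decays P H (Real.exp (-(1 / R)))) (hdQ : F.Decays Q H (Real.exp (-(1 / R))))
    (hε : 0 < ε) (hε1 : 1 ≤ Real.log ε⁻¹) {x y : E} (hx : x ∈ F.S) (hy : y ∈ F.S)
    (hIx : F.I x = 0) (hIy : F.I y = 0) (hX : 0 ≤ X) (hY : 0 ≤ Y)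
    (hxy : ‖x - y‖ ≤ X * ε * Real.log ε⁻¹) (hxY : F.bn x ≤ Y) (hyY : F.bn y ≤ Y) :
    ∑' k, ‖(P ^ k) x - (Q ^ k) y‖ ≤ ((R + 1) * X + (R + 1) ^ 2 * (δ * (L + 1)) * Y +
      2 * H * (R + 1) * Y) * ε * Real.log ε⁻¹ ^ 2 := by
  obtain ⟨n, hn1, hn2⟩ := exists_nat_exp_pow_le hR hε hε1
  have hL := hP.L_nonneg
  set ℓ := Real.log ε⁻¹
  set θ := Real.exp (-(1 / R)) with hθ
  have hθ0 : 0 ≤ θ := (Real.exp_pos _).le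
  have hθ1 : θ < 1 := exp_neg_inv_lt_one hR
  have hsP := hdP.summable hθ0 hθ1 hx hIx
  have hsQ := hdQ.summable hθ0 hθ1 hy hIy
  have hs : Summable fun k => ‖(P ^ k) x - (Q ^ k) y‖ :=
    Summable.of_nonneg_of_le (fun _ => norm_nonneg _) (fun _ => norm_sub_le _ _) (hsP.add hsQ)
  rw [← hs.sum_add_tsum_nat_add n]
  -- Each of the two geometric tails is at most `H ε (R + 1) Y`; the factor `ℓ² ≥ 1` is inserted
  -- only to match the head.
  have htail : ∑' k, ‖(P ^ (k + n)) x - (Q ^ (k + n)) y‖ ≤ 2 * H * (R + 1) * Y * ε * ℓ ^ 2 := by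
    have hsP' := (summable_nat_add_iff n).2 hsP
    have hsQ' := (summable_nat_add_iff n).2 hsQ
    have h1 : ∑' k, ‖(P ^ (k + n)) x - (Q ^ (k + n)) y‖ ≤
        ∑' k, (‖(P ^ (k + n)) x‖ + ‖(Q ^ (k + n)) y‖) :=
      ((summable_nat_add_iff n).2 hs).tsum_le_tsum (fun _ => norm_sub_le _ _) (hsP'.add hsQ')
    rw [hsP'.tsum_add hsQ'] at h1
    have hinv := inv_one_sub_exp_le hR
    have hb : ∀ z, F.bn z ≤ Y → H * θ ^ n * (1 - θ)⁻¹ * F.bn z ≤ H * ε * (R + 1) * Y := by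
      intro z hz
      have := F.bn_nonneg z
      have : 0 ≤ (1 - θ)⁻¹ := inv_nonneg.2 (by linarith)
      gcongr
    have h2 := (hdP.tsum_tail_le hθ0 hθ1 hx hIx n).trans (hb x hxY)
    have h3 := (hdQ.tsum_tail_le hθ0 hθ1 hy hIy n).trans (hb y hyY)
    have h4 : 2 * H * (R + 1) * Y * ε * 1 ≤ 2 * H * (R + 1) * Y * ε * ℓ ^ 2 := by
      gcongr; nlinarith
    linarith
  -- There are at most `(R + 1) ℓ` terms. Each is `O(ε ℓ)`: one part is the distance of the initial
  -- vectors, the other the accumulated operator error.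
  have hhead : ∑ k ∈ Finset.range n, ‖(P ^ k) x - (Q ^ k) y‖ ≤
      ((R + 1) * X + (R + 1) ^ 2 * (δ * (L + 1)) * Y) * ε * ℓ ^ 2 := by
    have h1 : ∀ k ∈ Finset.range n, ‖(P ^ k) x - (Q ^ k) y‖ ≤
        X * ε * ℓ + n * (δ * ε * (L + 1)) * Y := by
      intro k hk
      have e : (P ^ k) x - (Q ^ k) y = (P ^ k) (x - y) + ((P ^ k) y - (Q ^ k) y) := by
        rw [map_sub]; abel
      rw [e]
      have h2 := (hP.norm_pow_le k (x - y)).trans hxy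
      have h3 := hP.norm_pow_sub_pow_le hQ (by positivity) hPQ k hy
      have h4 : (k : ℝ) * (δ * ε * (L + 1)) * F.bn y ≤ n * (δ * ε * (L + 1)) * Y := by
        have := F.bn_nonneg y
        have hkn : (k : ℝ) ≤ n := by exact_mod_cast (Finset.mem_range.1 hk).le
        gcongr
      exact (norm_add_le _ _).trans (by linarith)
    refine (Finset.sum_le_sum h1).trans ?_
    rw [Finset.sum_const, Finset.card_range, nsmul_eq_mul]
    have hℓ : 0 ≤ ℓ := by linarith
    calc (n : ℝ) * (X * ε * ℓ + n * (δ * ε * (L + 1)) * Y)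
        ≤ ((R + 1) * ℓ) * (X * ε * ℓ + ((R + 1) * ℓ) * (δ * ε * (L + 1)) * Y) := by gcongr
      _ = _ := by ring
  calc _ ≤ _ := add_le_add hhead htail
    _ = _ := by ring

/-- `D` acts on the frame like the multiplication by a function bounded by `M`. -/
structure Mult (F : VarFrame E) (D : E →L[ℝ] E) (M U : ℝ) : Prop where
  norm_le : ∀ x, ‖D x‖ ≤ M * ‖x‖
  mem : ∀ x ∈ F.S, D x ∈ F.S
  bn_le : ∀ x ∈ F.S, F.bn (D x) ≤ U * F.bn x
  M_nonneg : 0 ≤ M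
  U_nonneg : 0 ≤ U

/-- The product of the centered multiplier with `x`. -/
def cen (F : VarFrame E) (D : E →L[ℝ] E) (x : E) : E := D x - F.I (D x) • x

namespace Mult

variable {M U : ℝ}

theorem abs_I_le (hD : F.Mult D M U) (x : E) : |F.I (D x)| ≤ M * ‖x‖ :=
  (F.I_le _).trans (hD.norm_le x)

theorem cen_mem (hD : F.Mult D M U) {x : E} (hx : x ∈ F.S) : F.cen D x ∈ F.S :=
  F.S.sub_mem (hD.mem x hx) (F.S.smul_mem _ hx)

theorem I_cen {x : E} (hx : F.I x = 1) : F.I (F.cen D x) = 0 := by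
  simp [cen, hx]

theorem bn_cen_le (hD : F.Mult D M U) {x : E} (hx : x ∈ F.S) (hn : ‖x‖ ≤ 1) :
    F.bn (F.cen D x) ≤ (U + M) * F.bn x := by
  have h1 := F.bn_sub (hD.mem x hx) (F.S.smul_mem (F.I (D x)) hx)
  have h2 := F.bn_smul (F.I (D x)) hx
  have h3 := hD.abs_I_le x
  have h4 : |F.I (D x)| ≤ M := h3.trans (mul_le_of_le_one_right hD.M_nonneg hn)
  have h5 := mul_le_mul_of_nonneg_right h4 (F.bn_nonneg x)
  have h6 := hD.bn_le x hx
  rw [cen]; linarith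

/-- Three terms change, each by at most `M ‖x - y‖`: the product, the mean that is subtracted, and
the vector multiplied by that mean. -/
theorem norm_cen_sub_le (hD : F.Mult D M U) {x y : E} (hx : ‖x‖ ≤ 1) (hy : ‖y‖ ≤ 1) :
    ‖F.cen D x - F.cen D y‖ ≤ 3 * M * ‖x - y‖ := by
  have e : F.cen D x - F.cen D y =
      D (x - y) - (F.I (D (x - y)) • x + F.I (D y) • (x - y)) := by
    simp only [cen, map_sub, sub_smul, smul_sub]; abel
  rw [e]
  have h1 := hD.norm_le (x - y)
  have h2 : ‖F.I (D (x - y)) • x‖ ≤ M * ‖x - y‖ * 1 := by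
    rw [norm_smul]
    exact mul_le_mul (hD.abs_I_le _) hx (norm_nonneg _)
      (mul_nonneg hD.M_nonneg (norm_nonneg _))
  have h3 : ‖F.I (D y) • (x - y)‖ ≤ M * ‖x - y‖ := by
    rw [norm_smul]
    exact mul_le_mul_of_nonneg_right ((hD.abs_I_le y).trans
      (mul_le_of_le_one_right hD.M_nonneg hy)) (norm_nonneg _)
  refine (norm_sub_le _ _).trans ?_
  have := norm_add_le (F.I (D (x - y)) • x) (F.I (D y) • (x - y))
  linarith

end Mult

/-- The stability estimate for the sums `I (D f) + 2 ∑_{k ≥ 1} I (D (Pᵏ f))`. -/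
theorem abs_coefficient_sub_le (hP : F.LY P α B L) (hQ : F.LY Q α B L)
    {δ ε H R M U : ℝ} (hδ : 0 ≤ δ) (hPQ : ∀ x ∈ F.S, ‖P x - Q x‖ ≤ δ * ε * F.bn x) (hR : 0 < R)
    (hH : 0 ≤ H) (hdP : F.Decays P H (Real.exp (-(1 / R))))
    (hdQ : F.Decays Q H (Real.exp (-(1 / R)))) (hε : 0 < ε) (hε1 : 1 ≤ Real.log ε⁻¹)
    (hD : F.Mult D M U) {x y : E} (hx : x ∈ F.S) (hy : y ∈ F.S) (hPx : P x = x) (hQy : Q y = y)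
    (hIx : F.I x = 1) (hIy : F.I y = 1) (hxn : ‖x‖ ≤ 1) (hyn : ‖y‖ ≤ 1) {s t : ℝ}
    (hs : HasSum (fun k => F.I (D ((P ^ (k + 1)) (F.cen D x)))) s)
    (ht : HasSum (fun k => F.I (D ((Q ^ (k + 1)) (F.cen D y)))) t) :
    |(F.I (D (F.cen D y)) + 2 * t) - (F.I (D (F.cen D x)) + 2 * s)| ≤
      2 * M * ((R + 1) * (3 * M * (2 * H * (L + 1) + (R + 1) * (δ * (L + 1)) * (L + 1))) +
        (R + 1) ^ 2 * (δ * (L + 1)) * ((U + M) * (L + 1)) +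
        2 * H * (R + 1) * ((U + M) * (L + 1))) * ε * Real.log ε⁻¹ ^ 2 := by
  have hL := hP.L_nonneg
  have hM := hD.M_nonneg
  have hU := hD.U_nonneg
  set f := F.cen D x
  set g := F.cen D y
  have hf : f ∈ F.S := hD.cen_mem hx
  have hg : g ∈ F.S := hD.cen_mem hy
  have hIf : F.I f = 0 := Mult.I_cen hIx
  have hIg : F.I g = 0 := Mult.I_cen hIy
  have hxy := norm_fixed_sub_le hP hQ hδ hPQ hR hH hdP hε hε1 hx hy hPx hQy
    (hIx.trans hIy.symm) hxn hyn
  have hfg : ‖f - g‖ ≤ (3 * M * (2 * H * (L + 1) + (R + 1) * (δ * (L + 1)) * (L + 1))) * ε *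
      Real.log ε⁻¹ := by
    refine (hD.norm_cen_sub_le hxn hyn).trans ?_
    have := mul_le_mul_of_nonneg_left hxy (show 0 ≤ 3 * M by positivity)
    linarith
  have hbf : F.bn f ≤ (U + M) * (L + 1) := (hD.bn_cen_le hx hxn).trans
    (mul_le_mul_of_nonneg_left (hP.bn_le_of_fixed hx hPx hxn) (by positivity))
  have hbg : F.bn g ≤ (U + M) * (L + 1) := (hD.bn_cen_le hy hyn).trans
    (mul_le_mul_of_nonneg_left (hQ.bn_le_of_fixed hy hQy hyn) (by positivity))
  have key := tsum_norm_pow_sub_pow_le hP hQ hδ hPQ hR hH hdP hdQ hε hε1 hf hg hIf hIg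
    (by positivity) (by positivity) hfg hbf hbg
  have hθ0 : 0 ≤ Real.exp (-(1 / R)) := (Real.exp_pos _).le
  have hθ1 : Real.exp (-(1 / R)) < 1 :=
    exp_neg_inv_lt_one hR
  have hsum : Summable fun k => ‖(P ^ k) f - (Q ^ k) g‖ :=
    Summable.of_nonneg_of_le (fun _ => norm_nonneg _) (fun _ => norm_sub_le _ _)
      ((hdP.summable hθ0 hθ1 hf hIf).add (hdQ.summable hθ0 hθ1 hg hIg))
  have hsplit := hsum.tsum_eq_zero_add
  simp only [pow_zero, one_apply_eq_self] at hsplit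
  have h0 : |F.I (D g) - F.I (D f)| ≤ M * ‖f - g‖ := by
    rw [← map_sub, ← map_sub, norm_sub_rev]; exact hD.abs_I_le _
  have h1 : |t - s| ≤ M * ∑' k, ‖(P ^ (k + 1)) f - (Q ^ (k + 1)) g‖ := by
    have hd := ht.sub hs
    rw [← hd.tsum_eq, ← tsum_mul_left]
    have hsum' := ((summable_nat_add_iff 1).2 hsum).mul_left M
    rw [← Real.norm_eq_abs]
    refine tsum_of_norm_bounded hsum'.hasSum fun k => ?_
    rw [← map_sub, ← map_sub, norm_sub_rev ((P ^ (k + 1)) f)]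
    exact hD.abs_I_le _
  have h2 : |(F.I (D g) + 2 * t) - (F.I (D f) + 2 * s)| ≤
      |F.I (D g) - F.I (D f)| + 2 * |t - s| := by
    have e : (F.I (D g) + 2 * t) - (F.I (D f) + 2 * s) =
      (F.I (D g) - F.I (D f)) + 2 * (t - s) := by ring
    rw [e]
    refine (abs_add_le _ _).trans ?_
    rw [abs_mul, abs_of_pos (two_pos : (0 : ℝ) < 2)]
  have h3 : 0 ≤ M * ‖f - g‖ := by positivity
  have h4 := mul_le_mul_of_nonneg_left key (show 0 ≤ 2 * M by positivity)
  -- The term `k = 0` has weight one in the coefficient; giving it weight two as well completes the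
  -- sum.
  calc _ ≤ 2 * M * ∑' k, ‖(P ^ k) f - (Q ^ k) g‖ := by rw [hsplit]; linarith
    _ ≤ _ := by linarith

end perturbation

end VarFrame

end UlamDiffusion
end

noncomputable section

namespace UlamDiffusion

/-! ### Exponential decay from the absence of peripheral eigenvalues -/

/-- Every endomorphism of a nontrivial finite-dimensional real space has a complex eigenvalue
`a + b i`, with an eigenvector `u + w i` in the complexification. -/
theorem exists_complex_eigenvector {V : Type*} [AddCommGroup V] [Module ℝ V]
    [FiniteDimensional ℝ V] [Nontrivial V] (A : V →ₗ[ℝ] V) :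
    ∃ (a b : ℝ) (u w : V), (u ≠ 0 ∨ w ≠ 0) ∧ A u = a • u - b • w ∧ A w = b • u + a • w := by
  classical
  set β := Module.finBasis ℝ V
  set N := LinearMap.toMatrix β β A
  have hpos : 0 < Module.finrank ℝ V := Module.finrank_pos
  have : Nonempty (Fin (Module.finrank ℝ V)) := ⟨⟨0, hpos⟩⟩
  -- The complex eigenvector is found for the matrix of `A` with entries viewed in `ℂ`. Its real and
  -- imaginary parts are coordinates of `u` and `w`.
  obtain ⟨z, hz⟩ := Module.End.exists_eigenvalue (Matrix.toLin' (N.map (Complex.ofReal)))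
  obtain ⟨f, hf⟩ := hz.exists_hasEigenvector
  have hfz : ∀ i, ∑ j, (N i j : ℂ) * f j = z * f i := by
    intro i
    have := congrFun hf.apply_eq_smul i
    simpa [Matrix.toLin'_apply, Matrix.mulVec, dotProduct] using this
  have hA : ∀ x : V, ∀ i, β.repr (A x) i = ∑ j, N i j * β.repr x j := by
    intro x i
    have := congrFun (LinearMap.toMatrix_mulVec_repr β β A x) i
    rw [← this]; rfl
  refine ⟨z.re, z.im, β.equivFun.symm fun i => (f i).re, β.equivFun.symm fun i => (f i).im,
    ?_, ?_, ?_⟩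
  · by_contra h
    push Not at h
    obtain ⟨h1, h2⟩ := h
    rw [LinearEquiv.map_eq_zero_iff] at h1 h2
    refine hf.2 (funext fun i => Complex.ext ?_ ?_)
    · exact congrFun h1 i
    · exact congrFun h2 i
  · refine β.repr.injective (Finsupp.ext fun i => ?_)
    rw [hA]
    have h := congrArg Complex.re (hfz i)
    simp only [Complex.re_sum, Complex.mul_re, Complex.ofReal_re, Complex.ofReal_im,
      zero_mul, sub_zero] at h
    simp only [map_sub, map_smul, Finsupp.coe_sub, Finsupp.coe_smul, Pi.sub_apply, Pi.smul_apply,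
      smul_eq_mul, ← Module.Basis.equivFun_apply, LinearEquiv.apply_symm_apply]
    exact h
  · refine β.repr.injective (Finsupp.ext fun i => ?_)
    rw [hA]
    have h := congrArg Complex.im (hfz i)
    simp only [Complex.im_sum, Complex.mul_im, Complex.ofReal_re, Complex.ofReal_im,
      zero_mul, add_zero] at h
    simp only [map_add, map_smul, Finsupp.coe_add, Finsupp.coe_smul, Pi.add_apply, Pi.smul_apply,
      smul_eq_mul, ← Module.Basis.equivFun_apply, LinearEquiv.apply_symm_apply]
    rw [h]; ring

namespace VarFrame

variable {E : Type*} [NormedAddCommGroup E] [NormedSpace ℝ E] {F : VarFrame E}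
  {P : E →L[ℝ] E} {α B L : ℝ}

/-- Formally `P (u + i w) = (a + b i)(u + i w)`; these are the real and imaginary parts of its
iterates. -/
theorem pow_apply_eigen {a b : ℝ} {u w : E} (hu : P u = a • u - b • w) (hw : P w = b • u + a • w)
    (k : ℕ) : (P ^ k) u = ((⟨a, b⟩ : ℂ) ^ k).re • u - ((⟨a, b⟩ : ℂ) ^ k).im • w ∧
      (P ^ k) w = ((⟨a, b⟩ : ℂ) ^ k).im • u + ((⟨a, b⟩ : ℂ) ^ k).re • w := by
  induction k with
  | zero => simp
  | succ k ih =>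
    rw [pow_succ_apply', pow_succ_apply', ih.1, ih.2, pow_succ, Complex.mul_re, Complex.mul_im]
    simp only [map_sub, map_add, map_smul, hu, hw]
    constructor <;> module

/-- A recurrent eigenvector belongs to an eigenvalue of modulus one. -/
theorem norm_eigenvalue_eq_one (hP : F.LY P α B L) {n : ℕ → ℕ} (hn : Tendsto n atTop atTop)
    {a b : ℝ} {u w : E} (hne : u ≠ 0 ∨ w ≠ 0)
    (hu : P u = a • u - b • w) (hw : P w = b • u + a • w)
    (hru : Tendsto (fun j => (P ^ n j) u) atTop (𝓝 u))
    (hrw : Tendsto (fun j => (P ^ n j) w) atTop (𝓝 w)) : ‖(⟨a, b⟩ : ℂ)‖ = 1 := by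
  set z : ℂ := ⟨a, b⟩
  have hpow := pow_apply_eigen hu hw
  rcases lt_trichotomy ‖z‖ 1 with h | h | h
  · exfalso
    -- For `‖z‖ < 1` the orbits of `u` and `w` tend to zero, which contradicts recurrence.
    have hz := tendsto_pow_atTop_nhds_zero_of_norm_lt_one h
    have hre : Tendsto (fun k => (z ^ k).re) atTop (𝓝 0) := by
      exact ((Complex.continuous_re.tendsto 0).comp hz)
    have him : Tendsto (fun k => (z ^ k).im) atTop (𝓝 0) := by
      exact ((Complex.continuous_im.tendsto 0).comp hz)
    have h1 : Tendsto (fun k => (P ^ k) u) atTop (𝓝 0) := by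
      simp only [fun k => (hpow k).1]
      simpa using (hre.smul_const u).sub (him.smul_const w)
    have h2 : Tendsto (fun k => (P ^ k) w) atTop (𝓝 0) := by
      simp only [fun k => (hpow k).2]
      simpa using (him.smul_const u).add (hre.smul_const w)
    rcases hne with h0 | h0
    · exact h0 (tendsto_nhds_unique hru (h1.comp hn))
    · exact h0 (tendsto_nhds_unique hrw (h2.comp hn))
  · exact h
  · exfalso
    -- For `‖z‖ > 1`, multiplying by the conjugate of `zᵏ` recovers `‖z‖²ᵏ y` from the `k`-th
    -- iterates with coefficients of size at most `‖z‖ᵏ`. As `P` is a contraction, `‖z‖ᵏ ‖y‖` would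
    -- stay bounded.
    have key : ∀ y : E, y ≠ 0 → (∀ k, ∃ p q : ℝ, |p| ≤ ‖z‖ ^ k ∧ |q| ≤ ‖z‖ ^ k ∧
        p • (P ^ k) u + q • (P ^ k) w = (‖z‖ ^ k * ‖z‖ ^ k) • y) → False := by
      intro y hy hk
      have hy' := norm_pos_iff.2 hy
      obtain ⟨k, hk'⟩ := ((tendsto_pow_atTop_atTop_of_one_lt h).eventually
        (eventually_gt_atTop ((‖u‖ + ‖w‖) / ‖y‖))).exists
      rw [div_lt_iff₀ hy'] at hk'
      obtain ⟨p, q, hp, hq, hpq⟩ := hk k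
      have hpos : 0 < ‖z‖ ^ k := pow_pos (one_pos.trans h) k
      have h1 : ‖(‖z‖ ^ k * ‖z‖ ^ k) • y‖ = ‖z‖ ^ k * ‖z‖ ^ k * ‖y‖ := by
        rw [norm_smul, Real.norm_of_nonneg (by positivity)]
      have h2 : ‖p • (P ^ k) u + q • (P ^ k) w‖ ≤ ‖z‖ ^ k * ‖u‖ + ‖z‖ ^ k * ‖w‖ := by
        refine (norm_add_le _ _).trans (add_le_add ?_ ?_) <;> rw [norm_smul]
        · exact mul_le_mul hp (hP.norm_pow_le k u) (norm_nonneg _) hpos.le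
        · exact mul_le_mul hq (hP.norm_pow_le k w) (norm_nonneg _) hpos.le
      rw [hpq, h1, ← mul_add, mul_assoc] at h2
      have h3 := le_of_mul_le_mul_left h2 hpos
      linarith
    have hn2 : ∀ k, ‖z‖ ^ k * ‖z‖ ^ k = (z ^ k).re * (z ^ k).re + (z ^ k).im * (z ^ k).im := by
      intro k
      rw [← norm_pow, ← Complex.normSq_apply, Complex.normSq_eq_norm_sq, sq]
    have hre : ∀ k, |(z ^ k).re| ≤ ‖z‖ ^ k := fun k => by
      rw [← norm_pow]; exact Complex.abs_re_le_norm _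
    have him : ∀ k, |(z ^ k).im| ≤ ‖z‖ ^ k := fun k => by
      rw [← norm_pow]; exact Complex.abs_im_le_norm _
    rcases hne with h0 | h0
    · refine key u h0 fun k => ⟨_, _, hre k, him k, ?_⟩
      rw [(hpow k).1, (hpow k).2, hn2]
      module
    · refine key w h0 fun k => ⟨-(z ^ k).im, (z ^ k).re, by rw [abs_neg]; exact him k, hre k, ?_⟩
      rw [(hpow k).1, (hpow k).2, hn2]
      module

/-- Balls of the strong norm are precompact, and `v` is lower semicontinuous. -/
structure Compact (F : VarFrame E) : Prop where
  totallyBounded : ∀ R : ℝ, TotallyBounded {x | x ∈ F.S ∧ F.bn x ≤ R}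
  lsc : ∀ (u : ℕ → E) (x : E) (R : ℝ), 0 ≤ R → (∀ n, u n ∈ F.S) → (∀ n, F.v (u n) ≤ R) →
    Tendsto u atTop (𝓝 x) → x ∈ F.S ∧ F.v x ≤ R

/-- The mean zero elements to which the iterates return along the times `n j`. -/
def recurrent (F : VarFrame E) (P : E →L[ℝ] E) (n : ℕ → ℕ) : Submodule ℝ E where
  carrier := {x | x ∈ F.S ∧ F.I x = 0 ∧ Tendsto (fun j => (P ^ n j) x) atTop (𝓝 x)}
  add_mem' := fun {x y} hx hy => ⟨F.S.add_mem hx.1 hy.1, by rw [map_add, hx.2.1, hy.2.1, add_zero],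
    by simpa only [map_add] using hx.2.2.add hy.2.2⟩
  zero_mem' := ⟨F.S.zero_mem, map_zero _, by simp only [map_zero]; exact tendsto_const_nhds⟩
  smul_mem' := fun c x hx => ⟨F.S.smul_mem c hx.1, by rw [map_smul, hx.2.1, smul_zero],
    by simpa only [map_smul] using hx.2.2.const_smul c⟩

/-- The vector is the weak limit of its own iterates, along which the term `αⁿ v x` of the
Lasota-Yorke bound disappears. Lower semicontinuity of `v` gives the claim. -/
theorem v_le_of_recurrent (hF : F.Compact) (hP : F.LY P α B L) {n : ℕ → ℕ}
    (hn : Tendsto n atTop atTop) {x : E} (hx : x ∈ F.recurrent P n) : F.v x ≤ L * ‖x‖ := by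
  refine le_of_forall_pos_le_add fun δ hδ => ?_
  have h1 : Tendsto (fun j => α ^ n j * F.v x) atTop (𝓝 0) := by
    simpa using ((tendsto_pow_atTop_nhds_zero_of_lt_one hP.α_nonneg hP.α_lt).comp hn).mul_const
      (F.v x)
  obtain ⟨j₀, hj₀⟩ := eventually_atTop.1 (h1.eventually (gt_mem_nhds hδ))
  have h2 := hx.2.2.comp (tendsto_add_atTop_nat j₀)
  refine (hF.lsc _ x (L * ‖x‖ + δ) ?_ (fun j => hP.pow_mem _ hx.1) (fun j => ?_) h2).2
  · have := mul_nonneg hP.L_nonneg (norm_nonneg x); linarith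
  · have := hP.v_pow_le (n (j + j₀)) hx.1
    have := hj₀ (j + j₀) (Nat.le_add_left _ _)
    linarith

theorem exists_subseq_tendsto [CompleteSpace E] (hF : F.Compact) {R : ℝ} {u : ℕ → E}
    (hu : ∀ n, u n ∈ F.S) (hR : ∀ n, F.bn (u n) ≤ R) :
    ∃ x, ∃ φ : ℕ → ℕ, StrictMono φ ∧ Tendsto (u ∘ φ) atTop (𝓝 x) := by
  have hK : IsCompact (closure {x | x ∈ F.S ∧ F.bn x ≤ R}) :=
    (hF.totallyBounded R).closure.isCompact_of_isClosed isClosed_closure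
  obtain ⟨x, -, φ, hφ, h⟩ := hK.tendsto_subseq (fun n => subset_closure ⟨hu n, hR n⟩)
  exact ⟨x, φ, hφ, h⟩

/-- On recurrent vectors the strong norm is dominated by the weak one, so weakly bounded sequences
have convergent subsequences. Riesz's theorem applies: an infinite-dimensional space would contain a
bounded separated sequence. -/
theorem finiteDimensional_recurrent [CompleteSpace E] (hF : F.Compact) (hP : F.LY P α B L)
    {n : ℕ → ℕ} (hn : Tendsto n atTop atTop) : FiniteDimensional ℝ (F.recurrent P n) := by
  by_contra hfin
  obtain ⟨R, f, hR, hf, hfs⟩ := exists_seq_norm_le_one_le_norm_sub (𝕜 := ℝ) hfin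
  have hb : ∀ k, F.bn (f k : E) ≤ (L + 1) * R := fun k => by
    have h1 := v_le_of_recurrent hF hP hn (f k).2
    have h2 : ‖(f k : E)‖ ≤ R := hf k
    have h3 := mul_le_mul_of_nonneg_left h2 hP.L_nonneg
    simp only [bn]; linarith
  obtain ⟨x, φ, hφ, h⟩ := exists_subseq_tendsto hF (u := fun k => (f k : E))
    (fun k => (f k).2.1) hb
  obtain ⟨N, hN⟩ := Metric.cauchySeq_iff'.1 h.cauchySeq 1 one_pos
  have h1 := hN (N + 1) (Nat.le_succ N)
  rw [dist_eq_norm] at h1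
  have h2 : φ (N + 1) ≠ φ N := fun h => absurd (hφ.injective h) (by omega)
  exact absurd h1 (not_lt.2 (hfs h2))

/-- No mean zero eigenvector for an eigenvalue of modulus one. -/
def NoPeripheral (F : VarFrame E) (P : E →L[ℝ] E) : Prop :=
  ∀ a b : ℝ, ‖(⟨a, b⟩ : ℂ)‖ = 1 → ∀ u ∈ F.S, ∀ w ∈ F.S, F.I u = 0 → F.I w = 0 →
    P u = a • u - b • w → P w = b • u + a • w → u = 0 ∧ w = 0

/-- The space of recurrent vectors is invariant and finite-dimensional. Were it nontrivial, it would
contain an eigenvector in the complex sense, necessarily for an eigenvalue of modulus one. -/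
theorem recurrent_eq_zero [CompleteSpace E] (hF : F.Compact) (hP : F.LY P α B L)
    (hno : F.NoPeripheral P) {n : ℕ → ℕ} (hn : Tendsto n atTop atTop) {x : E}
    (hx : x ∈ F.recurrent P n) : x = 0 := by
  by_contra hx0
  have := finiteDimensional_recurrent hF hP hn
  have : Nontrivial (F.recurrent P n) :=
    ⟨⟨⟨x, hx⟩, 0, fun h => hx0 (congrArg Subtype.val h)⟩⟩
  have hinv : ∀ y ∈ F.recurrent P n, P y ∈ F.recurrent P n := fun y hy =>
    ⟨hP.mem y hy.1, by rw [hP.I_eq, hy.2.1], by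
      refine ((P.continuous.tendsto _).comp hy.2.2).congr fun j => ?_
      rw [Function.comp_apply, ← pow_succ_apply', pow_succ_apply]⟩
  obtain ⟨a, b, u, w, hne, hu, hw⟩ :=
    exists_complex_eigenvector ((P : E →ₗ[ℝ] E).restrict hinv)
  have hu' : P (u : E) = a • (u : E) - b • (w : E) := congrArg Subtype.val hu
  have hw' : P (w : E) = b • (u : E) + a • (w : E) := congrArg Subtype.val hw
  have hne' : (u : E) ≠ 0 ∨ (w : E) ≠ 0 := by
    simpa only [ne_eq, Submodule.coe_eq_zero] using hne
  have h1 := norm_eigenvalue_eq_one hP hn hne' hu' hw' u.2.2.2 w.2.2.2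
  obtain ⟨h2, h3⟩ := hno a b h1 u u.2.1 w w.2.1 u.2.2.1 w.2.2.1 hu' hw'
  rcases hne' with h | h
  · exact h h2
  · exact h h3

/-- If the orbit of `g` accumulates at `x` along the times `φ`, then `x` returns to itself along the
differences `φ (2 j) - φ j`, which tend to infinity. So `x` is recurrent, hence zero, and
monotonicity of the norms along the orbit carries the convergence from the subsequence to the whole
sequence. -/
theorem tendsto_pow_of_noPeripheral [CompleteSpace E] (hF : F.Compact) (hP : F.LY P α B L)
    (hno : F.NoPeripheral P) {g : E} (hg : g ∈ F.S) (hI : F.I g = 0) :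
    Tendsto (fun k => (P ^ k) g) atTop (𝓝 0) := by
  obtain ⟨x, φ, hφ, h⟩ := exists_subseq_tendsto hF (u := fun k => (P ^ k) g)
    (fun k => hP.pow_mem k hg) (fun k => hP.bn_pow_le k hg)
  have hxS : x ∈ F.S := (hF.lsc _ x ((L + 1) * F.bn g)
    (mul_nonneg (by linarith [hP.L_nonneg]) (F.bn_nonneg g))
    (fun j => hP.pow_mem (φ j) hg) (fun j => (F.v_le_bn _).trans (hP.bn_pow_le (φ j) hg)) h).1
  have hxI : F.I x = 0 := by
    have h1 := (F.I.continuous.tendsto _).comp h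
    refine tendsto_nhds_unique h1 (tendsto_const_nhds.congr fun j => ?_)
    simp only [Function.comp_apply, hP.I_pow, hI]
  have hge : ∀ j, j ≤ φ (2 * j) - φ j := fun j => by
    have : ∀ i, φ j + i ≤ φ (j + i) := by
      intro i
      induction i with
      | zero => simp
      | succ i ih => have : φ (j + i) < φ (j + (i + 1)) := hφ (by omega); omega
    have := this j
    rw [← two_mul] at this
    omega
  have hn : Tendsto (fun j => φ (2 * j) - φ j) atTop atTop := tendsto_atTop_mono hge tendsto_id
  have h2 : Tendsto (fun j : ℕ => 2 * j) atTop atTop :=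
    tendsto_atTop_mono (fun j => show j ≤ 2 * j by omega) tendsto_id
  have hrec : Tendsto (fun j => (P ^ (φ (2 * j) - φ j)) x) atTop (𝓝 x) := by
    rw [tendsto_iff_norm_sub_tendsto_zero]
    have e1 := tendsto_iff_norm_sub_tendsto_zero.1 h
    have e2 := tendsto_iff_norm_sub_tendsto_zero.1 (h.comp h2)
    have e3 := e1.add e2
    rw [add_zero] at e3
    refine squeeze_zero (fun _ => norm_nonneg _) (fun j => ?_) e3
    have hle : φ j ≤ φ (2 * j) := hφ.monotone (by omega)
    have e4 : (P ^ (φ (2 * j) - φ j)) x - x =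
        (P ^ (φ (2 * j) - φ j)) (x - (P ^ φ j) g) + ((P ^ φ (2 * j)) g - x) := by
      rw [map_sub, ← pow_add_apply, Nat.sub_add_cancel hle]; abel
    rw [e4]
    refine (norm_add_le _ _).trans (add_le_add ?_ le_rfl)
    rw [Function.comp_apply, norm_sub_rev ((P ^ φ j) g)]
    exact hP.norm_pow_le _ _
  have hx0 := recurrent_eq_zero hF hP hno hn (x := x) ⟨hxS, hxI, hrec⟩
  rw [hx0] at h
  have hanti : Antitone fun k => ‖(P ^ k) g‖ := antitone_nat_of_succ_le fun k => by
    rw [pow_succ_apply']; exact hP.norm_le _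
  rw [tendsto_zero_iff_norm_tendsto_zero] at h ⊢
  exact (tendsto_iff_tendsto_subseq_of_antitone hanti hφ.tendsto_atTop).2 h

/-- Exponential decay on mean zero elements. -/
theorem exists_decays [CompleteSpace E] (hF : F.Compact) (hP : F.LY P α B L)
    (hno : F.NoPeripheral P) :
    ∃ n : ℕ, 0 < n ∧ F.Decays P (3 * (L + 1)) (Real.exp (-(1 / n))) := by
  have hL : 0 < L + 1 := by linarith [hP.L_nonneg]
  set δ := 1 / (8 * (L + 1))
  have hδ : 0 < δ := by positivity
  set A : Set E := {x | x ∈ F.S ∧ F.I x = 0 ∧ F.bn x ≤ 1}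
  have hsub : A ⊆ {x | x ∈ F.S ∧ F.bn x ≤ 1} := fun x hx => ⟨hx.1, hx.2.2⟩
  have hA : TotallyBounded A := (hF.totallyBounded 1).subset hsub
  -- On a finite net pointwise convergence is uniform. Since `P` is a contraction, the uniformity
  -- extends to all of `A`.
  obtain ⟨t, htA, htf, hcov⟩ := Metric.finite_approx_of_totallyBounded hA (δ / 2) (half_pos hδ)
  have h1 : ∀ᶠ k in atTop, ∀ y ∈ t, ‖(P ^ k) y‖ < δ / 2 := by
    rw [eventually_all_finite htf]
    intro y hy
    have := (tendsto_pow_of_noPeripheral hF hP hno (htA hy).1 (htA hy).2.1).norm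
    rw [norm_zero] at this
    exact this.eventually (gt_mem_nhds (half_pos hδ))
  have h2 : ∀ᶠ k in atTop, α ^ k < δ :=
    (tendsto_pow_atTop_nhds_zero_of_lt_one hP.α_nonneg hP.α_lt).eventually (gt_mem_nhds hδ)
  obtain ⟨n, ⟨hn1, hn2⟩, hn0⟩ := ((h1.and h2).and (eventually_gt_atTop 0)).exists
  have hunif : ∀ x ∈ A, ‖(P ^ n) x‖ ≤ δ := by
    intro x hx
    obtain ⟨y, hy, hxy⟩ := mem_iUnion₂.1 (hcov hx)
    have e : (P ^ n) x = (P ^ n) (x - y) + (P ^ n) y := by rw [map_sub]; abel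
    rw [e]
    rw [Metric.mem_ball, dist_eq_norm] at hxy
    have := hP.norm_pow_le n (x - y)
    have := hn1 y hy
    exact (norm_add_le _ _).trans (by linarith)
  refine ⟨2 * n, by omega, hP.decays (by omega) fun x hx hI => ?_⟩
  refine hP.bn_pow_two_mul_le hn2.le hx ?_
  rcases (F.bn_nonneg x).eq_or_lt with h0 | h0
  · have : ‖x‖ ≤ 0 := h0 ▸ F.norm_le_bn x
    rw [norm_le_zero_iff.1 this, map_zero, norm_zero]
    exact mul_nonneg hδ.le (F.bn_nonneg _)
  · have h3 := hunif ((F.bn x)⁻¹ • x) ⟨F.S.smul_mem _ hx, by rw [map_smul, hI, smul_zero], by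
      refine (F.bn_smul _ hx).trans ?_
      rw [abs_of_pos (inv_pos.2 h0), inv_mul_cancel₀ h0.ne']⟩
    rw [map_smul, norm_smul, Real.norm_of_nonneg (inv_nonneg.2 h0.le), inv_mul_le_iff₀ h0] at h3
    linarith

end VarFrame

end UlamDiffusion
end

noncomputable section

namespace UlamDiffusion

open scoped ENNReal

/-! ### The operators on `L¹` -/

/-- The space `L¹(m)`. -/
abbrev L1 := Lp ℝ 1 m

theorem L1.integrable (x : L1) : Integrable x m := L1.integrable_coeFn x

theorem L1.norm_eq (x : L1) : ‖x‖ = ∫ t, |x t| ∂m := L1.norm_eq_integral_norm x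

theorem norm_toL1_eq {f : ℝ → ℝ} (hf : Integrable f m) : ‖hf.toL1 f‖ = ∫ t, |f t| ∂m := by
  rw [L1.norm_eq]
  exact integral_congr_ae (hf.coeFn_toL1.mono fun x hx => congrArg abs hx)

/-- An operator on functions, with the obvious properties, induces an operator on `L¹`. -/
def liftL1 (A : (ℝ → ℝ) → ℝ → ℝ) (C : ℝ) (hint : ∀ f, Integrable f m → Integrable (A f) m)
    (hcongr : ∀ f g, f =ᵐ[m] g → A f =ᵐ[m] A g)
    (hadd : ∀ f g, Integrable f m → Integrable g m → A (f + g) =ᵐ[m] A f + A g)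
    (hmul : ∀ (c : ℝ) f, Integrable f m → A (fun x => c * f x) =ᵐ[m] fun x => c * A f x)
    (hnorm : ∀ f, Integrable f m → ∫ x, |A f x| ∂m ≤ C * ∫ x, |f x| ∂m) : L1 →L[ℝ] L1 :=
  LinearMap.mkContinuous
    { toFun := fun x => (hint x (L1.integrable x)).toL1 (A x)
      map_add' := fun x y => by
        rw [← Integrable.toL1_add, Integrable.toL1_eq_toL1_iff]
        exact (hcongr _ _ (Lp.coeFn_add x y)).trans (hadd _ _ (L1.integrable x) (L1.integrable y))
      map_smul' := fun c x => by
        rw [RingHom.id_apply, ← Integrable.toL1_smul, Integrable.toL1_eq_toL1_iff]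
        exact (hcongr _ _ (Lp.coeFn_smul c x)).trans (hmul c _ (L1.integrable x)) }
    C fun x => by
      change ‖(hint x (L1.integrable x)).toL1 (A x)‖ ≤ _
      rw [norm_toL1_eq, L1.norm_eq]
      exact hnorm x (L1.integrable x)

/-- `Q` is the operator induced by `A` on `L¹`. -/
def Represents (A : (ℝ → ℝ) → ℝ → ℝ) (Q : L1 →L[ℝ] L1) : Prop :=
  ∀ (f : ℝ → ℝ) (x : L1), f =ᵐ[m] x → A f =ᵐ[m] Q x

theorem liftL1_represents {A : (ℝ → ℝ) → ℝ → ℝ} {C : ℝ} {h1 h2 h3 h4 h5} :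
    Represents A (liftL1 A C h1 h2 h3 h4 h5) := fun f x hf => by
  refine (h2 f x hf).trans ?_
  exact (Integrable.coeFn_toL1 (h1 x (L1.integrable x))).symm

theorem norm_liftL1_le {A : (ℝ → ℝ) → ℝ → ℝ} {C : ℝ} {h1 h2 h3 h4}
    (h5 : ∀ f, Integrable f m → ∫ x, |A f x| ∂m ≤ C * ∫ x, |f x| ∂m) (x : L1) :
    ‖liftL1 A C h1 h2 h3 h4 h5 x‖ ≤ C * ‖x‖ := by
  change ‖(h1 x (L1.integrable x)).toL1 (A x)‖ ≤ _
  rw [norm_toL1_eq, L1.norm_eq]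
  exact h5 x (L1.integrable x)

theorem Represents.iterate {A : (ℝ → ℝ) → ℝ → ℝ} {Q : L1 →L[ℝ] L1} (h : Represents A Q) (k : ℕ)
    {f : ℝ → ℝ} {x : L1} (hf : f =ᵐ[m] x) : A^[k] f =ᵐ[m] (Q ^ k) x := by
  induction k with
  | zero => simpa
  | succ k ih =>
    rw [Function.iterate_succ_apply', VarFrame.pow_succ_apply']
    exact h _ _ ih

theorem Represents.comp {A A' : (ℝ → ℝ) → ℝ → ℝ} {Q Q' : L1 →L[ℝ] L1} (h : Represents A Q)
    (h' : Represents A' Q') : Represents (fun f => A (A' f)) (Q.comp Q') := fun f x hf =>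
  h _ _ (h' f x hf)

theorem Represents.eq_iff {A : (ℝ → ℝ) → ℝ → ℝ} {Q : L1 →L[ℝ] L1} (h : Represents A Q)
    {f g : ℝ → ℝ} {x y : L1} (hf : f =ᵐ[m] x) (hg : g =ᵐ[m] y) : A f =ᵐ[m] g ↔ Q x = y :=
  ⟨fun h' => Lp.ext ((h f x hf).symm.trans (h'.trans hg)), fun h' =>
    (h f x hf).trans (by rw [h']; exact hg.symm)⟩

theorem integral_coeFn_add (x y : L1) :
    ∫ t, (x + y : L1) t ∂m = ∫ t, x t ∂m + ∫ t, y t ∂m := by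
  rw [integral_congr_ae (Lp.coeFn_add x y)]
  exact integral_add (L1.integrable x) (L1.integrable y)

/-- The integral as a functional on `L¹`. -/
def integralL : L1 →L[ℝ] ℝ :=
  LinearMap.mkContinuous
    { toFun := fun x => ∫ t, x t ∂m
      map_add' := integral_coeFn_add
      map_smul' := fun c x => by
        rw [integral_congr_ae (Lp.coeFn_smul c x), RingHom.id_apply, smul_eq_mul]
        exact integral_const_mul c x }
    1 fun x => by
      rw [one_mul, L1.norm_eq]
      exact norm_integral_le_integral_norm x

theorem abs_integralL_le (x : L1) : |integralL x| ≤ ‖x‖ := by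
  rw [L1.norm_eq]
  exact norm_integral_le_integral_norm x

/-- The frame given by the essential variation on `L¹`. -/
def frame : VarFrame L1 where
  S :=
    { carrier := {x | MemBV x}
      add_mem' := fun {x y} hx hy => (MemBV.add hx hy).congr (Lp.coeFn_add x y).symm
      zero_mem' := (memBV_const 0).congr (Lp.coeFn_zero ℝ 1 m).symm
      smul_mem' := fun c x hx => (MemBV.const_mul hx c).congr (Lp.coeFn_smul c x).symm }
  -- Outside `S` this may be the default value `0` of `toReal`; the rules for `v` are therefore
  -- required on `S` only.
  v := fun x => (essVar x).toReal
  I := integralL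
  v_nonneg := fun _ => ENNReal.toReal_nonneg
  v_add := fun x hx y hy => by
    rw [← ENNReal.toReal_add hx.2 hy.2, essVar_congr (Lp.coeFn_add x y)]
    exact ENNReal.toReal_mono (ENNReal.add_ne_top.2 ⟨hx.2, hy.2⟩) (essVar_add_le _ _)
  v_smul := fun c x hx => by
    have h1 : |c| = (‖c‖ₑ).toReal := by simp
    rw [h1, ← ENNReal.toReal_mul, essVar_congr (Lp.coeFn_smul c x)]
    exact ENNReal.toReal_mono (ENNReal.mul_ne_top enorm_ne_top hx.2) (essVar_const_mul_le c x)
  I_le := abs_integralL_le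

theorem frame_v (x : L1) : frame.v x = (essVar x).toReal := rfl

theorem frame_I (x : L1) : frame.I x = ∫ t, x t ∂m := rfl

theorem mem_frame_of_ae {f : ℝ → ℝ} {x : L1} (h : f =ᵐ[m] x) (hf : MemBV f) : x ∈ frame.S :=
  hf.congr h

theorem bvNorm_eq {x : L1} (hx : x ∈ frame.S) : bvNorm x = ENNReal.ofReal (frame.bn x) := by
  rw [bvNorm, VarFrame.bn, ENNReal.ofReal_add (frame.v_nonneg x) (norm_nonneg x), frame_v,
    ENNReal.ofReal_toReal hx.2, L1.norm_eq, toReal_eLpNorm_one (L1.integrable x)]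

theorem bvNorm_congr {f g : ℝ → ℝ} (h : f =ᵐ[m] g) : bvNorm f = bvNorm g := by
  rw [bvNorm, bvNorm, essVar_congr h, eLpNorm_congr_ae h]

/-- The conditional expectation on `L¹`. -/
def projL (η : IntervalPartition) : L1 →L[ℝ] L1 :=
  liftL1 (proj η) 1 (fun _ _ => integrable_condExp) (fun _ _ h => condExp_congr_ae h)
    (fun _ _ hf hg => condExp_add hf hg _) (fun c f _ => condExp_smul c f _) fun f _ => by
      rw [one_mul]; exact integral_abs_condExp_le f

theorem projL_represents (η : IntervalPartition) : Represents (proj η) (projL η) :=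
  liftL1_represents

theorem projL_ae_eq (η : IntervalPartition) (x : L1) : projL η x =ᵐ[m] η.step x :=
  ((projL_represents η x x (EventuallyEq.refl _ _)).symm).trans (proj_ae_eq η (L1.integrable x))

theorem projL_mem (η : IntervalPartition) (x : L1) : projL η x ∈ frame.S :=
  (η.memBV_step x).congr (projL_ae_eq η x).symm

theorem v_projL_le (η : IntervalPartition) {x : L1} (hx : x ∈ frame.S) :
    frame.v (projL η x) ≤ frame.v x := by
  rw [frame_v, frame_v, essVar_congr (projL_ae_eq η x)]
  exact ENNReal.toReal_mono hx.2 (η.essVar_step_le x)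

theorem norm_projL_le (η : IntervalPartition) (x : L1) : ‖projL η x‖ ≤ ‖x‖ := by
  exact (norm_liftL1_le _ x).trans_eq (one_mul _)

theorem I_projL (η : IntervalPartition) (x : L1) : frame.I (projL η x) = frame.I x := by
  rw [frame_I, frame_I, integral_congr_ae (projL_represents η x x (EventuallyEq.refl _ _)).symm]
  refine integral_condExp ?_
  rw [BorelSpace.measurable_eq (α := ℝ)]
  exact η.sigma_le

theorem norm_sub_projL_le (η : IntervalPartition) {ε : ℝ} (hε : 0 ≤ ε) (hη : η.MeshLE ε) {x : L1}
    (hx : x ∈ frame.S) : ‖x - projL η x‖ ≤ ε * frame.v x := by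
  have h := η.integral_abs_sub_step_le (L1.integrable x) (frame.v_nonneg x) hε
    (by rw [frame_v, ENNReal.ofReal_toReal hx.2]) hη
  rw [L1.norm_eq]
  refine (le_of_eq (integral_congr_ae ?_)).trans h
  filter_upwards [Lp.coeFn_sub x (projL η x), projL_ae_eq η x] with t h1 h2
  rw [h1, Pi.sub_apply, h2]

/-- The step functions with given values on the cells. -/
def stepL (η : IntervalPartition) : (Fin η.d → ℝ) →ₗ[ℝ] L1 where
  toFun c := ∑ k, c k • (memBV_indicator_Ico (η.node k.castSucc) (η.node k.succ)).1.toL1 _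
  map_add' c c' := by simp only [Pi.add_apply, add_smul, Finset.sum_add_distrib]
  map_smul' a c := by
    simp only [Pi.smul_apply, smul_eq_mul, mul_smul, Finset.smul_sum, RingHom.id_apply]

theorem projL_mem_range (η : IntervalPartition) (x : L1) :
    projL η x ∈ LinearMap.range (stepL η) := by
  refine ⟨fun k => η.avg x k, Lp.ext ?_⟩
  refine EventuallyEq.trans ?_ (projL_ae_eq η x).symm
  have hs : ∀ s : Finset (Fin η.d), (∑ k ∈ s, η.avg x k •
      (memBV_indicator_Ico (η.node k.castSucc) (η.node k.succ)).1.toL1 _ : L1) =ᵐ[m]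
      fun t => ∑ k ∈ s, (η.cell k).indicator (fun _ => η.avg x k) t := by
    intro s
    induction s using Finset.induction_on with
    | empty => simp only [Finset.sum_empty]; exact Lp.coeFn_zero ℝ 1 m
    | insert a s ha ih =>
      simp only [Finset.sum_insert ha]
      refine (Lp.coeFn_add _ _).trans (EventuallyEq.add ?_ ih)
      refine (Lp.coeFn_smul _ _).trans ?_
      filter_upwards [Integrable.coeFn_toL1 (memBV_indicator_Ico (η.node a.castSucc)
        (η.node a.succ)).1] with t ht
      rw [Pi.smul_apply, ht]
      simp only [indicator, IntervalPartition.cell, smul_eq_mul, mul_ite, mul_one, mul_zero]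
      congr
  exact hs _

theorem totallyBounded_of_finiteDimensional {E : Type*} [NormedAddCommGroup E] [NormedSpace ℝ E]
    (W : Submodule ℝ E) [FiniteDimensional ℝ W] (R : ℝ) :
    TotallyBounded {x : E | x ∈ W ∧ ‖x‖ ≤ R} := by
  have hprop : ProperSpace W := FiniteDimensional.proper ℝ W
  have h := ((isCompact_closedBall (0 : W) R).image continuous_subtype_val).totallyBounded
  have hsub : {x : E | x ∈ W ∧ ‖x‖ ≤ R} ⊆ Subtype.val '' Metric.closedBall (0 : W) R :=
    fun x hx => ⟨⟨x, hx.1⟩, mem_closedBall_zero_iff.2 hx.2, rfl⟩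
  exact h.subset hsub

/-- Projection to a fine partition moves a `BV` ball uniformly little in `L¹` and sends it into a
bounded set of a finite-dimensional space. For semicontinuity, pass to a subsequence that converges
almost everywhere. -/
theorem frame_compact : frame.Compact where
  totallyBounded R := by
    rw [Metric.totallyBounded_iff]
    intro ε hε
    obtain ⟨η, hη⟩ := IntervalPartition.exists_meshLE
      (show 0 < ε / (2 * (|R| + 1)) by positivity)
    have hW := totallyBounded_of_finiteDimensional (LinearMap.range (stepL η)) R
    obtain ⟨t, ht, hcov⟩ := Metric.totallyBounded_iff.1 hW (ε / 2) (half_pos hε)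
    refine ⟨t, ht, fun x hx => ?_⟩
    have hmem : projL η x ∈ {x : L1 | x ∈ LinearMap.range (stepL η) ∧ ‖x‖ ≤ R} :=
      ⟨projL_mem_range η x, (norm_projL_le η x).trans ((frame.norm_le_bn x).trans hx.2)⟩
    obtain ⟨y, hy, hxy⟩ := mem_iUnion₂.1 (hcov hmem)
    refine mem_iUnion₂.2 ⟨y, hy, ?_⟩
    rw [Metric.mem_ball] at hxy ⊢
    have h1 := norm_sub_projL_le η (by positivity) hη hx.1
    have h2 : frame.v x ≤ |R| + 1 :=
      (frame.v_le_bn x).trans (hx.2.trans (by linarith [le_abs_self R]))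
    have h3 : ε / (2 * (|R| + 1)) * frame.v x ≤ ε / (2 * (|R| + 1)) * (|R| + 1) := by gcongr
    have h4 : ε / (2 * (|R| + 1)) * (|R| + 1) = ε / 2 := by
      have : |R| + 1 ≠ 0 := by positivity
      field_simp
    have h5 := dist_triangle x (projL η x) y
    rw [dist_eq_norm x (projL η x)] at h5
    linarith
  lsc u x R hR hu hv h := by
    have hm : TendstoInMeasure m (fun n => (u n : ℝ → ℝ)) atTop x :=
      tendstoInMeasure_of_tendsto_Lp h
    obtain ⟨φ, -, hae⟩ := hm.exists_seq_tendsto_ae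
    have h1 : essVar x ≤ ENNReal.ofReal R := by
      refine essVar_le_of_tendsto (fun n => ?_) hae
      exact (ENNReal.le_ofReal_iff_toReal_le (hu _).2 hR).2 (hv _)
    exact ⟨⟨L1.integrable x, ne_top_of_le_ne_top ENNReal.ofReal_ne_top h1⟩,
      ENNReal.toReal_le_of_le_ofReal hR h1⟩

/-! ### The transfer operator and Ulam's operator as perturbations of each other -/

section transferL

variable {T : ℝ → ℝ}

/-- The transfer operator on `L¹`. -/
def transferL (hT : IsPiecewiseExpanding T) : L1 →L[ℝ] L1 :=
  liftL1 (transfer T) 1 (fun f _ => integrable_transfer T f)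
    (fun _ _ h => by rw [transfer_congr h])
    (fun _ _ hf hg => transfer_add hT hf hg) (fun c _ hf => transfer_const_mul hT hf c)
    fun f hf => by rw [one_mul]; exact integral_abs_transfer_le hT hf

theorem transferL_represents (hT : IsPiecewiseExpanding T) :
    Represents (transfer T) (transferL hT) :=
  liftL1_represents

theorem transferL_ae_eq (hT : IsPiecewiseExpanding T) (x : L1) :
    transferL hT x =ᵐ[m] transfer T x :=
  (transferL_represents hT x x (EventuallyEq.refl _ _)).symm

theorem transferL_LY (hT : IsPiecewiseExpanding T) {α B L : ℝ} (hα : 0 < α) (hα1 : α < 1)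
    (hB : 0 ≤ B) (hA1 : A1 T α B) (hL : 0 ≤ L) (hBL : B ≤ (1 - α) * L) :
    frame.LY (transferL hT) α B L := by
  have hA : ∀ x ∈ frame.S, essVar (transferL hT x) ≤
      ENNReal.ofReal (α * frame.v x + B * ‖x‖) := by
    intro x hx
    rw [essVar_congr (transferL_ae_eq hT x)]
    refine (hA1 x hx).trans (le_of_eq ?_)
    rw [ENNReal.ofReal_add (mul_nonneg hα.le (frame.v_nonneg x)) (mul_nonneg hB (norm_nonneg x)),
      ENNReal.ofReal_mul hα.le, ENNReal.ofReal_mul hB, frame_v, ENNReal.ofReal_toReal hx.2,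
      L1.norm_eq, toReal_eLpNorm_one (L1.integrable x)]
  have hnn : ∀ x, 0 ≤ α * frame.v x + B * ‖x‖ := fun x =>
    add_nonneg (mul_nonneg hα.le (frame.v_nonneg x)) (mul_nonneg hB (norm_nonneg x))
  refine ⟨fun x => ?_, fun x hx => ?_, fun x hx => ?_, fun x => ?_, hα.le, hα1, hB, hL, hBL⟩
  · exact (norm_liftL1_le _ x).trans_eq (one_mul _)
  · exact ⟨L1.integrable _, ne_top_of_le_ne_top ENNReal.ofReal_ne_top (hA x hx)⟩
  · exact ENNReal.toReal_le_of_le_ofReal (hnn x) (hA x hx)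
  · rw [frame_I, frame_I, integral_congr_ae (transferL_ae_eq hT x)]
    exact integral_transfer hT (L1.integrable x)

/-- Ulam's approximation on `L¹`. -/
def ulamL (hT : IsPiecewiseExpanding T) (η : IntervalPartition) : L1 →L[ℝ] L1 :=
  (projL η).comp ((transferL hT).comp (projL η))

theorem ulamL_represents (hT : IsPiecewiseExpanding T) (η : IntervalPartition) :
    Represents (ulam T η) (ulamL hT η) :=
  (projL_represents η).comp ((transferL_represents hT).comp (projL_represents η))

theorem ulamL_mem (hT : IsPiecewiseExpanding T) (η : IntervalPartition) (x : L1) :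
    ulamL hT η x ∈ frame.S := projL_mem η _

/-- Conditional expectation increases neither the norm nor the variation and keeps the integral. All
constants are thus the same for every partition. -/
theorem ulamL_LY (hT : IsPiecewiseExpanding T) (η : IntervalPartition) {α B L : ℝ}
    (h : frame.LY (transferL hT) α B L) : frame.LY (ulamL hT η) α B L where
  norm_le x := (norm_projL_le η _).trans ((h.norm_le _).trans (norm_projL_le η x))
  mem x _ := ulamL_mem hT η x
  v_le x hx := by
    refine (v_projL_le η (h.mem _ (projL_mem η x))).trans ((h.v_le _ (projL_mem η x)).trans ?_)
    exact add_le_add (mul_le_mul_of_nonneg_left (v_projL_le η hx) h.α_nonneg)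
      (mul_le_mul_of_nonneg_left (norm_projL_le η x) h.B_nonneg)
  I_eq x := by
    change frame.I (projL η (transferL hT (projL η x))) = _
    rw [I_projL, h.I_eq, I_projL]
  α_nonneg := h.α_nonneg
  α_lt := h.α_lt
  B_nonneg := h.B_nonneg
  L_nonneg := h.L_nonneg
  B_le := h.B_le

/-- In `P - ΠPΠ = (1 - Π)P + ΠP(1 - Π)` each factor `1 - Π` costs `ε` times a variation: that of `P
x` in the first term and that of `x` in the second. -/
theorem norm_transferL_sub_ulamL_le (hT : IsPiecewiseExpanding T) (η : IntervalPartition)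
    {α B L ε : ℝ} (h : frame.LY (transferL hT) α B L) (hε : 0 ≤ ε) (hη : η.MeshLE ε) {x : L1}
    (hx : x ∈ frame.S) :
    ‖transferL hT x - ulamL hT η x‖ ≤ (2 + B) * ε * frame.bn x := by
  have e : transferL hT x - ulamL hT η x =
      (transferL hT x - projL η (transferL hT x)) +
        projL η (transferL hT (x - projL η x)) := by
    rw [map_sub, map_sub]
    change _ = _ + (_ - ulamL hT η x)
    abel
  rw [e]
  have h1 := norm_sub_projL_le η hε hη (h.mem x hx)
  have h2 := mul_le_mul_of_nonneg_left (h.v_le x hx) hε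
  have h3 : ‖projL η (transferL hT (x - projL η x))‖ ≤ ε * frame.v x :=
    (norm_projL_le η _).trans ((h.norm_le _).trans (norm_sub_projL_le η hε hη hx))
  refine (norm_add_le _ _).trans ?_
  have h4 : α * frame.v x ≤ frame.v x :=
    mul_le_of_le_one_left (frame.v_nonneg x) h.α_lt.le
  have h5 := frame.v_nonneg x
  have h6 := mul_nonneg h.B_nonneg h5
  have h7 : ε * (α * frame.v x + B * ‖x‖) + ε * frame.v x ≤ ε * ((2 + B) * frame.bn x) := by
    rw [← mul_add]
    refine mul_le_mul_of_nonneg_left ?_ hε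
    simp only [VarFrame.bn]
    linarith [norm_nonneg x]
  linarith

end transferL

/-- Multiplication by an essentially bounded function on `L¹`. -/
def mulL {ψ : ℝ → ℝ} {M : ℝ} (hψ : AEStronglyMeasurable ψ m) (hM : ∀ᵐ x ∂m, |ψ x| ≤ M) :
    L1 →L[ℝ] L1 :=
  liftL1 (fun f x => ψ x * f x) M (fun f hf => hf.bdd_mul hψ hM)
    (fun f g h => h.mono fun x hx => by simp only [hx])
    (fun f g _ _ => ae_of_all _ fun x => by simp only [Pi.add_apply]; ring)
    (fun c f _ => ae_of_all _ fun x => by simp only; ring)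
    fun f hf => by
      rw [← integral_const_mul]
      refine integral_mono_ae (hf.bdd_mul hψ hM).abs (hf.abs.const_mul M) (hM.mono fun x hx => ?_)
      simp only [abs_mul]
      gcongr

theorem mulL_represents {ψ : ℝ → ℝ} {M : ℝ} (hψ : AEStronglyMeasurable ψ m)
    (hM : ∀ᵐ x ∂m, |ψ x| ≤ M) : Represents (fun f x => ψ x * f x) (mulL hψ hM) :=
  liftL1_represents

theorem mulL_mult {ψ : ℝ → ℝ} {M W : ℝ} (hψ : MemBV ψ) (hM0 : 0 ≤ M) (hW0 : 0 ≤ W)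
    (hM : ∀ᵐ x ∂m, |ψ x| ≤ M) (hW : essVar ψ ≤ ENNReal.ofReal W) :
    frame.Mult (mulL hψ.1.1 hM) M (2 * (W + M) + M) := by
  have hnorm : ∀ x, ‖mulL hψ.1.1 hM x‖ ≤ M * ‖x‖ := fun x =>
    norm_liftL1_le _ x
  have hbv : bvNorm ψ ≤ ENNReal.ofReal (W + M) := by
    rw [bvNorm, ENNReal.ofReal_add hW0 hM0, toReal_eLpNorm_one hψ.1]
    refine add_le_add hW (ENNReal.ofReal_le_ofReal ?_)
    have := integral_mono_ae hψ.1.abs (integrable_const M) hM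
    simpa using this
  have hv : ∀ x ∈ frame.S, essVar (mulL hψ.1.1 hM x) ≤
      ENNReal.ofReal (2 * (W + M) * frame.bn x) := by
    intro x hx
    rw [essVar_congr (mulL_represents hψ.1.1 hM x x (EventuallyEq.refl _ _)).symm]
    refine (essVar_mul_le hψ hx).trans ?_
    rw [bvNorm_eq hx, ENNReal.ofReal_mul (by positivity), ENNReal.ofReal_mul two_pos.le]
    gcongr
    simp
  refine ⟨hnorm, fun x hx => ⟨L1.integrable _,
    ne_top_of_le_ne_top ENNReal.ofReal_ne_top (hv x hx)⟩, fun x hx => ?_, hM0, by positivity⟩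
  have h1 : frame.v (mulL hψ.1.1 hM x) ≤ 2 * (W + M) * frame.bn x :=
    ENNReal.toReal_le_of_le_ofReal (mul_nonneg (by positivity) (frame.bn_nonneg x)) (hv x hx)
  have h2 := mul_le_mul_of_nonneg_left (frame.norm_le_bn x) hM0
  have h3 := hnorm x
  rw [VarFrame.bn]
  linarith

end UlamDiffusion
end

noncomputable section

namespace UlamDiffusion

open scoped ENNReal

/-! ### Spectral properties of the transfer operator -/

variable {T : ℝ → ℝ}

theorem MemBV.re {f : ℝ → ℂ} (hf : MemBV f) : MemBV fun x => (f x).re :=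
  ⟨hf.1.re, ne_top_of_le_ne_top (by simpa using hf.2) (essVar_comp_le (φ := Complex.re) (C := 1)
    (LipschitzWith.of_dist_le_mul fun x y => by
      rw [NNReal.coe_one, one_mul, Real.dist_eq, dist_eq_norm, ← Complex.sub_re]
      exact Complex.abs_re_le_norm _) f)⟩

theorem MemBV.im {f : ℝ → ℂ} (hf : MemBV f) : MemBV fun x => (f x).im :=
  ⟨hf.1.im, ne_top_of_le_ne_top (by simpa using hf.2) (essVar_comp_le (φ := Complex.im) (C := 1)
    (LipschitzWith.of_dist_le_mul fun x y => by
      rw [NNReal.coe_one, one_mul, Real.dist_eq, dist_eq_norm, ← Complex.sub_im]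
      exact Complex.abs_im_le_norm _) f)⟩

theorem MemBV.complex {u w : ℝ → ℝ} (hu : MemBV u) (hw : MemBV w) :
    MemBV fun x => (u x : ℂ) + (w x : ℂ) * Complex.I := by
  refine ⟨hu.1.ofReal.add (hw.1.ofReal.mul_const _), ?_⟩
  obtain ⟨u', hu1, -, hu2⟩ := exists_rep hu.2
  obtain ⟨w', hw1, -, hw2⟩ := exists_rep hw.2
  have hl1 : LipschitzWith 1 (fun y : ℝ => (y : ℂ)) := Complex.isometry_ofReal.lipschitz
  have hl2 : LipschitzWith 1 (fun y : ℝ => (y : ℂ) * Complex.I) :=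
    LipschitzWith.of_dist_le_mul fun x y => by
      rw [dist_eq_norm, ← sub_mul, norm_mul, Complex.norm_I, mul_one, ← Complex.ofReal_sub,
        Complex.norm_real, NNReal.coe_one, one_mul, dist_eq_norm]
  have e1 := (hl1.lipschitzOnWith (s := univ)).comp_eVariationOn_le (mapsTo_univ u' univ)
  have e2 := (hl2.lipschitzOnWith (s := univ)).comp_eVariationOn_le (mapsTo_univ w' univ)
  have h : ((fun y : ℝ => (y : ℂ)) ∘ u' + (fun y : ℝ => (y : ℂ) * Complex.I) ∘ w') =ᵐ[m]
      fun x => (u x : ℂ) + (w x : ℂ) * Complex.I := by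
    filter_upwards [hu1, hw1] with x h1 h2
    simp [h1, h2]
  refine ne_top_of_le_ne_top ?_ ((essVar_le h).trans ((eVariationOn.mono _ (subset_univ _)).trans
    ((eVariationOn_add_le _ _).trans (add_le_add e1 e2))))
  rw [hu2, hw2]
  simpa using ⟨hu.2, hw.2⟩

theorem isEigenfunction_pair {u w : ℝ → ℝ} {a b : ℝ} (hu : MemBV u) (hw : MemBV w)
    (hTu : transfer T u =ᵐ[m] fun x => a * u x - b * w x)
    (hTw : transfer T w =ᵐ[m] fun x => b * u x + a * w x) (hne : ¬ (u =ᵐ[m] 0 ∧ w =ᵐ[m] 0)) :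
    IsEigenfunction T ⟨a, b⟩ fun x => (u x : ℂ) + (w x : ℂ) * Complex.I := by
  refine ⟨hu.complex hw, fun h => hne ⟨?_, ?_⟩, ?_⟩
  · filter_upwards [h] with x hx
    simpa using congrArg Complex.re hx
  · filter_upwards [h] with x hx
    simpa using congrArg Complex.im hx
  · have e1 : (fun y => ((u y : ℂ) + (w y : ℂ) * Complex.I).re) = u := by funext y; simp
    have e2 : (fun y => ((u y : ℂ) + (w y : ℂ) * Complex.I).im) = w := by funext y; simp
    filter_upwards [hTu, hTw] with x h1 h2
    simp only [transferC, e1, e2, h1, h2]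
    apply Complex.ext
    · simp
    · simp; ring

/-- A fixed density in `BV`, obtained as the absolute value of a real eigenfunction. -/
theorem exists_fixedDensity (hT : IsPiecewiseExpanding T) (hA2 : A2 T) :
    ∃ h, MemBV h ∧ IsFixedDensity (transfer T) h := by
  obtain ⟨⟨f, ⟨hfBV, hf0, hfT⟩, -⟩, -⟩ := hA2
  have hre : transfer T (fun x => (f x).re) =ᵐ[m] fun x => (f x).re := by
    filter_upwards [hfT] with x hx
    simpa [transferC] using congrArg Complex.re hx
  have him : transfer T (fun x => (f x).im) =ᵐ[m] fun x => (f x).im := by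
    filter_upwards [hfT] with x hx
    simpa [transferC] using congrArg Complex.im hx
  obtain ⟨u, hu, huT, hu0⟩ : ∃ u, MemBV u ∧ transfer T u =ᵐ[m] u ∧ ¬ u =ᵐ[m] 0 := by
    by_contra hcon
    push Not at hcon
    refine hf0 ?_
    filter_upwards [hcon _ hfBV.re hre, hcon _ hfBV.im him] with x h1 h2
    exact Complex.ext h1 h2
  have habs : MemBV fun x => |u x| :=
    ⟨hu.1.abs, ne_top_of_le_ne_top hu.2 (essVar_abs_le u)⟩
  -- From `u = P u` comes `|u| ≤ P |u|`. Both sides have the same integral, so they agree.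
  have hle : ∀ᵐ x ∂m, |u x| ≤ transfer T (fun y => |u y|) x := by
    filter_upwards [abs_transfer_le hT hu.1, huT] with x h1 h2
    rwa [h2] at h1
  have hfix : transfer T (fun y => |u y|) =ᵐ[m] fun x => |u x| := by
    have h0 : ∫ x, (transfer T (fun y => |u y|) x - |u x|) ∂m = 0 := by
      rw [integral_sub (integrable_transfer T _) hu.1.abs, integral_transfer hT hu.1.abs, sub_self]
    rw [integral_eq_zero_iff_of_nonneg_ae (hle.mono fun x hx => sub_nonneg.2 hx)
      ((integrable_transfer T _).sub hu.1.abs)] at h0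
    filter_upwards [h0] with x hx
    exact sub_eq_zero.1 hx
  have hpos : 0 < ∫ x, |u x| ∂m := by
    refine (integral_nonneg fun _ => abs_nonneg _).lt_of_ne fun h0 => hu0 ?_
    have := (integral_eq_zero_iff_of_nonneg (fun _ => abs_nonneg _) hu.1.abs).1 h0.symm
    filter_upwards [this] with x hx
    exact abs_eq_zero.1 hx
  have hBV := habs.const_mul (∫ x, |u x| ∂m)⁻¹
  refine ⟨_, hBV, hBV.1, ae_of_all _ fun x => mul_nonneg (inv_nonneg.2 hpos.le) (abs_nonneg _),
    ?_, ?_⟩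
  · rw [integral_const_mul, inv_mul_cancel₀ hpos.ne']
  · filter_upwards [transfer_const_mul hT hu.1.abs (∫ x, |u x| ∂m)⁻¹, hfix] with x h1 h2
    rw [h1, h2]

/-- An eigenvalue of modulus one must be `1`, and by simplicity its eigenfunction is a complex
multiple of the fixed density. Mean zero makes that multiple vanish. -/
theorem noPeripheral_transferL (hT : IsPiecewiseExpanding T) (hA2 : A2 T) :
    frame.NoPeripheral (transferL hT) := by
  intro a b hab u hu w hw hIu hIw hPu hPw
  obtain ⟨h, hBV, hfix⟩ := exists_fixedDensity hT hA2
  obtain ⟨⟨f, hf, hgen⟩, huniq⟩ := hA2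
  by_contra hne
  have hTu : transfer T u =ᵐ[m] fun x => a * u x - b * w x := by
    refine (transferL_ae_eq hT u).symm.trans ?_
    rw [hPu]
    filter_upwards [Lp.coeFn_sub (a • u) (b • w), Lp.coeFn_smul a u, Lp.coeFn_smul b w]
      with x h1 h2 h3
    rw [h1, Pi.sub_apply, h2, h3]; rfl
  have hTw : transfer T w =ᵐ[m] fun x => b * u x + a * w x := by
    refine (transferL_ae_eq hT w).symm.trans ?_
    rw [hPw]
    filter_upwards [Lp.coeFn_add (b • u) (a • w), Lp.coeFn_smul b u, Lp.coeFn_smul a w]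
      with x h1 h2 h3
    rw [h1, Pi.add_apply, h2, h3]; rfl
  have hne' : ¬ (u =ᵐ[m] 0 ∧ w =ᵐ[m] 0) := fun h0 =>
    hne ⟨Lp.ext (h0.1.trans (Lp.coeFn_zero ℝ 1 m).symm),
      Lp.ext (h0.2.trans (Lp.coeFn_zero ℝ 1 m).symm)⟩
  have heig := isEigenfunction_pair hu hw hTu hTw hne'
  have hz := huniq _ hab ⟨_, heig⟩
  rw [hz] at heig
  have hh0 : ¬ h =ᵐ[m] 0 := fun h0 => by
    have := hfix.integral_eq
    rw [integral_congr_ae h0] at this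
    simp at this
  have heigh := isEigenfunction_pair (T := T) (a := 1) (b := 0) hBV (memBV_const 0)
    (by filter_upwards [hfix.fixed] with x hx; simpa using hx)
    (by
      have h1 : transfer T (fun _ => (0 : ℝ)) =ᵐ[m] fun _ => 0 := by
        simpa using transfer_const_mul hT (integrable_const (0 : ℝ)) 0
      filter_upwards [h1] with x hx; simpa using hx)
    (fun h0 => hh0 h0.1)
  obtain ⟨c₁, hc₁⟩ := hgen _ heigh
  obtain ⟨c₂, hc₂⟩ := hgen _ heig
  have hc0 : c₁ ≠ 0 := by
    rintro rfl
    refine hh0 ?_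
    filter_upwards [hc₁] with x hx
    simpa using hx
  have key : ∀ᵐ x ∂m, (u x : ℂ) + (w x : ℂ) * Complex.I = (c₂ / c₁) * h x := by
    filter_upwards [hc₁, hc₂] with x h1 h2
    simp only [Complex.ofReal_zero, zero_mul, add_zero] at h1
    rw [h2, h1]; field_simp
  have hu' : u =ᵐ[m] fun x => (c₂ / c₁).re * h x := by
    filter_upwards [key] with x hx
    simpa using congrArg Complex.re hx
  have hw' : w =ᵐ[m] fun x => (c₂ / c₁).im * h x := by
    filter_upwards [key] with x hx
    simpa using congrArg Complex.im hx
  rw [frame_I, integral_congr_ae hu', integral_const_mul, hfix.integral_eq, mul_one] at hIu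
  rw [frame_I, integral_congr_ae hw', integral_const_mul, hfix.integral_eq, mul_one] at hIw
  refine hne' ⟨?_, ?_⟩
  · filter_upwards [hu'] with x hx; rw [hx, hIu, zero_mul]; rfl
  · filter_upwards [hw'] with x hx; rw [hx, hIw, zero_mul]; rfl

theorem hasDecay_iff (hT : IsPiecewiseExpanding T) {C ρ : ℝ} (hC : 0 ≤ C) (hρ : 0 ≤ ρ) :
    HasDecay T C ρ ↔ frame.Decays (transferL hT) C ρ := by
  have key : ∀ (x : L1) (f : ℝ → ℝ), x ∈ frame.S → f =ᵐ[m] x → ∀ k : ℕ,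
      (eLpNorm ((transfer T)^[k] f) 1 m ≤ ENNReal.ofReal (C * ρ ^ k) * bvNorm f ↔
        ‖(transferL hT ^ k) x‖ ≤ C * ρ ^ k * frame.bn x) := by
    intro x f hx hf k
    rw [eLpNorm_congr_ae ((transferL_represents hT).iterate k hf),
      toReal_eLpNorm_one (L1.integrable _), ← L1.norm_eq, bvNorm_congr hf, bvNorm_eq hx,
      ← ENNReal.ofReal_mul (by positivity), ENNReal.ofReal_le_ofReal_iff
        (mul_nonneg (by positivity) (frame.bn_nonneg x))]
  constructor
  · intro h x hx hI k
    exact (key x x hx (EventuallyEq.refl _ _) k).1 (h x hx hI k)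
  · intro h g hg hI k
    have hae : g =ᵐ[m] hg.1.toL1 g := hg.1.coeFn_toL1.symm
    have hx := mem_frame_of_ae hae hg
    refine (key _ g hx hae k).2 (h _ hx ?_ k)
    rw [frame_I, ← integral_congr_ae hae, hI]

/-- On mean zero elements of `L¹` there is no fixed point of the transfer operator except `0`. -/
theorem eq_zero_of_fixed_transferL (hT : IsPiecewiseExpanding T) {α B L H θ : ℝ}
    (hP : frame.LY (transferL hT) α B L) (hd : frame.Decays (transferL hT) H θ) (hθ0 : 0 ≤ θ)
    (hθ : θ < 1) {y : L1} (hfix : transferL hT y = y) (hI : frame.I y = 0) : y = 0 := by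
  refine norm_le_zero_iff.1 (le_of_forall_pos_le_add fun δ hδ => ?_)
  rw [zero_add]
  obtain ⟨g, hg, hyg⟩ := exists_memBV_integral_sub_le (L1.integrable y) (half_pos hδ)
  set x : L1 := hg.1.toL1 g
  set e : L1 := (memBV_const 1).1.toL1 _
  have hgx : g =ᵐ[m] x := hg.1.coeFn_toL1.symm
  have hee : (fun _ => (1 : ℝ)) =ᵐ[m] e := (memBV_const 1).1.coeFn_toL1.symm
  have hx : x ∈ frame.S := mem_frame_of_ae hgx hg
  have he : e ∈ frame.S := mem_frame_of_ae hee (memBV_const 1)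
  have hIe : frame.I e = 1 := by rw [frame_I, ← integral_congr_ae hee]; simp
  have hne : ‖e‖ ≤ 1 := by
    rw [norm_toL1_eq]; simp
  have hyx : ‖y - x‖ ≤ δ / 2 := by
    rw [L1.norm_eq]
    refine (integral_congr_ae ?_).trans_le hyg
    filter_upwards [Lp.coeFn_sub y x, hgx] with t h1 h2
    rw [h1, Pi.sub_apply, ← h2]
  have hIx : |frame.I x| ≤ δ / 2 := by
    have := frame.I_le (y - x)
    rw [map_sub, hI, zero_sub, abs_neg] at this
    exact this.trans hyx
  -- Decay applies to mean zero elements only, so the mean of the approximant is removed at the cost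
  -- of another `δ / 2`.
  set x₀ := x - frame.I x • e
  have hx₀ : x₀ ∈ frame.S := frame.S.sub_mem hx (frame.S.smul_mem _ he)
  have hIx₀ : frame.I x₀ = 0 := by simp [x₀, hIe]
  have hyx₀ : ‖y - x₀‖ ≤ δ := by
    have e1 : y - x₀ = (y - x) + frame.I x • e := by simp only [x₀]; abel
    rw [e1]
    refine (norm_add_le _ _).trans ?_
    rw [norm_smul, Real.norm_eq_abs]
    have := mul_le_mul hIx hne (norm_nonneg _) (by positivity)
    linarith
  have hlim := (hd.tendsto hθ0 hθ hx₀ hIx₀).norm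
  rw [norm_zero] at hlim
  have hlim' := hlim.const_add δ
  rw [add_zero] at hlim'
  refine ge_of_tendsto' hlim' fun k => ?_
  have e2 : y = (transferL hT ^ k) (y - x₀) + (transferL hT ^ k) x₀ := by
    rw [map_sub, VarFrame.pow_apply_of_fixed hfix]; abel
  calc ‖y‖ = ‖(transferL hT ^ k) (y - x₀) + (transferL hT ^ k) x₀‖ := by rw [← e2]
    _ ≤ _ := (norm_add_le _ _).trans (add_le_add ((hP.norm_pow_le k _).trans hyx₀) le_rfl)

/-! ### Fixed densities, series and resolvents of represented operators -/

section represents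

variable {A : (ℝ → ℝ) → ℝ → ℝ} {Q : L1 →L[ℝ] L1}

theorem Represents.isUniqueFixedDensity (h : Represents A Q) {x : L1} (hx : x ∈ frame.S)
    (hx0 : 0 ≤ᵐ[m] x) (hI : frame.I x = 1) (hfix : Q x = x)
    (huniq : ∀ y, Q y = y → frame.I y = 0 → y = 0) : IsUniqueFixedDensity A x := by
  refine ⟨⟨L1.integrable x, hx0, hI, ?_⟩, hx, fun h' hh' => ?_⟩
  · rw [h.eq_iff (EventuallyEq.refl _ _) (EventuallyEq.refl _ _)]; exact hfix
  · set y : L1 := hh'.integrable.toL1 h'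
    have hy : h' =ᵐ[m] y := hh'.integrable.coeFn_toL1.symm
    have hQy : Q y = y := (h.eq_iff hy hy).1 hh'.fixed
    have hIy : frame.I y = 1 := by rw [frame_I, ← integral_congr_ae hy, hh'.integral_eq]
    have := huniq (y - x) (by rw [map_sub, hQy, hfix]) (by rw [map_sub, hIy, hI, sub_self])
    rw [sub_eq_zero.1 this] at hy
    exact hy

variable {ψ : ℝ → ℝ} {M : ℝ} (hψ : AEStronglyMeasurable ψ m) (hM : ∀ᵐ x ∂m, |ψ x| ≤ M)

theorem integral_mul_eq_I {f : ℝ → ℝ} {y : L1} (hf : f =ᵐ[m] y) :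
    ∫ t, ψ t * f t ∂m = frame.I (mulL hψ hM y) :=
  integral_congr_ae (mulL_represents hψ hM f y hf)

/-- Against a mean zero function the constant `∫ ψ h` drops out. The second centering in the
coefficients can therefore be forgotten, and only plain multiplication by `ψ` remains. -/
theorem integral_centered_mul (x : L1) {f : ℝ → ℝ} {y : L1} (hf : f =ᵐ[m] y)
    (hI : frame.I y = 0) : ∫ t, centered ψ x t * f t ∂m = frame.I (mulL hψ hM y) := by
  have hfi : Integrable f m := (L1.integrable y).congr hf.symm
  have hfI : ∫ t, f t ∂m = 0 := (integral_congr_ae hf).trans hI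
  simp only [centered, sub_mul]
  rw [integral_sub (hfi.bdd_mul hψ hM) (hfi.const_mul _), integral_const_mul, hfI, mul_zero,
    sub_zero, integral_mul_eq_I hψ hM hf]

theorem centered_mul_ae_eq (x : L1) :
    (fun t => centered ψ x t * x t) =ᵐ[m] frame.cen (mulL hψ hM) x := by
  have h1 := integral_mul_eq_I hψ hM (EventuallyEq.refl (ae m) (x : ℝ → ℝ))
  have h2 := mulL_represents hψ hM x x (EventuallyEq.refl _ _)
  filter_upwards [h2, Lp.coeFn_sub (mulL hψ hM x) (frame.I (mulL hψ hM x) • x),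
    Lp.coeFn_smul (frame.I (mulL hψ hM x)) x] with t h2 h3 h4
  rw [VarFrame.cen, h3, Pi.sub_apply, ← h2, h4, Pi.smul_apply, ← h1, smul_eq_mul, centered]
  ring

theorem integral_centered_sq (x : L1) (hx : frame.I x = 1) :
    ∫ t, centered ψ x t ^ 2 * x t ∂m =
      frame.I (mulL hψ hM (frame.cen (mulL hψ hM) x)) := by
  rw [← integral_centered_mul hψ hM x (centered_mul_ae_eq hψ hM x) (VarFrame.Mult.I_cen hx)]
  exact integral_congr_ae (ae_of_all _ fun t => by simp only; ring)

variable {α B L H θ : ℝ}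

theorem Represents.integral_iterate (h : Represents A Q) (hQ : frame.LY Q α B L) {x : L1}
    (hx : frame.I x = 1) (k : ℕ) :
    ∫ t, A^[k] (fun y => centered ψ x y * x y) t * centered ψ x t ∂m =
      frame.I (mulL hψ hM ((Q ^ k) (frame.cen (mulL hψ hM) x))) := by
  rw [← integral_centered_mul hψ hM x (h.iterate k (centered_mul_ae_eq hψ hM x))
    (by rw [hQ.I_pow, VarFrame.Mult.I_cen hx])]
  exact integral_congr_ae (ae_of_all _ fun t => mul_comm _ _)

/-- The second identity separates the term `k = 0` from the Neumann series; it is the link between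
the series form and the resolvent form of the coefficient. -/
theorem exists_hasSum (hd : frame.Decays Q H θ)
    (hθ0 : 0 ≤ θ) (hθ : θ < 1) {U : ℝ} (hD : frame.Mult (mulL hψ hM) M U) {x : L1}
    (hxS : x ∈ frame.S) (hx : frame.I x = 1) :
    ∃ s, HasSum (fun k => frame.I (mulL hψ hM ((Q ^ (k + 1)) (frame.cen (mulL hψ hM) x)))) s ∧
      frame.I (mulL hψ hM (∑' k, (Q ^ k) (frame.cen (mulL hψ hM) x))) =
        frame.I (mulL hψ hM (frame.cen (mulL hψ hM) x)) + s := by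
  have hs := hd.summable_apply hθ0 hθ (hD.cen_mem hxS) (VarFrame.Mult.I_cen hx)
  have hs' : Summable fun k => frame.I (mulL hψ hM ((Q ^ k) (frame.cen (mulL hψ hM) x))) :=
    (frame.I.comp (mulL hψ hM)).summable hs
  refine ⟨_, ((summable_nat_add_iff 1).2 hs').hasSum, ?_⟩
  have h1 := (frame.I.comp (mulL hψ hM)).map_tsum hs
  simp only [ContinuousLinearMap.comp_apply] at h1
  rw [h1, hs'.tsum_eq_zero_add]
  rfl

theorem Represents.isSeriesCoefficient (h : Represents A Q) (hQ : frame.LY Q α B L) {x : L1}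
    (hx : frame.I x = 1) {s : ℝ}
    (hs : HasSum (fun k => frame.I (mulL hψ hM ((Q ^ (k + 1)) (frame.cen (mulL hψ hM) x)))) s) :
    IsSeriesCoefficient A ψ x (frame.I (mulL hψ hM (frame.cen (mulL hψ hM) x)) + 2 * s) := by
  refine ⟨s, ?_, by rw [integral_centered_sq hψ hM x hx]⟩
  simpa only [h.integral_iterate hψ hM hQ hx] using hs

theorem Represents.isResolventCoefficient (h : Represents A Q) (hQ : frame.LY Q α B L)
    (hd : frame.Decays Q H θ) (hθ0 : 0 ≤ θ) (hθ : θ < 1) {U : ℝ}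
    (hD : frame.Mult (mulL hψ hM) M U) {x : L1} (hxS : x ∈ frame.S) (hx : frame.I x = 1)
    (huniq : ∀ y, Q y = y → frame.I y = 0 → y = 0) {s : ℝ}
    (hs : frame.I (mulL hψ hM (∑' k, (Q ^ k) (frame.cen (mulL hψ hM) x))) =
        frame.I (mulL hψ hM (frame.cen (mulL hψ hM) x)) + s) :
    IsResolventCoefficient A ψ x (frame.I (mulL hψ hM (frame.cen (mulL hψ hM) x)) + 2 * s) := by
  set f := frame.cen (mulL hψ hM) x
  have hf : f ∈ frame.S := hD.cen_mem hxS
  have hIf : frame.I f = 0 := VarFrame.Mult.I_cen hx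
  set g := ∑' k, (Q ^ k) f
  have hIg : frame.I g = 0 := hd.I_tsum hQ hθ0 hθ hf hIf
  have hg : g - Q g = f := hd.tsum_sub hθ0 hθ hf hIf
  have hsol : ∀ {u : ℝ → ℝ} {y : L1}, u =ᵐ[m] y →
      (u - A u =ᵐ[m] (fun t => centered ψ x t * x t) ↔ y - Q y = f) := by
    intro u y hu
    have h1 : u - A u =ᵐ[m] (y - Q y : L1) :=
      (hu.sub (h u y hu)).trans (Lp.coeFn_sub y (Q y)).symm
    have h2 := centered_mul_ae_eq hψ hM x
    exact ⟨fun h' => Lp.ext (h1.symm.trans (h'.trans h2)), fun h' =>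
      h1.trans (by rw [h']; exact h2.symm)⟩
  refine ⟨g, ⟨⟨L1.integrable g, hIg, (hsol (EventuallyEq.refl _ _)).2 hg⟩, ?_⟩, ?_⟩
  · intro g' hg' hIg' hsg'
    have hae : g' =ᵐ[m] hg'.toL1 g' := hg'.coeFn_toL1.symm
    have h1 := (hsol hae).1 hsg'
    have h2 : hg'.toL1 g' - g = 0 := by
      refine huniq _ ?_ ?_
      · rw [map_sub, ← sub_eq_zero]
        have : Q (hg'.toL1 g') - Q g - (hg'.toL1 g' - g) =
          (g - Q g) - (hg'.toL1 g' - Q (hg'.toL1 g')) := by abel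
        rw [this, h1, hg, sub_self]
      · rw [map_sub, hIg, sub_zero, frame_I, ← integral_congr_ae hae, hIg']
    rw [sub_eq_zero.1 h2] at hae
    exact hae
  -- With `c` the integral of the centered square, this is `-c + 2 (c + s) = c + 2 s`.
  · rw [integral_centered_sq hψ hM x hx,
      integral_centered_mul hψ hM x (EventuallyEq.refl _ (g : ℝ → ℝ)) hIg, hs]
    ring

end represents

/-! ### The diffusion coefficient -/

theorem integral_mul_comp_iterate (hT : IsPiecewiseExpanding T) {f g : ℝ → ℝ}
    (hf : Integrable f m) (hg : Measurable g) {C : ℝ} (hC : ∀ x, |g x| ≤ C) (k : ℕ) :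
    ∫ x, f x * g (T^[k] x) ∂m = ∫ x, (transfer T)^[k] f x * g x ∂m := by
  induction k generalizing f with
  | zero => rfl
  | succ k ih =>
    rw [Function.iterate_succ_apply, ← ih (integrable_transfer T f)]
    exact (integral_transfer_mul hT hf (hg.comp (hT.measurable.iterate k)) fun x => hC _).symm

/-- Squaring `S_{n+1} = φ + S_n ∘ T` and using duality and invariance of `h`, the second moments `a
n` grow by `C₀ + 2 ∑_{i<n} D i` at each step. So `a n / n` is a Cesàro mean of a sequence that
converges to `C₀ + 2 S`. -/
theorem IsSeriesCoefficient.isDiffusionCoefficient (hT : IsPiecewiseExpanding T) {ψ h : ℝ → ℝ}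
    (hψ : MemBV ψ) (hh : IsFixedDensity (transfer T) h) {s : ℝ}
    (hs : IsSeriesCoefficient (transfer T) ψ h s) : IsDiffusionCoefficient T ψ h s := by
  obtain ⟨S, hS, rfl⟩ := hs
  -- Duality requires a measurable function bounded at every point, which the optimal representative
  -- of `ψ` is.
  obtain ⟨g, hg1, hgm, hg2⟩ := exists_rep hψ.2
  set c := ∫ y, ψ y * h y ∂m with hc
  set φ : ℝ → ℝ := fun x => g x - c with hφ
  have hφae : φ =ᵐ[m] centered ψ h := hg1.mono fun x hx => by simp only [hφ, centered, hx, hc]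
  have hφm : Measurable φ := hgm.sub_const c
  obtain ⟨C, hC0, hC⟩ : ∃ C, 0 ≤ C ∧ ∀ x, |φ x| ≤ C := by
    refine ⟨∫ y, |g y| ∂m + (essVar ψ).toReal + |c|, by positivity, fun x => ?_⟩
    have := abs_le_integral_add ENNReal.toReal_nonneg (hψ.1.congr hg1.symm)
      (by rw [ENNReal.ofReal_toReal hψ.2, hg2]) x
    exact (abs_sub _ _).trans (by linarith)
  set Sn : ℕ → ℝ → ℝ := fun n x => ∑ i ∈ Finset.range n, φ (T^[i] x) with hSn
  have hSnm : ∀ n, Measurable (Sn n) := fun n =>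
    Finset.measurable_fun_sum _ fun i _ => hφm.comp (hT.measurable.iterate i)
  have hSnb : ∀ n x, |Sn n x| ≤ n * C := fun n x => by
    refine (Finset.abs_sum_le_sum_abs _ _).trans ((Finset.sum_le_sum fun i _ => hC _).trans ?_)
    simp
  have hhi := hh.integrable
  have hφh : Integrable (fun x => φ x * h x) m :=
    hhi.bdd_mul hφm.aestronglyMeasurable (ae_of_all _ hC)
  set C₀ := ∫ x, centered ψ h x ^ 2 * h x ∂m
  set D : ℕ → ℝ := fun i =>
    ∫ x, ((transfer T)^[i + 1] (fun y => centered ψ h y * h y)) x * centered ψ h x ∂m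
  have hC₀ : ∫ x, φ x ^ 2 * h x ∂m = C₀ :=
    integral_congr_ae (hφae.mono fun x hx => by simp only [hx])
  have hD : ∀ i, ∫ x, transfer T (fun y => φ y * h y) x * φ (T^[i] x) ∂m = D i := fun i => by
    have e : transfer T (fun y => φ y * h y) = transfer T fun y => centered ψ h y * h y :=
      transfer_congr (hφae.mul (EventuallyEq.refl _ h))
    rw [integral_mul_comp_iterate hT (integrable_transfer T _) hφm hC i, e,
      ← Function.iterate_succ_apply]
    exact integral_congr_ae (hφae.mono fun x hx => by simp only [hx])
  set a : ℕ → ℝ := fun n => ∫ x, Sn n x ^ 2 * h x ∂m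
  have hrec : ∀ n, a (n + 1) = a n + (C₀ + 2 * ∑ i ∈ Finset.range n, D i) := by
    intro n
    have e1 : ∀ x, Sn (n + 1) x = φ x + Sn n (T x) := fun x => by
      simp only [hSn]
      rw [Finset.sum_range_succ', add_comm]
      rfl
    have i1 : Integrable (fun x => φ x ^ 2 * h x) m :=
      hhi.bdd_mul (c := C ^ 2) (hφm.pow_const 2).aestronglyMeasurable (ae_of_all _ fun x => by
        rw [norm_pow]; exact pow_le_pow_left₀ (norm_nonneg _) (hC x) 2)
    have i2 : Integrable (fun x => (φ x * h x) * Sn n (T x)) m :=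
      hφh.mul_bdd (c := n * C) ((hSnm n).comp hT.measurable).aestronglyMeasurable
        (ae_of_all _ fun x => hSnb n _)
    have hsqm : Measurable fun x => Sn n x ^ 2 := (hSnm n).pow_const 2
    have hsqb : ∀ x, |Sn n x ^ 2| ≤ (n * C) ^ 2 := fun x => by
      rw [abs_pow]; exact pow_le_pow_left₀ (abs_nonneg _) (hSnb n x) 2
    have i3 : Integrable (fun x => h x * Sn n (T x) ^ 2) m :=
      hhi.mul_bdd (hsqm.comp hT.measurable).aestronglyMeasurable (ae_of_all _ fun x => hsqb (T x))
    have e2 : a (n + 1) = ∫ x, (φ x ^ 2 * h x + (2 * ((φ x * h x) * Sn n (T x)) +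
        h x * Sn n (T x) ^ 2)) ∂m :=
      integral_congr_ae (ae_of_all _ fun x => by simp only [e1]; ring)
    have e5 : ∫ x, (φ x ^ 2 * h x + (2 * ((φ x * h x) * Sn n (T x)) + h x * Sn n (T x) ^ 2)) ∂m =
        ∫ x, φ x ^ 2 * h x ∂m + ∫ x, (2 * ((φ x * h x) * Sn n (T x)) + h x * Sn n (T x) ^ 2) ∂m :=
      integral_add i1 ((i2.const_mul 2).add i3)
    rw [e2, e5, integral_add (i2.const_mul 2) i3, integral_const_mul, hC₀]
    have e3 : ∫ x, h x * Sn n (T x) ^ 2 ∂m = a n := by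
      rw [← integral_transfer_mul hT hhi hsqm hsqb]
      exact integral_congr_ae (hh.fixed.mono fun x hx => by simp only [hx]; ring)
    have e4 : ∫ x, (φ x * h x) * Sn n (T x) ∂m = ∑ i ∈ Finset.range n, D i := by
      rw [← integral_transfer_mul hT hφh (hSnm n) (hSnb n)]
      simp only [hSn, Finset.mul_sum]
      rw [integral_finsetSum]
      · exact Finset.sum_congr rfl fun i _ => hD i
      · exact fun i _ => (integrable_transfer T _).mul_bdd
          (hφm.comp (hT.measurable.iterate i)).aestronglyMeasurable (ae_of_all _ fun x => hC _)
    rw [e3, e4]; ring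
  have ha : ∀ n, a n = ∑ k ∈ Finset.range n, (C₀ + 2 * ∑ i ∈ Finset.range k, D i) := by
    intro n
    induction n with
    | zero => simp [a, hSn]
    | succ n ih => rw [hrec, ih, Finset.sum_range_succ]
  have hces := ((hS.tendsto_sum_nat.const_mul 2).const_add C₀).cesaro
  refine hces.congr fun n => ?_
  rw [← ha, one_div]
  congr 1
  refine integral_congr_ae ?_
  -- Return from `g` to `ψ`: by nonsingularity of `T`, almost every orbit avoids the null set where
  -- they differ.
  have hiter : ∀ᵐ x ∂m, ∀ i : ℕ, g (T^[i] x) = ψ (T^[i] x) :=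
    ae_all_iff.2 fun i => (hT.quasiMeasurePreserving.iterate i).ae_eq_comp hg1
  filter_upwards [hiter] with x hx
  simp only [hSn, hφ, hx, Finset.sum_sub_distrib, Finset.sum_const, Finset.card_range, nsmul_eq_mul, hc]

end UlamDiffusion
end

noncomputable section

namespace UlamDiffusion

open scoped ENNReal

/-! ### The constants -/

/-- Bound for the strong norm of the iterates, `q = (a, b, c, r)`. -/
def growthConst (q : ℕ × ℕ × ℕ × ℕ) : ℕ := q.1 * q.2.1 + 1

/-- Number of iterations after which the weak norm is small. -/
def stepsConst (q : ℕ × ℕ × ℕ × ℕ) : ℕ := 16 * growthConst q * q.2.2.1 * q.2.2.2 * q.1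

/-- The inverse of the largest admissible mesh. -/
def meshConst (q : ℕ × ℕ × ℕ × ℕ) : ℕ :=
  16 * growthConst q * stepsConst q * ((2 + q.2.1) * growthConst q) + 3

/-- Decay of the iterates takes place at the rate `exp (-1 / rateConst q)`. -/
def rateConst (q : ℕ × ℕ × ℕ × ℕ) : ℕ := q.2.2.2 + 2 * stepsConst q

/-- The prefactor in the decay of the iterates. -/
def decayConst (q : ℕ × ℕ × ℕ × ℕ) : ℕ := q.2.2.1 + 3 * growthConst q

/-- The constant of the stability estimate in terms of the data of `abs_coefficient_sub_le`. -/
def stabilityConst {R : Type*} [Semiring R] (M U d H G S : R) : R :=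
  2 * M * (S * (3 * M * (2 * H * G + S * (d * G) * G)) + S * S * (d * G) * ((U + M) * G) +
    2 * H * S * ((U + M) * G))

/-- The constant of the error estimate, `q = (a, b, c, r, M, W)`. -/
def errorConst (q : ℕ × ℕ × ℕ × ℕ × ℕ × ℕ) : ℕ :=
  let p := (q.1, q.2.1, q.2.2.1, q.2.2.2.1)
  let M := q.2.2.2.2.1
  let W := q.2.2.2.2.2
  stabilityConst M (2 * (W + M) + M) (2 + q.2.1) (decayConst p) (growthConst p) (rateConst p + 1)

/-! ### Computability: the constants are polynomials, hence primitive recursive -/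

section primrec

variable {α : Type*} [Primcodable α] {f g : α → ℕ}

theorem primrec_add (hf : Primrec f) (hg : Primrec g) : Primrec fun x => f x + g x :=
  Primrec.nat_add.comp hf hg

theorem primrec_mul (hf : Primrec f) (hg : Primrec g) : Primrec fun x => f x * g x :=
  Primrec.nat_mul.comp hf hg

theorem primrec_growthConst : Primrec growthConst :=
  primrec_add (primrec_mul Primrec.fst (Primrec.fst.comp Primrec.snd)) (Primrec.const 1)

theorem primrec_stepsConst : Primrec stepsConst :=
  primrec_mul (primrec_mul (primrec_mul (primrec_mul (Primrec.const 16) primrec_growthConst)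
    (Primrec.fst.comp (Primrec.snd.comp Primrec.snd)))
    (Primrec.snd.comp (Primrec.snd.comp Primrec.snd))) Primrec.fst

theorem primrec_meshConst : Primrec meshConst :=
  primrec_add (primrec_mul (primrec_mul (primrec_mul (Primrec.const 16) primrec_growthConst)
    primrec_stepsConst) (primrec_mul (primrec_add (Primrec.const 2)
    (Primrec.fst.comp Primrec.snd)) primrec_growthConst)) (Primrec.const 3)

theorem primrec_rateConst : Primrec rateConst :=
  primrec_add (Primrec.snd.comp (Primrec.snd.comp Primrec.snd))
    (primrec_mul (Primrec.const 2) primrec_stepsConst)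

theorem primrec_decayConst : Primrec decayConst :=
  primrec_add (Primrec.fst.comp (Primrec.snd.comp Primrec.snd))
    (primrec_mul (Primrec.const 3) primrec_growthConst)

theorem primrec_stabilityConst {M U d H G S : α → ℕ} (hM : Primrec M) (hU : Primrec U)
    (hd : Primrec d) (hH : Primrec H) (hG : Primrec G) (hS : Primrec S) :
    Primrec fun x => stabilityConst (M x) (U x) (d x) (H x) (G x) (S x) := by
  have c2 : Primrec fun _ : α => 2 := Primrec.const 2
  have c3 : Primrec fun _ : α => 3 := Primrec.const 3
  have hdG := primrec_mul hd hG
  have hUM := primrec_mul (primrec_add hU hM) hG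
  exact primrec_mul (primrec_mul c2 hM) (primrec_add (primrec_add
    (primrec_mul hS (primrec_mul (primrec_mul c3 hM)
      (primrec_add (primrec_mul (primrec_mul c2 hH) hG) (primrec_mul (primrec_mul hS hdG) hG))))
    (primrec_mul (primrec_mul (primrec_mul hS hS) hdG) hUM))
    (primrec_mul (primrec_mul (primrec_mul c2 hH) hS) hUM))

theorem primrec_errorConst : Primrec errorConst := by
  have s2 : Primrec fun q : ℕ × ℕ × ℕ × ℕ × ℕ × ℕ => q.2.2 := Primrec.snd.comp Primrec.snd
  have s3 : Primrec fun q : ℕ × ℕ × ℕ × ℕ × ℕ × ℕ => q.2.2.2 := Primrec.snd.comp s2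
  have s4 : Primrec fun q : ℕ × ℕ × ℕ × ℕ × ℕ × ℕ => q.2.2.2.2 := Primrec.snd.comp s3
  have hb : Primrec fun q : ℕ × ℕ × ℕ × ℕ × ℕ × ℕ => q.2.1 := Primrec.fst.comp Primrec.snd
  have hM := Primrec.fst.comp s4
  have hW := Primrec.snd.comp s4
  have hp : Primrec fun q : ℕ × ℕ × ℕ × ℕ × ℕ × ℕ => (q.1, q.2.1, q.2.2.1, q.2.2.2.1) :=
    Primrec.fst.pair (hb.pair ((Primrec.fst.comp s2).pair (Primrec.fst.comp s3)))
  exact primrec_stabilityConst hM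
    (primrec_add (primrec_mul (Primrec.const 2) (primrec_add hW hM)) hM)
    (primrec_add (Primrec.const 2) hb) (primrec_decayConst.comp hp) (primrec_growthConst.comp hp)
    (primrec_add (primrec_rateConst.comp hp) (Primrec.const 1))

end primrec

/-! ### The spectral gap of Ulam's approximation -/

theorem le_exp_of_inv_one_sub_le {t a : ℝ} (ht1 : t < 1) (ha : (1 - t)⁻¹ ≤ a) :
    t ≤ Real.exp (-(1 / a)) := by
  have h1 : 0 < 1 - t := by linarith
  have ha0 : 0 < a := (inv_pos.2 h1).trans_le ha
  have h2 : 1 / a ≤ 1 - t := by rw [one_div]; exact inv_le_of_inv_le₀ h1 ha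
  have h3 := Real.add_one_le_exp (-(1 / a))
  linarith

/-- Bounding the exponential by `e^(-n/a) ≤ a/n` is crude, but it lets the number of steps be a
polynomial in the data. -/
theorem pow_le_div_of_inv_one_sub_le {t a : ℝ} (ht : 0 ≤ t) (ht1 : t < 1) (ha : (1 - t)⁻¹ ≤ a)
    {n : ℕ} (hn : 0 < n) : t ^ n ≤ a / n := by
  have ha0 : 0 < a := (inv_pos.2 (by linarith)).trans_le ha
  have hn' : (0 : ℝ) < n := by exact_mod_cast hn
  calc t ^ n ≤ Real.exp (-(1 / a)) ^ n := by gcongr; exact le_exp_of_inv_one_sub_le ht1 ha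
    _ = (Real.exp (n / a))⁻¹ := by rw [← Real.exp_nat_mul, ← Real.exp_neg]; ring_nf
    _ ≤ (n / a)⁻¹ := inv_anti₀ (by positivity) (by linarith [Real.add_one_le_exp ((n : ℝ) / a)])
    _ = a / n := inv_div _ _

/-- After `n` steps `P` is weakly small on the kernel of `I`, and `Qⁿ` differs from `Pⁿ` by at most
`n (2 + b) ε (a b + 1)`. Both are at most `1 / (16 G)` by the choice of `n` and of the mesh, so `Q`
contracts the strong norm after `2 n` steps. The rate `r + 2 n` and the prefactor `c + 3 G` serve
both operators. -/
theorem decays_of_close {F : VarFrame L1} {P Q : L1 →L[ℝ] L1} {α B C ρ ε : ℝ} {a b c r : ℕ}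
    (hP : F.LY P α B (a * b)) (hQ : F.LY Q α B (a * b)) (hC : 0 < C) (hρ : 0 < ρ) (hρ1 : ρ < 1)
    (hd : F.Decays P C ρ) (ha : (1 - α)⁻¹ ≤ (a : ℝ)) (hc : C ≤ (c : ℝ)) (hr : (1 - ρ)⁻¹ ≤ (r : ℝ))
    (hε : 0 < ε) (hεN : ε ≤ 1 / (meshConst (a, b, c, r) : ℝ))
    (hPQ : ∀ x ∈ F.S, ‖P x - Q x‖ ≤ (2 + b) * ε * F.bn x) :
    F.Decays P (decayConst (a, b, c, r)) (Real.exp (-(1 / (rateConst (a, b, c, r) : ℝ)))) ∧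
    F.Decays Q (decayConst (a, b, c, r)) (Real.exp (-(1 / (rateConst (a, b, c, r) : ℝ)))) := by
  set q := (a, b, c, r)
  have ha0 : (0 : ℝ) < a := (inv_pos.2 (by linarith [hP.α_lt])).trans_le ha
  have hc0 : (0 : ℝ) < c := hC.trans_le hc
  have hr0 : (0 : ℝ) < r := (inv_pos.2 (by linarith)).trans_le hr
  have ha1 : 1 ≤ a := by exact_mod_cast ha0
  have hc1 : 1 ≤ c := by exact_mod_cast hc0
  have hr1 : 1 ≤ r := by exact_mod_cast hr0
  have hG : (growthConst q : ℝ) = a * b + 1 := by simp [growthConst, q]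
  have hG0 : (0 : ℝ) < growthConst q := by rw [hG]; positivity
  set G : ℝ := (growthConst q : ℝ) with hGdef
  set n := stepsConst q with hndef
  have hn : (n : ℝ) = 16 * G * c * r * a := by simp [n, stepsConst, q, hGdef]
  have hn0 : (0 : ℝ) < n := by rw [hn]; positivity
  have hnpos : 0 < n := by exact_mod_cast hn0
  have hR : (rateConst q : ℝ) = r + 2 * n := by simp [rateConst, q, hndef]
  have hH : (decayConst q : ℝ) = c + 3 * G := by simp [decayConst, q, hGdef]
  have hexp : ∀ s : ℝ, 0 < s → s ≤ r + 2 * n →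
      Real.exp (-(1 / s)) ≤ Real.exp (-(1 / (rateConst q : ℝ))) := by
    intro s hs hsr
    rw [hR]
    exact Real.exp_le_exp.2 (neg_le_neg (one_div_le_one_div_of_le hs hsr))
  refine ⟨hd.mono (by rw [hH]; linarith) (by positivity) hρ.le
    ((le_exp_of_inv_one_sub_le hρ1 hr).trans (hexp r hr0 (by linarith))), ?_⟩
  have hN : (meshConst q : ℝ) = 16 * G * n * ((2 + b) * G) + 3 := by
    simp [meshConst, q, hGdef, hndef]
  -- By the choice of `n`, `αⁿ ≤ a / n = 1 / (16 G c r)`.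
  have hα : α ^ n ≤ 1 / (8 * ((a : ℝ) * b + 1)) := by
    refine (pow_le_div_of_inv_one_sub_le hP.α_nonneg hP.α_lt ha hnpos).trans ?_
    rw [← hG, hn, div_le_div_iff₀ (by positivity) (by positivity)]
    have h1 : (1 : ℝ) ≤ c * r := by exact_mod_cast Nat.mul_pos hc1 hr1
    have h2 : (8 * (a * G)) * 1 ≤ (8 * (a * G)) * (c * r) := by gcongr
    have h3 : 0 ≤ 8 * (a * G) * (c * r) := by positivity
    linarith
  have hw : ∀ x ∈ F.S, F.I x = 0 → ‖(Q ^ n) x‖ ≤ 1 / (8 * ((a : ℝ) * b + 1)) * F.bn x := by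
    intro x hx hI
    have h1 := hd x hx hI n
    have h2 := hP.norm_pow_sub_pow_le hQ (by positivity) hPQ n hx
    have h3 : C * ρ ^ n ≤ 1 / (16 * G) := by
      calc C * ρ ^ n ≤ c * (r / n) := by
            gcongr; exact pow_le_div_of_inv_one_sub_le hρ.le hρ1 hr hnpos
        _ = 1 / (16 * G) / a := by rw [hn]; field_simp
        _ ≤ 1 / (16 * G) := div_le_self (by positivity) (by exact_mod_cast ha1)
    -- The product in `meshConst` is exactly the lower bound on `1 / ε` needed here.
    have h4 : n * ((2 + b) * ε * ((a : ℝ) * b + 1)) ≤ 1 / (16 * G) := by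
      have hN0 : (0 : ℝ) < meshConst q := by rw [hN]; positivity
      have h5 : ε * meshConst q ≤ 1 := by rwa [le_div_iff₀ hN0] at hεN
      rw [hN] at h5
      rw [← hG, le_div_iff₀ (by positivity)]
      linarith
    have h6 := mul_le_mul_of_nonneg_right h3 (F.bn_nonneg x)
    have h7 := mul_le_mul_of_nonneg_right h4 (F.bn_nonneg x)
    have e1 : 1 / (8 * ((a : ℝ) * b + 1)) * F.bn x =
        1 / (16 * G) * F.bn x + 1 / (16 * G) * F.bn x := by
      rw [← hG]; field_simp; ring
    have e2 : (Q ^ n) x = (P ^ n) x - ((P ^ n) x - (Q ^ n) x) := by abel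
    rw [e1, e2]
    exact (norm_sub_le _ _).trans (by linarith)
  have hdQ := hQ.decays (n := 2 * n) (by omega) fun x hx hI =>
    hQ.bn_pow_two_mul_le hα hx (hw x hx hI)
  refine hdQ.mono ?_ (by positivity) (Real.exp_pos _).le ?_
  · rw [hH, hG]; linarith
  · push_cast
    exact hexp _ (by positivity) (by linarith)

theorem ulamL_nonneg {T : ℝ → ℝ} (hT : IsPiecewiseExpanding T) (η : IntervalPartition) {x : L1}
    (hx : 0 ≤ᵐ[m] x) : 0 ≤ᵐ[m] ulamL hT η x := by
  have hproj : ∀ y : L1, 0 ≤ᵐ[m] y → 0 ≤ᵐ[m] projL η y := fun y hy => by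
    filter_upwards [projL_represents η y y (EventuallyEq.refl _ _),
      (condExp_nonneg hy : 0 ≤ᵐ[m] proj η y)] with t h1 h2
    rwa [← h1]
  refine hproj (transferL hT (projL η x)) ?_
  have h := transfer_nonneg hT (L1.integrable _) (hproj x hx)
  filter_upwards [h, transferL_ae_eq hT (projL η x)] with t h1 h2
  rwa [h2]

theorem norm_eq_one_of_nonneg {x : L1} (hx : 0 ≤ᵐ[m] x) (hI : frame.I x = 1) : ‖x‖ = 1 := by
  rw [L1.norm_eq, ← hI, frame_I]
  exact integral_congr_ae (hx.mono fun t ht => abs_of_nonneg ht)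

/-- The fixed density is the limit of the iterates of the constant `1`: positivity and the integral
pass to the limit. It lies in `BV` because every image under Ulam's operator is a step function. -/
theorem exists_fixed_ulamL {T : ℝ → ℝ} (hT : IsPiecewiseExpanding T) (η : IntervalPartition)
    {α B L H θ : ℝ} (hQ : frame.LY (ulamL hT η) α B L) (hd : frame.Decays (ulamL hT η) H θ)
    (hθ0 : 0 ≤ θ) (hθ : θ < 1) :
    ∃ x : L1, x ∈ frame.S ∧ 0 ≤ᵐ[m] x ∧ frame.I x = 1 ∧ ulamL hT η x = x := by
  set e : L1 := (memBV_const 1).1.toL1 _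
  have hee : (fun _ => (1 : ℝ)) =ᵐ[m] e := (memBV_const 1).1.coeFn_toL1.symm
  have he : e ∈ frame.S := mem_frame_of_ae hee (memBV_const 1)
  have hIe : frame.I e = 1 := by rw [frame_I, ← integral_congr_ae hee]; simp
  have he0 : 0 ≤ᵐ[m] e := by
    filter_upwards [hee] with t ht
    rw [← ht]; exact zero_le_one
  obtain ⟨x, hx, hlim⟩ := hd.exists_fixed hQ hθ0 hθ he
  have hpos : ∀ k, 0 ≤ᵐ[m] (ulamL hT η ^ k) e := by
    intro k
    induction k with
    | zero => simpa
    | succ k ih => rw [VarFrame.pow_succ_apply']; exact ulamL_nonneg hT η ih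
  refine ⟨x, hx ▸ ulamL_mem hT η x, ?_, ?_, hx⟩
  · rw [Lp.coeFn_nonneg]
    exact ge_of_tendsto' hlim fun k => (Lp.coeFn_nonneg _).1 (hpos k)
  · have h1 := (frame.I.continuous.tendsto _).comp hlim
    refine tendsto_nhds_unique h1 (tendsto_const_nhds.congr fun k => ?_)
    rw [Function.comp_apply, hQ.I_pow, hIe]

theorem exists_ae_bound {ψ : ℝ → ℝ} (hψ : MemBV ψ) :
    ∃ M : ℝ, 0 ≤ M ∧ ∀ᵐ x ∂m, |ψ x| ≤ M := by
  obtain ⟨g, hg1, -, hg2⟩ := exists_rep hψ.2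
  refine ⟨∫ y, |g y| ∂m + (essVar ψ).toReal, by positivity, ?_⟩
  filter_upwards [hg1] with x hx
  rw [← hx]
  exact abs_le_integral_add ENNReal.toReal_nonneg (hψ.1.congr hg1.symm)
    (by rw [ENNReal.ofReal_toReal hψ.2, hg2]) x

theorem IsSeriesCoefficient.unique {Q : (ℝ → ℝ) → ℝ → ℝ} {ψ h : ℝ → ℝ} {s t : ℝ}
    (hs : IsSeriesCoefficient Q ψ h s) (ht : IsSeriesCoefficient Q ψ h t) : s = t := by
  obtain ⟨S, hS, rfl⟩ := hs
  obtain ⟨S', hS', rfl⟩ := ht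
  rw [hS.unique hS']

/-- The summand `3 > e` in `meshConst` is there for this, so that lower powers of the logarithm can
be absorbed. -/
theorem one_le_log_inv {ε : ℝ} {q : ℕ × ℕ × ℕ × ℕ} (hε : 0 < ε)
    (hεN : ε ≤ 1 / (meshConst q : ℝ)) : 1 ≤ Real.log ε⁻¹ := by
  rw [Real.le_log_iff_exp_le (inv_pos.2 hε)]
  have h3 : (3 : ℝ) ≤ meshConst q := by
    have : 3 ≤ meshConst q := Nat.le_add_left _ _
    exact_mod_cast this
  have h4 : (meshConst q : ℝ) ≤ ε⁻¹ := by
    rw [one_div] at hεN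
    exact le_inv_of_le_inv₀ hε hεN
  linarith [Real.exp_one_lt_d9]

/-- The stability estimate for one partition. -/
theorem exists_ulam_coefficient {T ψ : ℝ → ℝ} {α B C ρ ε σsq : ℝ} (hT : IsPiecewiseExpanding T)
    (hα : 0 < α) (hα1 : α < 1) (hB : 0 ≤ B) (hA1 : A1 T α B) {x : L1} (hx : x ∈ frame.S)
    (hx0 : 0 ≤ᵐ[m] x) (hIx : frame.I x = 1) (hPx : transferL hT x = x) (hψ : MemBV ψ)
    (hσ : IsSeriesCoefficient (transfer T) ψ x σsq) (hC : 0 < C) (hρ : 0 < ρ) (hρ1 : ρ < 1)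
    (hd : HasDecay T C ρ) {a b c r M W : ℕ} (ha : (1 - α)⁻¹ ≤ (a : ℝ)) (hb : B ≤ (b : ℝ))
    (hc : C ≤ (c : ℝ)) (hr : (1 - ρ)⁻¹ ≤ (r : ℝ)) (hM : eLpNorm ψ ⊤ m ≤ (M : ENNReal))
    (hW : essVar ψ ≤ (W : ENNReal)) (hε : 0 < ε) (hεN : ε ≤ 1 / (meshConst (a, b, c, r) : ℝ))
    (η : IntervalPartition) (hη : η.MeshLE ε) :
    ∃ hε : ℝ → ℝ, IsUniqueFixedDensity (ulam T η) hε ∧ ∃ σεsq : ℝ,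
      IsSeriesCoefficient (ulam T η) ψ hε σεsq ∧ IsResolventCoefficient (ulam T η) ψ hε σεsq ∧
      |σεsq - σsq| ≤ (errorConst (a, b, c, r, M, W) : ℝ) * ε * Real.log ε⁻¹ ^ 2 := by
  -- The integer `a * b` is an admissible `L`, since `(1 - α) a ≥ 1`.
  have hBL : B ≤ (1 - α) * ((a : ℝ) * b) := by
    have h1 : 1 ≤ (1 - α) * a := by
      rwa [inv_le_iff_one_le_mul₀' (by linarith)] at ha
    have h2 : 1 * (b : ℝ) ≤ (1 - α) * a * b := by gcongr
    linarith
  have hP := transferL_LY hT hα hα1 hB hA1 (by positivity) hBL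
  have hQ := ulamL_LY hT η hP
  have hPQ : ∀ y ∈ frame.S, ‖transferL hT y - ulamL hT η y‖ ≤ (2 + b) * ε * frame.bn y := by
    intro y hy
    refine (norm_transferL_sub_ulamL_le hT η hP hε.le hη hy).trans ?_
    have := frame.bn_nonneg y
    gcongr
  obtain ⟨hdP, hdQ⟩ := decays_of_close hP hQ hC hρ hρ1 ((hasDecay_iff hT hC.le hρ.le).1 hd) ha hc hr
    hε hεN hPQ
  have hr0 : (0 : ℝ) < r := (inv_pos.2 (by linarith)).trans_le hr
  have hR : (0 : ℝ) < rateConst (a, b, c, r) := by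
    have : 0 < r := by exact_mod_cast hr0
    have : 0 < rateConst (a, b, c, r) := by simp only [rateConst]; omega
    exact_mod_cast this
  have hθ0 : 0 ≤ Real.exp (-(1 / (rateConst (a, b, c, r) : ℝ))) := (Real.exp_pos _).le
  have hθ1 := VarFrame.exp_neg_inv_lt_one hR
  have hMae : ∀ᵐ t ∂m, |ψ t| ≤ M := by
    rw [eLpNorm_exponent_top] at hM
    filter_upwards [ae_le_eLpNormEssSup (f := ψ) (μ := m)] with t ht
    have h1 := ht.trans hM
    rw [← ofReal_norm, ← ENNReal.ofReal_natCast,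
      ENNReal.ofReal_le_ofReal_iff (Nat.cast_nonneg M)] at h1
    exact h1
  have hD := mulL_mult hψ (Nat.cast_nonneg M) (Nat.cast_nonneg W) hMae
    (by rwa [ENNReal.ofReal_natCast])
  obtain ⟨y, hy, hy0, hIy, hQy⟩ := exists_fixed_ulamL hT η hQ hdQ hθ0 hθ1
  -- A fixed point in `L¹` is a step function, so decay on `BV` already gives uniqueness in `L¹`.
  have huniq : ∀ z, ulamL hT η z = z → frame.I z = 0 → z = 0 := fun z hz hIz =>
    hdQ.eq_zero_of_fixed hθ0 hθ1 (hz ▸ ulamL_mem hT η z) hIz hz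
  obtain ⟨s, hs, -⟩ := exists_hasSum hψ.1.1 hMae hdP hθ0 hθ1 hD hx hIx
  obtain ⟨t, ht, ht'⟩ := exists_hasSum hψ.1.1 hMae hdQ hθ0 hθ1 hD hy hIy
  have hrep := ulamL_represents hT η
  refine ⟨y, hrep.isUniqueFixedDensity hy hy0 hIy hQy huniq, _,
    hrep.isSeriesCoefficient hψ.1.1 hMae hQ hIy ht,
    hrep.isResolventCoefficient hψ.1.1 hMae hQ hdQ hθ0 hθ1 hD hy hIy huniq ht', ?_⟩
  rw [hσ.unique ((transferL_represents hT).isSeriesCoefficient hψ.1.1 hMae hP hIx hs)]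
  refine (VarFrame.abs_coefficient_sub_le hP hQ (by positivity) hPQ hR (by positivity) hdP hdQ hε
    (one_le_log_inv hε hεN) hD hx hy hPx hQy hIx hIy (norm_eq_one_of_nonneg hx0 hIx).le
    (norm_eq_one_of_nonneg hy0 hIy).le hs ht).trans (le_of_eq ?_)
  have hG : (growthConst (a, b, c, r) : ℝ) = a * b + 1 := by simp [growthConst]
  simp only [errorConst, stabilityConst]
  push_cast
  rw [hG]
  ring

/-- The transfer operator has an exponential rate of decay larger than `α`. -/
theorem exists_hasDecay {T : ℝ → ℝ} {α B : ℝ} (hT : IsPiecewiseExpanding T)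
    (hα : 0 < α) (hα1 : α < 1) (hB : 0 ≤ B) (hA1 : A1 T α B) (hA2 : A2 T) :
    ∃ C ρ : ℝ, 0 < C ∧ α < ρ ∧ ρ < 1 ∧ HasDecay T C ρ := by
  have hα' : 0 < 1 - α := by linarith
  have hL : 0 ≤ B / (1 - α) := div_nonneg hB hα'.le
  have hP := transferL_LY hT hα hα1 hB hA1 hL (by rw [mul_div_cancel₀ _ hα'.ne'])
  obtain ⟨n, hn, hd⟩ := VarFrame.exists_decays frame_compact hP (noPeripheral_transferL hT hA2)
  have hθ1 := VarFrame.exp_neg_inv_lt_one (R := n) (by exact_mod_cast hn)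
  -- The second entry lies strictly between `α` and `1` and ensures `α < ρ`.
  set ρ := max (Real.exp (-(1 / (n : ℝ)))) ((1 + α) / 2)
  have hρ0 : 0 ≤ ρ := (Real.exp_pos _).le.trans (le_max_left _ _)
  have hC : 0 < 3 * (B / (1 - α) + 1) := by positivity
  refine ⟨_, ρ, hC, lt_of_lt_of_le (by linarith) (le_max_right _ _),
    max_lt hθ1 (by linarith), (hasDecay_iff hT hC.le hρ0).2 ?_⟩
  exact hd.mono le_rfl hC.le (Real.exp_pos _).le (le_max_left _ _)

end UlamDiffusion

end

/-! ### The theorem -/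

open UlamDiffusion

/-- The constant `K` and the threshold `1 / N` are computable functions of natural upper bounds
`a, b, c, r, M, W` of `1/(1-α)`, `B₀`, `C`, `1/(1-ρ)`, `‖ψ‖_∞`, `V ψ`. -/
theorem theorem2p4 :
    ∃ (K : ℕ × ℕ × ℕ × ℕ × ℕ × ℕ → ℕ) (N : ℕ × ℕ × ℕ × ℕ → ℕ),
      Computable K ∧ Computable N ∧ (∀ q, 1 < N q) ∧
      ∀ (T : ℝ → ℝ) (α B₀ : ℝ), UlamDiffusion.IsPiecewiseExpanding T →
        0 < α → α < 1 → 0 ≤ B₀ → UlamDiffusion.A1 T α B₀ → UlamDiffusion.A2 T →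
        (∃ C ρ : ℝ, 0 < C ∧ α < ρ ∧ ρ < 1 ∧ UlamDiffusion.HasDecay T C ρ) ∧
        ∃ h : ℝ → ℝ, UlamDiffusion.IsUniqueFixedDensity (UlamDiffusion.transfer T) h ∧
          ∀ ψ : ℝ → ℝ, UlamDiffusion.MemBV ψ →
            ∃ σsq : ℝ, UlamDiffusion.IsDiffusionCoefficient T ψ h σsq ∧
              ∀ (C ρ : ℝ), 0 < C → 0 < ρ → ρ < 1 → UlamDiffusion.HasDecay T C ρ →
              ∀ a b c r M W : ℕ, (1 - α)⁻¹ ≤ (a : ℝ) → B₀ ≤ (b : ℝ) → C ≤ (c : ℝ) →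
                (1 - ρ)⁻¹ ≤ (r : ℝ) → eLpNorm ψ ⊤ UlamDiffusion.m ≤ (M : ENNReal) →
                UlamDiffusion.essVar ψ ≤ (W : ENNReal) →
              ∀ ε : ℝ, 0 < ε → ε ≤ 1 / (N (a, b, c, r) : ℝ) →
              ∀ η : UlamDiffusion.IntervalPartition, η.MeshLE ε →
                ∃ hε : ℝ → ℝ,
                  UlamDiffusion.IsUniqueFixedDensity (UlamDiffusion.ulam T η) hε ∧
                  ∃ σεsq : ℝ,
                    UlamDiffusion.IsSeriesCoefficient (UlamDiffusion.ulam T η) ψ hε σεsq ∧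
                    UlamDiffusion.IsResolventCoefficient (UlamDiffusion.ulam T η) ψ hε σεsq ∧
                    |σεsq - σsq| ≤ (K (a, b, c, r, M, W) : ℝ) * ε * Real.log ε⁻¹ ^ 2 := by
  refine ⟨errorConst, meshConst, primrec_errorConst.to_comp, primrec_meshConst.to_comp,
    fun q => (by norm_num : 1 < 3).trans_le (Nat.le_add_left _ _), ?_⟩
  intro T α B₀ hT hα hα1 hB hA1 hA2
  refine ⟨exists_hasDecay hT hα hα1 hB hA1 hA2, ?_⟩
  have hα' : 0 < 1 - α := by linarith
  have hP := transferL_LY hT hα hα1 hB hA1 (div_nonneg hB hα'.le)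
    (by rw [mul_div_cancel₀ _ hα'.ne'])
  -- This rate comes from compactness and is not effective. It serves only to obtain uniqueness of
  -- `h` and the limit `σ²`; the error estimate uses the given `C` and `ρ`.
  obtain ⟨n, hn, hd⟩ := VarFrame.exists_decays frame_compact hP (noPeripheral_transferL hT hA2)
  have hθ1 := VarFrame.exp_neg_inv_lt_one (R := n) (by exact_mod_cast hn)
  have hθ0 : 0 ≤ Real.exp (-(1 / (n : ℝ))) := (Real.exp_pos _).le
  obtain ⟨h, hBV, hfix⟩ := exists_fixedDensity hT hA2
  set x : L1 := hBV.1.toL1 h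
  have hx : h =ᵐ[m] x := hBV.1.coeFn_toL1.symm
  have hxS : x ∈ frame.S := mem_frame_of_ae hx hBV
  have hx0 : 0 ≤ᵐ[m] x := hfix.nonneg.trans hx.le
  have hIx : frame.I x = 1 := by rw [frame_I, ← integral_congr_ae hx, hfix.integral_eq]
  have hPx : transferL hT x = x := ((transferL_represents hT).eq_iff hx hx).1 hfix.fixed
  have hux := (transferL_represents hT).isUniqueFixedDensity hxS hx0 hIx hPx fun y hy hI =>
    eq_zero_of_fixed_transferL hT hP hd hθ0 hθ1 hy hI
  refine ⟨x, hux, fun ψ hψ => ?_⟩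
  obtain ⟨A, hA0, hA⟩ := exists_ae_bound hψ
  have hD := mulL_mult hψ hA0 ENNReal.toReal_nonneg hA (ENNReal.ofReal_toReal hψ.2).ge
  obtain ⟨s, hs, -⟩ := exists_hasSum hψ.1.1 hA hd hθ0 hθ1 hD hxS hIx
  have hσ := (transferL_represents hT).isSeriesCoefficient hψ.1.1 hA hP hIx hs
  refine ⟨_, hσ.isDiffusionCoefficient hT hψ hux.1, ?_⟩
  intro C ρ hC hρ hρ1 hdec a b c r M W ha hb hc hr hM hW ε hε hεN η hη
  exact exists_ulam_coefficient hT hα hα1 hB hA1 hxS hx0 hIx hPx hψ hσ hC hρ hρ1 hdec ha hb hc hr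
    hM hW hε hεN η hη
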